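/- All complexes are chain complexes over $\mathbb{C}$ (differentials of degree $-1$, Koszul signs throughout). A \emph{stable cyclic $\mathbb{S}$-module} $V$ is a functor $S\mapsto V((S))$ from finite sets and bijections to chain complexes with $V((S))=0$ for $|S|<3$ (equivalently, complexes $V((n))$, $n\ge 3$, with an action of $\mathbb{S}_n$). Its dual is $V^\vee((S))=\Sigma^{n-3}\mathrm{sgn}_n\otimes V((S))^*$, $n=|S|$. A \emph{(non-unital, stable) cyclic operad} is a stable cyclic $\mathbb{S}$-module $A$ with equivariant, associative, graded symmetric composition maps $A((X\sqcup\{*\}))\otimes A((Y\sqcup\{*\}))\to A((X\sqcup Y))$ of chain complexes. Let $\mathbb{T}_+V$ be the free cyclic operad generated by $V$; it is graded by the number of edges of trees, and $\mathbb{T}_1V((S))$ is the sum, over the trees with one edge and legs $S$, i.e. over the unordered decompositions $S=X\sqcup Y$, of $V((X\sqcup\{*\}))\otimes V((Y\sqcup\{*\}))$. Let $V\subset A$ be a cyclic $\mathbb{S}$-submodule which generates $A$. The pair $(A,V)$ is a \emph{cyclic quadratic operad} if the ideal $\ker(\mathbb{T}_+V\to A)$ is generated by the relations $R=\ker(\mathbb{T}_1V\to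 A)$. (Ideals are closed under the differential, bijections, and composition on either side with arbitrary elements.) Suppose that the total complex $A((S))$ is finite-dimensional for every $S$. Let $\partial$ be the derivation of degree $-1$ of $\mathbb{T}_+A^\vee$ which on the generators $A^\vee$ is the sum, over all trees with one edge, of the suspended adjoints $A^\vee((X\sqcup Y))\to A^\vee((X\sqcup\{*\}))\otimes A^\vee((Y\sqcup\{*\}))$ of the compositions of $A$; thus the cobar operad $\mathsf{B}A$ is $\mathbb{T}_+A^\vee$ with the differential $\delta+\partial$, where $\delta$ is induced by the differential of $A$. Let $\psi:\mathsf{B}A\xrightarrow{\ \partial\ }\mathsf{B}A\to\mathbb{T}_+V^\vee$ be the composition of $\partial$ with the map induced by $V\subset A$, and let the \emph{naive dual} $A^!$ be the cokernel of $\psi$. Let $R^\perp$ be the kernel of the natural map $\mathbb{T}_1V^\vee\cong(\mathbb{T}_1V)^\vee\to R^\vee$ (of degree $1$). \textbf{Proposition.} Let $(A,V)$ be a cyclic quadratic operad with relations $R$, where the generators $V$ may lie in arbitrary arities, and let every total complex $A((S))$ be finite-dimensional. Then the image of $\psi$ is an ideal of $\mathbb{T}_+V^\vee$, so that $A^!$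 is a cyclic operad, with finite-dimensional total complexes $A^!((S))$. The natural map $V^\vee\to A^!$ is injective, and $(A^!,V^\vee)$ is a cyclic quadratic operad with relations $\ker(\mathbb{T}_1V^\vee\to A^!)=R^\perp$. -/

import Mathlib

open scoped TensorProduct DirectSum

universe u v w

namespace CycOp

/-! ### Signs -/

/-- The Koszul sign `(-1)^n`. -/
noncomputable def ksign (n : ℤ) : ℂ := (-1) ^ n

theorem ksign_zero : ksign 0 = 1 := by simp [ksign]

theorem ksign_add (m n : ℤ) : ksign (m + n) = ksign m * ksign n := by
  simp [ksign, zpow_add₀]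

theorem ksign_even {n : ℤ} (h : Even n) : ksign n = 1 := h.neg_one_zpow

theorem ksign_mul_self (n : ℤ) : ksign n * ksign n = 1 := by
  rw [← ksign_add]; exact ksign_even ⟨n, rfl⟩

theorem ksign_congr {m n : ℤ} (h : Even (m - n)) : ksign m = ksign n := by
  have : m = (m - n) + n := by ring
  rw [this, ksign_add, ksign_even h, one_mul]

/-- A chosen enumeration of a finite set `S`, i.e. a chosen generator of the line `det(S)`. -/
noncomputable def enum (S : Type) [Finite S] : S ≃ Fin (Nat.card S) := Finite.equivFin S

/-- The sign of an enumeration `e` of `S` relative to the chosen one: the exterior product of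
the elements of `S` in the order `e` is `orient e` times the chosen generator of `det(S)`. -/
noncomputable def orient {n : ℕ} {S : Type} (e : Fin n ≃ S) : ℤˣ :=
  haveI : Finite S := Finite.of_equiv _ e
  have _h : Nat.card S = n := by rw [← Nat.card_congr e, Nat.card_fin]
  Equiv.Perm.sign ((e.trans (enum S)).trans (finCongr _h))

open Classical in
/-- The sign by which a bijection `g : S ≃ T` of finite sets acts from `det(S)` to `det(T)`,
with respect to the chosen generators; for `S = T` it is the sign of the permutation `g`. -/
noncomputable def detSign {S T : Type} (g : S ≃ T) : ℤˣ :=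
  if _h : Finite S then orient ((enum S).symm.trans g) else 1

theorem orient_enum (S : Type) [Finite S] : orient (enum S).symm = 1 := by
  unfold orient
  simp

theorem orient_trans {n : ℕ} {S T : Type} (e : Fin n ≃ S) (g : S ≃ T) :
    orient (e.trans g) = orient e * detSign g := by
  have : Finite S := Finite.of_equiv _ e
  have : Finite T := Finite.of_equiv _ g
  obtain rfl : n = Nat.card S := by rw [← Nat.card_congr e, Nat.card_fin]
  unfold detSign
  rw [dif_pos ‹Finite S›, mul_comm]
  unfold orient
  rw [← Equiv.Perm.sign_trans]
  exact congrArg Equiv.Perm.sign (Equiv.ext fun x => by simp)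

theorem orient_perm {n : ℕ} {S : Type} (σ : Equiv.Perm (Fin n)) (e : Fin n ≃ S) :
    orient (σ.trans e) = Equiv.Perm.sign σ * orient e := by
  unfold orient
  rw [mul_comm, ← Equiv.Perm.sign_trans]
  rfl

theorem detSign_eq {n : ℕ} {S T : Type} (e : Fin n ≃ S) (g : S ≃ T) :
    detSign g = orient e * orient (e.trans g) := by
  rw [orient_trans, ← mul_assoc, Int.units_mul_self, one_mul]

theorem detSign_refl (S : Type) : detSign (Equiv.refl S) = 1 := by
  by_cases h : Finite S
  · rw [detSign_eq (enum S).symm]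
    exact Int.units_mul_self _
  · simp [detSign, h]

theorem detSign_trans {S T U : Type} (g : S ≃ T) (g' : T ≃ U) :
    detSign (g.trans g') = detSign g * detSign g' := by
  by_cases h : Finite S
  · have h1 := orient_trans (enum S).symm (g.trans g')
    rw [← Equiv.trans_assoc, orient_trans, orient_trans, orient_enum] at h1
    simpa using h1.symm
  · have h2 : ¬ Finite T := fun hT => h (Finite.of_equiv _ g.symm)
    simp [detSign, h, h2]

theorem detSign_symm {S T : Type} (g : S ≃ T) : detSign g.symm = detSign g := by
  have h := detSign_trans g g.symm
  rw [Equiv.self_trans_symm, detSign_refl] at h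
  rw [← mul_one (detSign g), h, ← mul_assoc, Int.units_mul_self, one_mul]

/-- `detSign` is the usual sign character on permutations. -/
theorem detSign_perm {S : Type} [Fintype S] [DecidableEq S] (σ : Equiv.Perm S) :
    detSign σ = Equiv.Perm.sign σ := by
  rw [detSign_eq (enum S).symm, orient_enum, one_mul]
  have : ((enum S).symm.trans σ) = (((enum S).permCongr σ).trans (enum S).symm) := by
    ext x; simp [Equiv.permCongr_apply]
  rw [this, orient_perm, orient_enum, mul_one, Equiv.Perm.sign_permCongr]

/-- The complex number `±1` by which `g` acts on determinant lines. -/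
noncomputable def detC {S T : Type} (g : S ≃ T) : ℂ := ((detSign g : ℤ) : ℂ)

theorem detC_refl (S : Type) : detC (Equiv.refl S) = 1 := by simp [detC, detSign_refl]

theorem detC_trans {S T U : Type} (g : S ≃ T) (g' : T ≃ U) :
    detC (g.trans g') = detC g * detC g' := by simp [detC, detSign_trans]

/-! ### Stable cyclic modules -/

/-- A stable cyclic `𝕊`-module: a functor from finite sets and bijections to chain complexes
over `ℂ`, where `X S i` is the component of degree `i` of the complex `V((S))`, vanishing if `S`
has less than three elements.  For convenience `S` runs over all types, but `V((S))` is zero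
for infinite `S` (whose `Nat.card` is `0`).  The argument `i = j` of `map`, and the argument
`j + 1 = i` of `d`, merely avoid casts between equal degrees. -/
structure CyclicModule where
  X : Type → ℤ → Type u
  [acg : ∀ S i, AddCommGroup (X S i)]
  [mod : ∀ S i, Module ℂ (X S i)]
  map : ∀ {S T : Type} {i j : ℤ}, S ≃ T → i = j → (X S i →ₗ[ℂ] X T j)
  d : ∀ {S : Type} {i j : ℤ}, j + 1 = i → (X S i →ₗ[ℂ] X S j)
  map_refl : ∀ {S : Type} {i : ℤ} (x : X S i), map (Equiv.refl S) rfl x = x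
  map_trans : ∀ {S T U : Type} {i j k : ℤ} (g : S ≃ T) (g' : T ≃ U) (h : i = j) (h' : j = k)
    (x : X S i), map g' h' (map g h x) = map (g.trans g') (h.trans h') x
  map_d : ∀ {S T : Type} {i j k l : ℤ} (g : S ≃ T) (h : i = k) (h' : j = l) (hi : j + 1 = i)
    (hk : l + 1 = k) (x : X S i), map g h' (d hi x) = d hk (map g h x)
  d_d : ∀ {S : Type} {i j k : ℤ} (h : j + 1 = i) (h' : k + 1 = j) (x : X S i), d h' (d h x) = 0
  stable : ∀ (S : Type) (i : ℤ), Nat.card S < 3 → Subsingleton (X S i)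

attribute [instance] CyclicModule.acg CyclicModule.mod

/-- The total complex `V((S))` is finite dimensional, for every `S`. -/
class CyclicModule.FinDim (V : CyclicModule.{u}) : Prop where
  finite : ∀ S : Type, FiniteDimensional ℂ (⨁ i : ℤ, V.X S i)

instance CyclicModule.FinDim.finiteX (V : CyclicModule.{u}) [V.FinDim] (S : Type) (i : ℤ) :
    FiniteDimensional ℂ (V.X S i) := by
  have := CyclicModule.FinDim.finite (V := V) S
  exact Module.Finite.of_injective (DirectSum.lof ℂ ℤ (V.X S) i) (DFinsupp.single_injective)

/-- Morphisms of cyclic `𝕊`-modules (of chain complexes). -/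
structure CyclicModule.Hom (V : CyclicModule.{u}) (W : CyclicModule.{v}) where
  f : ∀ (S : Type) (i : ℤ), V.X S i →ₗ[ℂ] W.X S i
  f_map : ∀ {S T : Type} {i j : ℤ} (g : S ≃ T) (h : i = j) (x : V.X S i),
    f T j (V.map g h x) = W.map g h (f S i x)
  f_d : ∀ {S : Type} {i j : ℤ} (h : j + 1 = i) (x : V.X S i),
    f S j (V.d h x) = W.d h (f S i x)

/-- The dual `V^∨((S)) = Σ^{n-3} sgn_n ⊗ V((S))^*`, `n = |S|`.  In degree `i` it is the linear
dual of the component of degree `n - 3 - i` of `V((S))`; the suspension multiplies the adjoint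
differential by `(-1)^{n-3}`. -/
noncomputable def dual (V : CyclicModule.{u}) : CyclicModule.{u} where
  X S i := Module.Dual ℂ (V.X S ((Nat.card S : ℤ) - 3 - i))
  map {S T i j} g h := detC g •
    (V.map g.symm (by rw [Nat.card_congr g, h]) :
      V.X T ((Nat.card T : ℤ) - 3 - j) →ₗ[ℂ] V.X S ((Nat.card S : ℤ) - 3 - i)).dualMap
  d {S i j} h := ksign ((Nat.card S : ℤ) - 3) •
    (V.d (by omega) :
      V.X S ((Nat.card S : ℤ) - 3 - j) →ₗ[ℂ] V.X S ((Nat.card S : ℤ) - 3 - i)).dualMap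
  map_refl {S i} f := by
    ext x
    simp [detC_refl, V.map_refl]
  map_trans {S T U i j k} g g' h h' f := by
    ext x
    simp only [LinearMap.smul_apply, LinearMap.dualMap_apply, map_smul, smul_eq_mul,
      V.map_trans, detC_trans]
    rw [← mul_assoc]
    rfl
  map_d {S T i j k l} g h h' hi hk f := by
    ext x
    simp only [LinearMap.smul_apply, LinearMap.dualMap_apply, map_smul, smul_eq_mul]
    have e : (Nat.card S : ℤ) = Nat.card T := by rw [Nat.card_congr g]
    have e' : ksign ((Nat.card S : ℤ) - 3) = ksign ((Nat.card T : ℤ) - 3) := by rw [e]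
    rw [V.map_d g.symm (i := (Nat.card T : ℤ) - 3 - l) (j := (Nat.card T : ℤ) - 3 - k)
      (k := (Nat.card S : ℤ) - 3 - j) (l := (Nat.card S : ℤ) - 3 - i) (by omega) (by omega)
      (by omega) (by omega), e']
    ring
  d_d {S i j k} h h' f := by
    ext x
    simp [V.d_d]
  stable S i hS := by
    have := V.stable S ((Nat.card S : ℤ) - 3 - i) hS
    exact ⟨fun f g => by ext x; rw [Subsingleton.elim x 0, map_zero, map_zero]⟩

theorem dual_map_apply (V : CyclicModule.{u}) {S T : Type} {i j : ℤ} (g : S ≃ T) (h : i = j)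
    (f : Module.Dual ℂ (V.X S ((Nat.card S : ℤ) - 3 - i)))
    (x : V.X T ((Nat.card T : ℤ) - 3 - j)) :
    DFunLike.coe (F := Module.Dual ℂ (V.X T ((Nat.card T : ℤ) - 3 - j))) ((dual V).map g h f) x =
      detC g * f (V.map g.symm (by rw [Nat.card_congr g, h]) x) := rfl

theorem dual_d_apply (V : CyclicModule.{u}) {S : Type} {i j : ℤ} (h : j + 1 = i)
    (f : Module.Dual ℂ (V.X S ((Nat.card S : ℤ) - 3 - i)))
    (x : V.X S ((Nat.card S : ℤ) - 3 - j)) :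
    DFunLike.coe (F := Module.Dual ℂ (V.X S ((Nat.card S : ℤ) - 3 - j))) ((dual V).d h f) x =
      ksign ((Nat.card S : ℤ) - 3) * f (V.d (by omega) x) := rfl

/-- The morphism `W^∨ → V^∨` dual to `V → W`. -/
noncomputable def CyclicModule.Hom.dual {V : CyclicModule.{u}} {W : CyclicModule.{v}}
    (φ : V.Hom W) : (dual W).Hom (CycOp.dual V) where
  f S i := (φ.f S ((Nat.card S : ℤ) - 3 - i)).dualMap
  f_map {S T i j} g h x := by
    refine LinearMap.ext fun y => ?_
    refine (dual_map_apply W g h x _).trans ?_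
    refine Eq.trans ?_ (dual_map_apply V g h _ y).symm
    exact congrArg (fun z => detC g * DFunLike.coe (F := Module.Dual ℂ _) x z)
      (φ.f_map g.symm (by rw [Nat.card_congr g, h]) y).symm
  f_d {S i j} h x := by
    refine LinearMap.ext fun y => ?_
    refine (dual_d_apply W h x _).trans ?_
    refine Eq.trans ?_ (dual_d_apply V h _ y).symm
    exact congrArg (fun z => ksign ((Nat.card S : ℤ) - 3) *
      DFunLike.coe (F := Module.Dual ℂ _) x z) (φ.f_d (by omega) y).symm

/-! ### Stable cyclic operads -/

/-- Moves the distinguished flag out of the second summand. -/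
def sumOption (S T : Type) : S ⊕ Option T ≃ Option (S ⊕ T) where
  toFun
    | Sum.inl s => some (Sum.inl s)
    | Sum.inr none => none
    | Sum.inr (some t) => some (Sum.inr t)
  invFun
    | none => Sum.inr none
    | some (Sum.inl s) => Sum.inl s
    | some (Sum.inr t) => Sum.inr (some t)
  left_inv := by rintro (s | _ | t) <;> rfl
  right_inv := by rintro (_ | s | t) <;> rfl

/-- Moves the distinguished flag out of the first summand. -/
def optionSum (S T : Type) : Option S ⊕ T ≃ Option (S ⊕ T) where
  toFun
    | Sum.inl none => none
    | Sum.inl (some s) => some (Sum.inl s)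
    | Sum.inr t => some (Sum.inr t)
  invFun
    | none => Sum.inl none
    | some (Sum.inl s) => Sum.inl (some s)
    | some (Sum.inr t) => Sum.inr t
  left_inv := by rintro ((_ | s) | t) <;> rfl
  right_inv := by rintro (_ | s | t) <;> rfl

/-- Exchanges the two distinguished flags. -/
def optionSwap (S : Type) : Option (Option S) ≃ Option (Option S) where
  toFun
    | none => some none
    | some none => none
    | some (some s) => some (some s)
  invFun
    | none => some none
    | some none => none
    | some (some s) => some (some s)
  left_inv := by rintro (_ | _ | s) <;> rfl
  right_inv := by rintro (_ | _ | s) <;> rfl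

/-- A (non-unital, stable) cyclic operad.  The operation `comp a b` glues the flag `none` of
`a ∈ A((S ∪ {none}))` to the flag `none` of `b ∈ A((T ∪ {none}))`; together with the action of
bijections it encodes all the products `a ∘_i b`.  The axioms are equivariance, (graded)
symmetry of the gluing, which is `(a ∘_k b)^* = (-1)^{|a||b|} b^* ∘_1 a^*`, associativity, and
the Leibniz rule. -/
structure CyclicOperad extends CyclicModule.{u} where
  comp : ∀ {S T : Type} {i j k : ℤ}, i + j = k →
    (X (Option S) i →ₗ[ℂ] X (Option T) j →ₗ[ℂ] X (S ⊕ T) k)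
  comp_map : ∀ {S S' T T' : Type} {i i' j j' k k' : ℤ} (f : S ≃ S') (g : T ≃ T')
    (hi : i = i') (hj : j = j') (hk : k = k') (h : i + j = k) (h' : i' + j' = k')
    (a : X (Option S) i) (b : X (Option T) j),
    comp h' (map (Equiv.optionCongr f) hi a) (map (Equiv.optionCongr g) hj b) =
      map (Equiv.sumCongr f g) hk (comp h a b)
  comp_comm : ∀ {S T : Type} {i j k : ℤ} (h : i + j = k) (h' : j + i = k)
    (a : X (Option S) i) (b : X (Option T) j),
    map (Equiv.sumComm S T) rfl (comp h a b) = ksign (i * j) • comp h' b a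
  comp_assoc : ∀ {S T U : Type} {i j k l m n : ℤ} (hl : i + j = l) (hm : j + k = m)
    (h : l + k = n) (h' : i + m = n) (a : X (Option S) i) (b : X (Option (Option T)) j)
    (c : X (Option U) k),
    map (Equiv.sumAssoc S T U) rfl (comp h (map (sumOption S T) rfl (comp hl a b)) c) =
      comp h' a (map (optionSum T U) rfl (comp hm (map (optionSwap T) rfl b) c))
  d_comp : ∀ {S T : Type} {i j k i' j' k' : ℤ} (h : i + j = k) (hi : i' + 1 = i)
    (hj : j' + 1 = j) (hk : k' + 1 = k) (h1 : i' + j = k') (h2 : i + j' = k')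
    (a : X (Option S) i) (b : X (Option T) j),
    d hk (comp h a b) = comp h1 (d hi a) b + ksign i • comp h2 a (d hj b)

/-! ### The free cyclic operad -/

/-- Formal expressions in elements of `V`: trees of gluings decorated by elements of `V`, and
their linear combinations. -/
inductive Expr (V : CyclicModule.{u}) : Type → ℤ → Type (max 1 u)
  | gen {S : Type} {i : ℤ} (v : V.X S i) : Expr V S i
  | zero {S : Type} {i : ℤ} : Expr V S i
  | add {S : Type} {i : ℤ} (x y : Expr V S i) : Expr V S i
  | smul {S : Type} {i : ℤ} (c : ℂ) (x : Expr V S i) : Expr V S i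
  | map {S T : Type} {i j : ℤ} (g : S ≃ T) (h : i = j) (x : Expr V S i) : Expr V T j
  | comp {S T : Type} {i j k : ℤ} (h : i + j = k) (x : Expr V (Option S) i)
      (y : Expr V (Option T) j) : Expr V (S ⊕ T) k

/-- The congruence on expressions generated by the vector space axioms, the (bi)linearity of all
operations, the compatibility of `gen` with bijections, and the axioms of a cyclic operad. -/
inductive Rel (V : CyclicModule.{u}) :
    ∀ {S : Type} {i : ℤ}, Expr V S i → Expr V S i → Prop
  | refl {S : Type} {i : ℤ} (x : Expr V S i) : Rel V x x
  | symm {S : Type} {i : ℤ} {x y : Expr V S i} : Rel V x y → Rel V y x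
  | trans {S : Type} {i : ℤ} {x y z : Expr V S i} : Rel V x y → Rel V y z → Rel V x z
  | add_congr {S : Type} {i : ℤ} {x x' y y' : Expr V S i} :
      Rel V x x' → Rel V y y' → Rel V (x.add y) (x'.add y')
  | smul_congr {S : Type} {i : ℤ} (c : ℂ) {x x' : Expr V S i} :
      Rel V x x' → Rel V (x.smul c) (x'.smul c)
  | map_congr {S T : Type} {i j : ℤ} (g : S ≃ T) (h : i = j) {x x' : Expr V S i} :
      Rel V x x' → Rel V (x.map g h) (x'.map g h)
  | comp_congr {S T : Type} {i j k : ℤ} (h : i + j = k) {x x' : Expr V (Option S) i}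
      {y y' : Expr V (Option T) j} : Rel V x x' → Rel V y y' →
      Rel V (Expr.comp h x y) (Expr.comp h x' y')
  | add_assoc {S : Type} {i : ℤ} (x y z : Expr V S i) :
      Rel V ((x.add y).add z) (x.add (y.add z))
  | add_comm {S : Type} {i : ℤ} (x y : Expr V S i) : Rel V (x.add y) (y.add x)
  | zero_add {S : Type} {i : ℤ} (x : Expr V S i) : Rel V (Expr.zero.add x) x
  | one_smul {S : Type} {i : ℤ} (x : Expr V S i) : Rel V (x.smul 1) x
  | zero_smul {S : Type} {i : ℤ} (x : Expr V S i) : Rel V (x.smul 0) Expr.zero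
  | mul_smul {S : Type} {i : ℤ} (c c' : ℂ) (x : Expr V S i) :
      Rel V (x.smul (c * c')) ((x.smul c').smul c)
  | smul_add {S : Type} {i : ℤ} (c : ℂ) (x y : Expr V S i) :
      Rel V ((x.add y).smul c) ((x.smul c).add (y.smul c))
  | add_smul {S : Type} {i : ℤ} (c c' : ℂ) (x : Expr V S i) :
      Rel V (x.smul (c + c')) ((x.smul c).add (x.smul c'))
  | gen_add {S : Type} {i : ℤ} (v w : V.X S i) :
      Rel V (Expr.gen (v + w)) ((Expr.gen v).add (Expr.gen w))
  | gen_smul {S : Type} {i : ℤ} (c : ℂ) (v : V.X S i) :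
      Rel V (Expr.gen (c • v)) ((Expr.gen v).smul c)
  | map_add {S T : Type} {i j : ℤ} (g : S ≃ T) (h : i = j) (x y : Expr V S i) :
      Rel V ((x.add y).map g h) ((x.map g h).add (y.map g h))
  | map_smul {S T : Type} {i j : ℤ} (g : S ≃ T) (h : i = j) (c : ℂ) (x : Expr V S i) :
      Rel V ((x.smul c).map g h) ((x.map g h).smul c)
  | comp_add_left {S T : Type} {i j k : ℤ} (h : i + j = k) (x x' : Expr V (Option S) i)
      (y : Expr V (Option T) j) :
      Rel V (Expr.comp h (x.add x') y) ((Expr.comp h x y).add (Expr.comp h x' y))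
  | comp_add_right {S T : Type} {i j k : ℤ} (h : i + j = k) (x : Expr V (Option S) i)
      (y y' : Expr V (Option T) j) :
      Rel V (Expr.comp h x (y.add y')) ((Expr.comp h x y).add (Expr.comp h x y'))
  | comp_smul_left {S T : Type} {i j k : ℤ} (h : i + j = k) (c : ℂ) (x : Expr V (Option S) i)
      (y : Expr V (Option T) j) :
      Rel V (Expr.comp h (x.smul c) y) ((Expr.comp h x y).smul c)
  | comp_smul_right {S T : Type} {i j k : ℤ} (h : i + j = k) (c : ℂ) (x : Expr V (Option S) i)
      (y : Expr V (Option T) j) :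
      Rel V (Expr.comp h x (y.smul c)) ((Expr.comp h x y).smul c)
  | map_gen {S T : Type} {i j : ℤ} (g : S ≃ T) (h : i = j) (v : V.X S i) :
      Rel V ((Expr.gen v).map g h) (Expr.gen (V.map g h v))
  | map_refl {S : Type} {i : ℤ} (x : Expr V S i) : Rel V (x.map (Equiv.refl S) rfl) x
  | map_trans {S T U : Type} {i j k : ℤ} (g : S ≃ T) (g' : T ≃ U) (h : i = j) (h' : j = k)
      (x : Expr V S i) : Rel V ((x.map g h).map g' h') (x.map (g.trans g') (h.trans h'))
  | comp_map {S S' T T' : Type} {i i' j j' k k' : ℤ} (f : S ≃ S') (g : T ≃ T')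
      (hi : i = i') (hj : j = j') (hk : k = k') (h : i + j = k) (h' : i' + j' = k')
      (a : Expr V (Option S) i) (b : Expr V (Option T) j) :
      Rel V (Expr.comp h' (a.map (Equiv.optionCongr f) hi) (b.map (Equiv.optionCongr g) hj))
        ((Expr.comp h a b).map (Equiv.sumCongr f g) hk)
  | comp_comm {S T : Type} {i j k : ℤ} (h : i + j = k) (h' : j + i = k)
      (a : Expr V (Option S) i) (b : Expr V (Option T) j) :
      Rel V ((Expr.comp h a b).map (Equiv.sumComm S T) rfl)
        ((Expr.comp h' b a).smul (ksign (i * j)))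
  | comp_assoc {S T U : Type} {i j k l m n : ℤ} (hl : i + j = l) (hm : j + k = m)
      (h : l + k = n) (h' : i + m = n) (a : Expr V (Option S) i)
      (b : Expr V (Option (Option T)) j) (c : Expr V (Option U) k) :
      Rel V
        ((Expr.comp h ((Expr.comp hl a b).map (sumOption S T) rfl) c).map
          (Equiv.sumAssoc S T U) rfl)
        (Expr.comp h' a
          ((Expr.comp hm (b.map (optionSwap T) rfl) c).map (optionSum T U) rfl))

/-- The setoid of `Rel`. -/
def relSetoid (V : CyclicModule.{u}) (S : Type) (i : ℤ) : Setoid (Expr V S i) where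
  r := Rel V
  iseqv := ⟨Rel.refl, Rel.symm, Rel.trans⟩

/-- The component of degree `i` of `𝕋₊V((S))`. -/
def FreeX (V : CyclicModule.{u}) (S : Type) (i : ℤ) : Type (max 1 u) :=
  Quotient (relSetoid V S i)

namespace FreeX

variable {V : CyclicModule.{u}}

/-- The class of an expression. -/
def mk {S : Type} {i : ℤ} (x : Expr V S i) : FreeX V S i := Quotient.mk (relSetoid V S i) x

theorem mk_eq {S : Type} {i : ℤ} {x y : Expr V S i} (h : Rel V x y) : mk x = mk y :=
  Quotient.sound (s := relSetoid V S i) h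

instance {S : Type} {i : ℤ} : Zero (FreeX V S i) := ⟨mk Expr.zero⟩

instance {S : Type} {i : ℤ} : Add (FreeX V S i) :=
  ⟨Quotient.map₂ Expr.add fun _ _ h _ _ h' => Rel.add_congr h h'⟩

instance {S : Type} {i : ℤ} : SMul ℂ (FreeX V S i) :=
  ⟨fun c => Quotient.map (Expr.smul c) fun _ _ h => Rel.smul_congr c h⟩

theorem mk_zero {S : Type} {i : ℤ} : mk (Expr.zero : Expr V S i) = 0 := rfl

theorem mk_add {S : Type} {i : ℤ} (x y : Expr V S i) : mk (x.add y) = mk x + mk y := rfl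

theorem mk_smul {S : Type} {i : ℤ} (c : ℂ) (x : Expr V S i) : mk (x.smul c) = c • mk x := rfl

theorem ind {S : Type} {i : ℤ} {p : FreeX V S i → Prop} (h : ∀ x, p (mk x)) (x : FreeX V S i) :
    p x := Quotient.inductionOn x h

noncomputable instance {S : Type} {i : ℤ} : Neg (FreeX V S i) := ⟨fun x => (-1 : ℂ) • x⟩

noncomputable instance {S : Type} {i : ℤ} : AddCommGroup (FreeX V S i) where
  add_assoc x y z := by
    induction x using ind; induction y using ind; induction z using ind
    exact mk_eq (Rel.add_assoc _ _ _)
  zero_add x := by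
    induction x using ind
    exact mk_eq (Rel.zero_add _)
  add_zero x := by
    induction x using ind
    exact mk_eq (Rel.trans (Rel.add_comm _ _) (Rel.zero_add _))
  add_comm x y := by
    induction x using ind; induction y using ind
    exact mk_eq (Rel.add_comm _ _)
  neg_add_cancel x := by
    induction x using ind with
    | h x =>
      refine mk_eq (Rel.trans (Rel.add_congr (Rel.refl _) (Rel.symm (Rel.one_smul x))) ?_)
      refine Rel.trans (Rel.symm (Rel.add_smul (-1) 1 x)) ?_
      rw [neg_add_cancel]
      exact Rel.zero_smul x
  nsmul := nsmulRec
  zsmul := zsmulRec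

noncomputable instance {S : Type} {i : ℤ} : Module ℂ (FreeX V S i) where
  one_smul x := by
    induction x using ind
    exact mk_eq (Rel.one_smul _)
  mul_smul c c' x := by
    induction x using ind
    exact mk_eq (Rel.mul_smul c c' _)
  smul_zero c := by
    refine Eq.trans (mk_eq (Rel.smul_congr c (Rel.symm (Rel.zero_smul Expr.zero)))) ?_
    refine Eq.trans (mk_eq (Rel.symm (Rel.mul_smul c 0 Expr.zero))) ?_
    rw [mul_zero]
    exact mk_eq (Rel.zero_smul _)
  smul_add c x y := by
    induction x using ind; induction y using ind
    exact mk_eq (Rel.smul_add c _ _)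
  add_smul c c' x := by
    induction x using ind
    exact mk_eq (Rel.add_smul c c' _)
  zero_smul x := by
    induction x using ind
    exact mk_eq (Rel.zero_smul _)

/-- The inclusion of generators. -/
def gen {S : Type} {i : ℤ} : V.X S i →ₗ[ℂ] FreeX V S i where
  toFun v := mk (Expr.gen v)
  map_add' v w := mk_eq (Rel.gen_add v w)
  map_smul' c v := mk_eq (Rel.gen_smul c v)

/-- The action of bijections. -/
def map {S T : Type} {i j : ℤ} (g : S ≃ T) (h : i = j) : FreeX V S i →ₗ[ℂ] FreeX V T j where
  toFun := Quotient.map (Expr.map g h) fun _ _ r => Rel.map_congr g h r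
  map_add' x y := by
    induction x using ind; induction y using ind
    exact mk_eq (Rel.map_add g h _ _)
  map_smul' c x := by
    induction x using ind
    exact mk_eq (Rel.map_smul g h c _)

/-- Gluing. -/
noncomputable def comp {S T : Type} {i j k : ℤ} (h : i + j = k) :
    FreeX V (Option S) i →ₗ[ℂ] FreeX V (Option T) j →ₗ[ℂ] FreeX V (S ⊕ T) k :=
  LinearMap.mk₂ ℂ (Quotient.map₂ (Expr.comp h) fun _ _ r _ _ r' => Rel.comp_congr h r r')
    (by
      intro x x' y
      induction x using ind; induction x' using ind; induction y using ind
      exact mk_eq (Rel.comp_add_left h _ _ _))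
    (by
      intro c x y
      induction x using ind; induction y using ind
      exact mk_eq (Rel.comp_smul_left h c _ _))
    (by
      intro x y y'
      induction x using ind; induction y using ind; induction y' using ind
      exact mk_eq (Rel.comp_add_right h _ _ _))
    (by
      intro c x y
      induction x using ind; induction y using ind
      exact mk_eq (Rel.comp_smul_right h c _ _))

theorem mk_gen {S : Type} {i : ℤ} (v : V.X S i) : mk (Expr.gen v) = gen v := rfl

theorem mk_map {S T : Type} {i j : ℤ} (g : S ≃ T) (h : i = j) (x : Expr V S i) :
    mk (x.map g h) = map g h (mk x) := rfl

theorem mk_comp {S T : Type} {i j k : ℤ} (h : i + j = k) (x : Expr V (Option S) i)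
    (y : Expr V (Option T) j) : mk (Expr.comp h x y) = comp h (mk x) (mk y) := rfl

theorem map_gen {S T : Type} {i j : ℤ} (g : S ≃ T) (h : i = j) (v : V.X S i) :
    map g h (gen v) = gen (V.map g h v) := mk_eq (Rel.map_gen g h v)

theorem map_refl {S : Type} {i : ℤ} (x : FreeX V S i) : map (Equiv.refl S) rfl x = x := by
  induction x using ind
  exact mk_eq (Rel.map_refl _)

theorem map_trans {S T U : Type} {i j k : ℤ} (g : S ≃ T) (g' : T ≃ U) (h : i = j) (h' : j = k)
    (x : FreeX V S i) : map g' h' (map g h x) = map (g.trans g') (h.trans h') x := by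
  induction x using ind
  exact mk_eq (Rel.map_trans g g' h h' _)

theorem comp_map {S S' T T' : Type} {i i' j j' k k' : ℤ} (f : S ≃ S') (g : T ≃ T')
    (hi : i = i') (hj : j = j') (hk : k = k') (h : i + j = k) (h' : i' + j' = k')
    (a : FreeX V (Option S) i) (b : FreeX V (Option T) j) :
    comp h' (map (Equiv.optionCongr f) hi a) (map (Equiv.optionCongr g) hj b) =
      map (Equiv.sumCongr f g) hk (comp h a b) := by
  induction a using ind; induction b using ind
  exact mk_eq (Rel.comp_map f g hi hj hk h h' _ _)

theorem comp_comm {S T : Type} {i j k : ℤ} (h : i + j = k) (h' : j + i = k)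
    (a : FreeX V (Option S) i) (b : FreeX V (Option T) j) :
    map (Equiv.sumComm S T) rfl (comp h a b) = ksign (i * j) • comp h' b a := by
  induction a using ind; induction b using ind
  exact mk_eq (Rel.comp_comm h h' _ _)

theorem comp_assoc {S T U : Type} {i j k l m n : ℤ} (hl : i + j = l) (hm : j + k = m)
    (h : l + k = n) (h' : i + m = n) (a : FreeX V (Option S) i)
    (b : FreeX V (Option (Option T)) j) (c : FreeX V (Option U) k) :
    map (Equiv.sumAssoc S T U) rfl (comp h (map (sumOption S T) rfl (comp hl a b)) c) =
      comp h' a (map (optionSum T U) rfl (comp hm (map (optionSwap T) rfl b) c)) := by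
  induction a using ind; induction b using ind; induction c using ind
  exact mk_eq (Rel.comp_assoc hl hm h h' _ _ _)

theorem stable_aux {S : Type} {i : ℤ} (x : Expr V S i) (hS : Nat.card S < 3) :
    mk x = 0 := by
  induction x with
  | @gen S i v =>
    have := V.stable S i hS
    rw [mk_gen, Subsingleton.elim v 0, _root_.map_zero]
  | zero => rfl
  | add x y hx hy => rw [mk_add, hx hS, hy hS, add_zero]
  | smul c x hx => rw [mk_smul, hx hS, smul_zero]
  | map g h x hx => rw [mk_map, hx (by rwa [Nat.card_congr g]), _root_.map_zero]
  | @comp S T i j k h x y hx hy =>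
    have key : Nat.card (Option S) < 3 ∨ Nat.card (Option T) < 3 := by
      by_cases hf : Finite S
      · by_cases hf' : Finite T
        · rw [Finite.card_option, Finite.card_option]
          rw [Nat.card_sum] at hS
          omega
        · have : Infinite T := not_finite_iff_infinite.mp hf'
          right
          simp
      · have : Infinite S := not_finite_iff_infinite.mp hf
        left
        simp
    rcases key with h1 | h1
    · rw [mk_comp, hx h1, _root_.map_zero, LinearMap.zero_apply]
    · rw [mk_comp, hy h1, _root_.map_zero]

/-- The extension to expressions of a map `D` of degree `-1` defined on generators, by the rule
`D (a ∘ b) = D a ∘ b + (-1)^{|a|} a ∘ D b`. -/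
noncomputable def derivAux
    (D : ∀ {S : Type} {i j : ℤ}, j + 1 = i → (V.X S i →ₗ[ℂ] FreeX V S j)) :
    ∀ {S : Type} {i : ℤ}, Expr V S i → ∀ j : ℤ, j + 1 = i → FreeX V S j
  | _, _, Expr.gen v, _, hj => D hj v
  | _, _, Expr.zero, _, _ => 0
  | _, _, Expr.add x y, j, hj => derivAux D x j hj + derivAux D y j hj
  | _, _, Expr.smul c x, j, hj => c • derivAux D x j hj
  | _, _, Expr.map g h x, j, hj => map g rfl (derivAux D x j (hj.trans h.symm))
  | _, _, Expr.comp (i := i) (j := i') h x y, j, hj =>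
    comp (i := i - 1) (by omega) (derivAux D x (i - 1) (by omega)) (mk y) +
      ksign i • comp (j := i' - 1) (by omega) (mk x) (derivAux D y (i' - 1) (by omega))

theorem derivAux_sound
    (D : ∀ {S : Type} {i j : ℤ}, j + 1 = i → (V.X S i →ₗ[ℂ] FreeX V S j))
    (hD : ∀ {S T : Type} {i j k l : ℤ} (g : S ≃ T) (h : i = k) (h' : j = l) (hi : j + 1 = i)
      (hk : l + 1 = k) (v : V.X S i), map g h' (D hi v) = D hk (V.map g h v))
    {S : Type} {i : ℤ} {x y : Expr V S i} (r : Rel V x y) (j : ℤ) (hj : j + 1 = i) :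
    derivAux D x j hj = derivAux D y j hj := by
  induction r generalizing j with
  | refl => rfl
  | symm _ ih => exact (ih j hj).symm
  | trans _ _ ih ih' => exact (ih j hj).trans (ih' j hj)
  | add_congr _ _ ih ih' => simp only [derivAux, ih, ih']
  | smul_congr c _ ih => simp only [derivAux, ih]
  | map_congr g h _ ih => simp only [derivAux, ih]
  | comp_congr h r r' ih ih' => simp only [derivAux, ih, ih', mk_eq r, mk_eq r']
  | add_assoc => simp only [derivAux]; abel
  | add_comm => simp only [derivAux]; abel
  | zero_add => simp only [derivAux]; abel
  | one_smul => simp only [derivAux, _root_.one_smul]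
  | zero_smul => simp only [derivAux, _root_.zero_smul]
  | mul_smul => simp only [derivAux, SemigroupAction.mul_smul]
  | smul_add => simp only [derivAux, _root_.smul_add]
  | add_smul => simp only [derivAux, _root_.add_smul]
  | gen_add => simp only [derivAux, _root_.map_add]
  | gen_smul => simp only [derivAux, _root_.map_smul]
  | map_add => simp only [derivAux, _root_.map_add]
  | map_smul => simp only [derivAux, _root_.map_smul]
  | comp_add_left =>
    simp only [derivAux, mk_add, _root_.map_add, LinearMap.add_apply, _root_.smul_add]; abel
  | comp_add_right =>
    simp only [derivAux, mk_add, _root_.map_add, _root_.smul_add]; abel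
  | comp_smul_left h c x y =>
    simp only [derivAux, mk_smul, _root_.map_smul, LinearMap.smul_apply, _root_.smul_add]
    rw [smul_comm c]
  | comp_smul_right h c x y =>
    simp only [derivAux, mk_smul, _root_.map_smul, _root_.smul_add]
    rw [smul_comm c]
  | map_gen g h v => simp only [derivAux]; exact hD g h rfl _ _ v
  | map_refl x => simp only [derivAux]; exact map_refl _
  | map_trans g g' h h' x => simp only [derivAux]; exact map_trans g g' rfl rfl _
  | comp_map f g hi hj' hk h h' a b =>
    subst hi hj' hk
    simp only [derivAux, mk_map, _root_.map_add, _root_.map_smul]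
    congr 1
    · exact comp_map f g rfl rfl rfl _ _ _ _
    · congr 1
      exact comp_map f g rfl rfl rfl _ _ _ _
  | @comp_comm S T p q k h h' a b =>
    simp only [derivAux, _root_.map_add, _root_.map_smul, _root_.smul_add]
    rw [comp_comm _ (by omega), comp_comm _ (by omega), _root_.add_comm, smul_smul, smul_smul,
      ← ksign_add, ← ksign_add]
    congr 1
    · congr 1
      exact ksign_congr ⟨0, by ring⟩
    · congr 1
      refine ksign_congr ⟨-q, by ring⟩
  | @comp_assoc S T U p q r l m n hl hm h h' a b c =>
    subst hl hm
    simp only [derivAux, mk_map, mk_comp, _root_.map_add, _root_.map_smul, LinearMap.add_apply,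
      LinearMap.smul_apply, _root_.smul_add, smul_smul]
    rw [comp_assoc (l := p + q - 1) (by omega) rfl (by omega) (by omega),
      comp_assoc (l := p + q - 1) (m := q + r - 1) (by omega) (by omega) (by omega) (by omega),
      comp_assoc (m := q + r - 1) rfl (by omega) (by omega) (by omega), ksign_add p q,
      _root_.add_assoc]

end FreeX

namespace FreeX

variable {V : CyclicModule.{u}}

/-- The derivation of degree `-1` of `𝕋₊V` which extends the natural map `D` on generators. -/
noncomputable def deriv
    (D : ∀ {S : Type} {i j : ℤ}, j + 1 = i → (V.X S i →ₗ[ℂ] FreeX V S j))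
    (hD : ∀ {S T : Type} {i j k l : ℤ} (g : S ≃ T) (h : i = k) (h' : j = l) (hi : j + 1 = i)
      (hk : l + 1 = k) (v : V.X S i), map g h' (D hi v) = D hk (V.map g h v))
    {S : Type} {i j : ℤ} (hj : j + 1 = i) : FreeX V S i →ₗ[ℂ] FreeX V S j where
  toFun := Quotient.lift (fun x => derivAux D x j hj) fun _ _ r => derivAux_sound D hD r j hj
  map_add' x y := by
    induction x using ind; induction y using ind
    rfl
  map_smul' c x := by
    induction x using ind
    rfl

section deriv

variable (D : ∀ {S : Type} {i j : ℤ}, j + 1 = i → (V.X S i →ₗ[ℂ] FreeX V S j))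
    (hD : ∀ {S T : Type} {i j k l : ℤ} (g : S ≃ T) (h : i = k) (h' : j = l) (hi : j + 1 = i)
      (hk : l + 1 = k) (v : V.X S i), map g h' (D hi v) = D hk (V.map g h v))

theorem deriv_gen {S : Type} {i j : ℤ} (hj : j + 1 = i) (v : V.X S i) :
    deriv D hD hj (gen v) = D hj v := rfl

theorem deriv_map {S T : Type} {i j k l : ℤ} (g : S ≃ T) (h : i = k) (h' : j = l)
    (hi : j + 1 = i) (hk : l + 1 = k) (x : FreeX V S i) :
    map g h' (deriv D hD hi x) = deriv D hD hk (map g h x) := by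
  subst h h'
  induction x using ind
  rfl

theorem deriv_comp {S T : Type} {i j k i' j' k' : ℤ} (h : i + j = k) (hi : i' + 1 = i)
    (hj : j' + 1 = j) (hk : k' + 1 = k) (h1 : i' + j = k') (h2 : i + j' = k')
    (a : FreeX V (Option S) i) (b : FreeX V (Option T) j) :
    deriv D hD hk (comp h a b) =
      comp h1 (deriv D hD hi a) b + ksign i • comp h2 a (deriv D hD hj b) := by
  obtain rfl : i' = i - 1 := by omega
  obtain rfl : j' = j - 1 := by omega
  induction a using ind; induction b using ind
  rfl

end deriv

theorem gen_d_natural {S T : Type} {i j k l : ℤ} (g : S ≃ T) (h : i = k) (h' : j = l)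
    (hi : j + 1 = i) (hk : l + 1 = k) (v : V.X S i) :
    map g h' ((gen ∘ₗ V.d hi) v) = (gen ∘ₗ V.d hk) (V.map g h v) :=
  (map_gen g h' _).trans (congrArg gen (V.map_d g h h' hi hk v))

/-- The differential of `𝕋₊V`: the derivation which extends the differential of `V`. -/
noncomputable def d {S : Type} {i j : ℤ} (h : j + 1 = i) : FreeX V S i →ₗ[ℂ] FreeX V S j :=
  deriv (fun h => gen ∘ₗ V.d h) gen_d_natural h

theorem d_gen {S : Type} {i j : ℤ} (h : j + 1 = i) (v : V.X S i) :
    d h (gen v) = gen (V.d h v) := rfl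

theorem map_d {S T : Type} {i j k l : ℤ} (g : S ≃ T) (h : i = k) (h' : j = l)
    (hi : j + 1 = i) (hk : l + 1 = k) (x : FreeX V S i) :
    map g h' (d hi x) = d hk (map g h x) := deriv_map _ gen_d_natural g h h' hi hk x

theorem d_comp {S T : Type} {i j k i' j' k' : ℤ} (h : i + j = k) (hi : i' + 1 = i)
    (hj : j' + 1 = j) (hk : k' + 1 = k) (h1 : i' + j = k') (h2 : i + j' = k')
    (a : FreeX V (Option S) i) (b : FreeX V (Option T) j) :
    d hk (comp h a b) = comp h1 (d hi a) b + ksign i • comp h2 a (d hj b) :=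
  deriv_comp _ gen_d_natural h hi hj hk h1 h2 a b

theorem d_d {S : Type} {i j k : ℤ} (h : j + 1 = i) (h' : k + 1 = j) (x : FreeX V S i) :
    d h' (d h x) = 0 := by
  induction x using ind with
  | h x =>
    induction x generalizing j k with
    | gen v => rw [mk_gen, d_gen, d_gen, V.d_d, _root_.map_zero]
    | zero => rw [mk_zero, _root_.map_zero, _root_.map_zero]
    | add x y hx hy => rw [mk_add, _root_.map_add, _root_.map_add, hx, hy, add_zero]
    | smul c x hx => rw [mk_smul, _root_.map_smul, _root_.map_smul, hx, smul_zero]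
    | map g e x hx =>
      subst e
      rw [mk_map, ← map_d g rfl rfl h, ← map_d g rfl rfl h', hx, _root_.map_zero]
    | @comp S T p q r e x y hx hy =>
      rw [mk_comp, d_comp (i' := p - 1) (j' := q - 1) e (by omega) (by omega)
        h (by omega) (by omega), _root_.map_add, _root_.map_smul,
        d_comp (i' := p - 1 - 1) (j' := q - 1) _ (by omega) (by omega)
        h' (by omega) (by omega),
        d_comp (i' := p - 1) (j' := q - 1 - 1) _ (by omega) (by omega)
        h' (by omega) (by omega), hx, hy, _root_.map_zero, _root_.map_zero,
        LinearMap.zero_apply, zero_add, smul_zero, add_zero, ← add_smul]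
      have : ksign (p - 1) + ksign p = 0 := by
        have h1 : ksign p = ksign (p - 1) * ksign 1 := by rw [← ksign_add]; congr 1; ring
        rw [h1]
        simp [ksign]
      rw [this, zero_smul]

end FreeX

/-- The free (non-unital, stable) cyclic operad `𝕋₊V` generated by `V`; its differential is the
derivation extending the differential of `V`. -/
noncomputable def free (V : CyclicModule.{u}) : CyclicOperad.{max 1 u} where
  X := FreeX V
  map := FreeX.map
  d := FreeX.d
  map_refl := FreeX.map_refl
  map_trans := FreeX.map_trans
  map_d := FreeX.map_d
  d_d := FreeX.d_d
  stable S i hS := ⟨fun x y => by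
    induction x using FreeX.ind; induction y using FreeX.ind
    rw [FreeX.stable_aux _ hS, FreeX.stable_aux _ hS]⟩
  comp := FreeX.comp
  comp_map := FreeX.comp_map
  comp_comm := FreeX.comp_comm
  comp_assoc := FreeX.comp_assoc
  d_comp := FreeX.d_comp

/-- The inclusion `V → 𝕋₊V` of the generators. -/
noncomputable def freeGen (V : CyclicModule.{u}) : V.Hom (free V).toCyclicModule where
  f _ _ := FreeX.gen
  f_map g h x := (FreeX.map_gen g h x).symm
  f_d h x := (FreeX.d_gen h x).symm

/-- Morphisms of cyclic operads. -/
structure CyclicOperad.Hom (A : CyclicOperad.{u}) (B : CyclicOperad.{v}) extends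
    A.toCyclicModule.Hom B.toCyclicModule where
  f_comp : ∀ {S T : Type} {i j k : ℤ} (h : i + j = k) (a : A.X (Option S) i)
    (b : A.X (Option T) j), f (S ⊕ T) k (A.comp h a b) = B.comp h (f (Option S) i a) (f (Option T) j b)

/-- The evaluation of expressions in a cyclic operad. -/
noncomputable def evalAux {V : CyclicModule.{u}} {A : CyclicOperad.{v}}
    (φ : V.Hom A.toCyclicModule) : ∀ {S : Type} {i : ℤ}, Expr V S i → A.X S i
  | _, _, Expr.gen v => φ.f _ _ v
  | _, _, Expr.zero => 0
  | _, _, Expr.add x y => evalAux φ x + evalAux φ y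
  | _, _, Expr.smul c x => c • evalAux φ x
  | _, _, Expr.map g h x => A.map g h (evalAux φ x)
  | _, _, Expr.comp h x y => A.comp h (evalAux φ x) (evalAux φ y)

theorem evalAux_sound {V : CyclicModule.{u}} {A : CyclicOperad.{v}}
    (φ : V.Hom A.toCyclicModule) {S : Type} {i : ℤ} {x y : Expr V S i} (r : Rel V x y) :
    evalAux φ x = evalAux φ y := by
  induction r with
  | refl => rfl
  | symm _ ih => exact ih.symm
  | trans _ _ ih ih' => exact ih.trans ih'
  | add_congr _ _ ih ih' => simp only [evalAux, ih, ih']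
  | smul_congr c _ ih => simp only [evalAux, ih]
  | map_congr g h _ ih => simp only [evalAux, ih]
  | comp_congr h r r' ih ih' => simp only [evalAux, ih, ih']
  | add_assoc => simp only [evalAux]; abel
  | add_comm => simp only [evalAux]; abel
  | zero_add => simp only [evalAux]; abel
  | one_smul => simp only [evalAux, _root_.one_smul]
  | zero_smul => simp only [evalAux, _root_.zero_smul]
  | mul_smul => simp only [evalAux, SemigroupAction.mul_smul]
  | smul_add => simp only [evalAux, _root_.smul_add]
  | add_smul => simp only [evalAux, _root_.add_smul]
  | gen_add => simp only [evalAux, _root_.map_add]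
  | gen_smul => simp only [evalAux, _root_.map_smul]
  | map_add => simp only [evalAux, _root_.map_add]
  | map_smul => simp only [evalAux, _root_.map_smul]
  | comp_add_left => simp only [evalAux, _root_.map_add, LinearMap.add_apply]
  | comp_add_right => simp only [evalAux, _root_.map_add]
  | comp_smul_left h c x y => simp only [evalAux, _root_.map_smul, LinearMap.smul_apply]
  | comp_smul_right h c x y => simp only [evalAux, _root_.map_smul]
  | map_gen g h v => simp only [evalAux]; exact (φ.f_map g h v).symm
  | map_refl x => simp only [evalAux]; exact A.map_refl _
  | map_trans g g' h h' x => simp only [evalAux]; exact A.map_trans g g' h h' _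
  | comp_map f g hi hj' hk h h' a b => simp only [evalAux]; exact A.comp_map f g hi hj' hk h h' _ _
  | comp_comm h h' a b => simp only [evalAux]; exact A.comp_comm h h' _ _
  | comp_assoc hl hm h h' a b c => simp only [evalAux]; exact A.comp_assoc hl hm h h' _ _ _

/-- The evaluation of elements of `𝕋₊V` in a cyclic operad. -/
noncomputable def eval {V : CyclicModule.{u}} {A : CyclicOperad.{v}}
    (φ : V.Hom A.toCyclicModule) {S : Type} {i : ℤ} : FreeX V S i →ₗ[ℂ] A.X S i where
  toFun := Quotient.lift (evalAux φ) fun _ _ r => evalAux_sound φ r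
  map_add' x y := by
    induction x using FreeX.ind; induction y using FreeX.ind
    rfl
  map_smul' c x := by
    induction x using FreeX.ind
    rfl

theorem eval_gen {V : CyclicModule.{u}} {A : CyclicOperad.{v}}
    (φ : V.Hom A.toCyclicModule) {S : Type} {i : ℤ} (v : V.X S i) :
    eval φ (FreeX.gen v) = φ.f S i v := rfl

theorem eval_map {V : CyclicModule.{u}} {A : CyclicOperad.{v}}
    (φ : V.Hom A.toCyclicModule) {S T : Type} {i j : ℤ} (g : S ≃ T) (h : i = j)
    (x : FreeX V S i) : eval φ (FreeX.map g h x) = A.map g h (eval φ x) := by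
  induction x using FreeX.ind
  rfl

theorem eval_comp {V : CyclicModule.{u}} {A : CyclicOperad.{v}}
    (φ : V.Hom A.toCyclicModule) {S T : Type} {i j k : ℤ} (h : i + j = k)
    (a : FreeX V (Option S) i) (b : FreeX V (Option T) j) :
    eval φ (FreeX.comp h a b) = A.comp h (eval φ a) (eval φ b) := by
  induction a using FreeX.ind; induction b using FreeX.ind
  rfl

theorem eval_d {V : CyclicModule.{u}} {A : CyclicOperad.{v}}
    (φ : V.Hom A.toCyclicModule) {S : Type} {i j : ℤ} (h : j + 1 = i) (x : FreeX V S i) :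
    eval φ (FreeX.d h x) = A.d h (eval φ x) := by
  induction x using FreeX.ind with
  | h x =>
    induction x generalizing j with
    | gen v => exact φ.f_d h v
    | zero => simp only [FreeX.mk_zero, map_zero]
    | add x y hx hy => simp only [FreeX.mk_add, map_add, hx, hy]
    | smul c x hx => simp only [FreeX.mk_smul, map_smul, hx]
    | map g e x hx =>
      subst e
      rw [FreeX.mk_map, ← FreeX.map_d g rfl rfl h, eval_map, eval_map, hx, A.map_d]
    | @comp S T p q r e x y hx hy =>
      rw [FreeX.mk_comp, FreeX.d_comp (i' := p - 1) (j' := q - 1) e (by omega) (by omega)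
        h (by omega) (by omega), map_add, map_smul, eval_comp, eval_comp, eval_comp, hx, hy,
        A.d_comp]

/-- The morphism of cyclic operads `𝕋₊V → A` which extends `φ : V → A`. -/
noncomputable def lift {V : CyclicModule.{u}} {A : CyclicOperad.{v}}
    (φ : V.Hom A.toCyclicModule) : (free V).Hom A where
  f _ _ := eval φ
  f_map := eval_map φ
  f_d := eval_d φ
  f_comp := eval_comp φ

/-- The universal property of the free cyclic operad. -/
theorem lift_unique {V : CyclicModule.{u}} {A : CyclicOperad.{v}}
    (φ : V.Hom A.toCyclicModule) (Φ : (free V).Hom A)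
    (h : ∀ (S : Type) (i : ℤ) (v : V.X S i), Φ.f S i ((freeGen V).f S i v) = φ.f S i v)
    (S : Type) (i : ℤ) (x : (free V).X S i) : Φ.f S i x = (lift φ).f S i x := by
  induction x using FreeX.ind (V := V) with
  | h x =>
    induction x with
    | gen v => exact h _ _ v
    | zero => exact (map_zero (Φ.f _ _)).trans (map_zero ((lift φ).f _ _)).symm
    | add x y hx hy => exact (map_add (Φ.f _ _) _ _).trans (congrArg₂ (· + ·) hx hy)
    | smul c x hx => exact (map_smul (Φ.f _ _) c _).trans (congrArg (c • ·) hx)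
    | map g e x hx => exact (Φ.f_map g e _).trans (congrArg (A.map g e) hx)
    | comp e x y hx hy => exact (Φ.f_comp e _ _).trans (congrArg₂ (fun u v => A.comp e u v) hx hy)

theorem lift_gen {V : CyclicModule.{u}} {A : CyclicOperad.{v}}
    (φ : V.Hom A.toCyclicModule) (S : Type) (i : ℤ) (v : V.X S i) :
    (lift φ).f S i ((freeGen V).f S i v) = φ.f S i v := rfl

/-- Composition of morphisms of cyclic `𝕊`-modules. -/
def CyclicModule.Hom.comp {U : CyclicModule.{u}} {V : CyclicModule.{v}} {W : CyclicModule.{w}}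
    (ψ : V.Hom W) (φ : U.Hom V) : U.Hom W where
  f S i := ψ.f S i ∘ₗ φ.f S i
  f_map g h x := (congrArg (ψ.f _ _) (φ.f_map g h x)).trans (ψ.f_map g h _)
  f_d h x := (congrArg (ψ.f _ _) (φ.f_d h x)).trans (ψ.f_d h _)

/-- The morphism `𝕋₊V → 𝕋₊W` induced by `V → W`. -/
noncomputable def freeMap {V : CyclicModule.{u}} {W : CyclicModule.{v}} (φ : V.Hom W) :
    (free V).Hom (free W) := lift ((freeGen W).comp φ)

/-! ### Ideals and quotients -/

/-- An ideal of a cyclic operad: a cyclic `𝕊`-submodule (of chain complexes) such that `a ∘ b`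
lies in it as soon as `a` or `b` does. -/
structure IsIdeal (A : CyclicOperad.{u}) (I : ∀ (S : Type) (i : ℤ), Submodule ℂ (A.X S i)) :
    Prop where
  map_mem : ∀ {S T : Type} {i j : ℤ} (g : S ≃ T) (h : i = j) (x : A.X S i),
    x ∈ I S i → A.map g h x ∈ I T j
  d_mem : ∀ {S : Type} {i j : ℤ} (h : j + 1 = i) (x : A.X S i), x ∈ I S i → A.d h x ∈ I S j
  comp_left : ∀ {S T : Type} {i j k : ℤ} (h : i + j = k) (a : A.X (Option S) i)
    (b : A.X (Option T) j), a ∈ I (Option S) i → A.comp h a b ∈ I (S ⊕ T) k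
  comp_right : ∀ {S T : Type} {i j k : ℤ} (h : i + j = k) (a : A.X (Option S) i)
    (b : A.X (Option T) j), b ∈ I (Option T) j → A.comp h a b ∈ I (S ⊕ T) k

/-- The ideal generated by `R`: the intersection of all ideals containing `R`. -/
def idealSpan (A : CyclicOperad.{u}) (R : ∀ (S : Type) (i : ℤ), Submodule ℂ (A.X S i))
    (S : Type) (i : ℤ) : Submodule ℂ (A.X S i) :=
  ⨅ (I : ∀ (S : Type) (i : ℤ), Submodule ℂ (A.X S i)) (_ : IsIdeal A I)
    (_ : ∀ (S : Type) (i : ℤ), R S i ≤ I S i), I S i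

/-- The quotient of a cyclic operad by an ideal. -/
noncomputable def CyclicOperad.quotient (A : CyclicOperad.{u})
    (I : ∀ (S : Type) (i : ℤ), Submodule ℂ (A.X S i)) (hI : IsIdeal A I) : CyclicOperad.{u} where
  X S i := A.X S i ⧸ I S i
  map {S T i j} g h := (I S i).mapQ (I T j) (A.map g h) fun x hx => hI.map_mem g h x hx
  d {S i j} h := (I S i).mapQ (I S j) (A.d h) fun x hx => hI.d_mem h x hx
  map_refl x := by
    induction x using Submodule.Quotient.induction_on
    exact congrArg (Submodule.Quotient.mk) (A.map_refl _)
  map_trans g g' h h' x := by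
    induction x using Submodule.Quotient.induction_on
    exact congrArg (Submodule.Quotient.mk) (A.map_trans g g' h h' _)
  map_d g h h' hi hk x := by
    induction x using Submodule.Quotient.induction_on
    exact congrArg (Submodule.Quotient.mk) (A.map_d g h h' hi hk _)
  d_d h h' x := by
    induction x using Submodule.Quotient.induction_on
    exact congrArg (Submodule.Quotient.mk) (A.d_d h h' _)
  stable S i hS := by
    have := A.stable S i hS
    infer_instance
  comp {S T i j k} h := (I (Option S) i).liftQ
    { toFun := fun a => (I (Option T) j).mapQ (I (S ⊕ T) k) (A.comp h a)
        fun b hb => hI.comp_right h a b hb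
      map_add' := by
        intro a a'
        refine LinearMap.ext fun y => ?_
        induction y using Submodule.Quotient.induction_on
        simp
      map_smul' := by
        intro c a
        refine LinearMap.ext fun y => ?_
        induction y using Submodule.Quotient.induction_on
        simp }
    (by
      intro a ha
      rw [LinearMap.mem_ker]
      refine LinearMap.ext fun y => ?_
      induction y using Submodule.Quotient.induction_on with
      | H b => exact (Submodule.Quotient.mk_eq_zero _).mpr (hI.comp_left h a b ha))
  comp_map f g hi hj hk h h' a b := by
    induction a using Submodule.Quotient.induction_on
    induction b using Submodule.Quotient.induction_on
    exact congrArg (Submodule.Quotient.mk) (A.comp_map f g hi hj hk h h' _ _)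
  comp_comm h h' a b := by
    induction a using Submodule.Quotient.induction_on
    induction b using Submodule.Quotient.induction_on
    exact congrArg (Submodule.Quotient.mk) (A.comp_comm h h' _ _)
  comp_assoc hl hm h h' a b c := by
    induction a using Submodule.Quotient.induction_on
    induction b using Submodule.Quotient.induction_on
    induction c using Submodule.Quotient.induction_on
    exact congrArg (Submodule.Quotient.mk) (A.comp_assoc hl hm h h' _ _ _)
  d_comp h hi hj hk h1 h2 a b := by
    induction a using Submodule.Quotient.induction_on
    induction b using Submodule.Quotient.induction_on
    exact congrArg (Submodule.Quotient.mk) (A.d_comp h hi hj hk h1 h2 _ _)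

/-- The projection of a cyclic operad to its quotient. -/
noncomputable def CyclicOperad.quotientMap (A : CyclicOperad.{u})
    (I : ∀ (S : Type) (i : ℤ), Submodule ℂ (A.X S i)) (hI : IsIdeal A I) :
    A.Hom (A.quotient I hI) where
  f S i := (I S i).mkQ
  f_map _ _ _ := rfl
  f_d _ _ := rfl
  f_comp _ _ _ := rfl

/-! ### Trees with one edge -/

/-- Auxiliary form of `splitSign`, computed with enumerations `eX` of `X` and `eY` of `Y`. -/
noncomputable def splitSignAux {S X Y : Type} (s : X ⊕ Y ≃ S) {m n : ℕ} (eX : Fin m ≃ X)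
    (eY : Fin n ≃ Y) : ℤˣ :=
  orient (finSumFinEquiv.symm.trans ((eX.sumCongr eY).trans s)) *
    (orient ((finSuccEquiv m).trans eX.optionCongr) *
      orient ((finSuccEquiv n).trans eY.optionCongr))

open Classical in
/-- The sign of the isomorphism of degree `-1`
`Σ^{|S|-3} det(S) → Σ^{|X ∪ {*}|-3} det(X ∪ {*}) ⊗ Σ^{|Y ∪ {*}|-3} det(Y ∪ {*})`, `S = X ⊔ Y`,
which sends `u x₁ ⋯ x_m y₁ ⋯ y_n` to `(u * x₁ ⋯ x_m) ⊗ (u * y₁ ⋯ y_n)`, relative to the chosen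
generators of the determinant lines; here `u` is the generator of the line `Σ^{-3}`. -/
noncomputable def splitSign {S X Y : Type} (s : X ⊕ Y ≃ S) : ℤˣ :=
  if h : Finite X ∧ Finite Y then
    haveI := h.1
    haveI := h.2
    splitSignAux s (enum X).symm (enum Y).symm
  else 1

theorem splitSignAux_perm {S X Y : Type} (s : X ⊕ Y ≃ S) {m n : ℕ} (eX : Fin m ≃ X)
    (eY : Fin n ≃ Y) (σ : Equiv.Perm (Fin m)) (τ : Equiv.Perm (Fin n)) :
    splitSignAux s (σ.trans eX) (τ.trans eY) = splitSignAux s eX eY := by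
  have h1 : finSumFinEquiv.symm.trans (((σ.trans eX).sumCongr (τ.trans eY)).trans s) =
      (finSumFinEquiv.permCongr (σ.sumCongr τ)).trans
        (finSumFinEquiv.symm.trans ((eX.sumCongr eY).trans s)) := by
    ext z
    obtain ⟨w, rfl⟩ := finSumFinEquiv.surjective z
    rcases w with w | w <;> simp [Equiv.permCongr_apply]
  have h2 : ∀ {k : ℕ} {Z : Type} (ρ : Equiv.Perm (Fin k)) (e : Fin k ≃ Z),
      orient ((finSuccEquiv k).trans (ρ.trans e).optionCongr) =
        Equiv.Perm.sign ρ * orient ((finSuccEquiv k).trans e.optionCongr) := by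
    intro k Z ρ e
    have : (finSuccEquiv k).trans (ρ.trans e).optionCongr =
        ((finSuccEquiv k).symm.permCongr ρ.optionCongr).trans
          ((finSuccEquiv k).trans e.optionCongr) := by
      ext1 z
      obtain ⟨w, rfl⟩ := (finSuccEquiv k).symm.surjective z
      rcases w with _ | w <;> simp [Equiv.permCongr_apply]
    rw [this, orient_perm, Equiv.Perm.sign_permCongr, Equiv.optionCongr_sign]
  unfold splitSignAux
  rw [h1, h2, h2, orient_perm, Equiv.Perm.sign_permCongr, Equiv.Perm.sign_sumCongr]
  rcases Int.units_eq_one_or (Equiv.Perm.sign σ) with h | h <;>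
    rcases Int.units_eq_one_or (Equiv.Perm.sign τ) with h' | h' <;> simp [h, h']

theorem splitSign_eq {S X Y : Type} (s : X ⊕ Y ≃ S) {m n : ℕ} (eX : Fin m ≃ X)
    (eY : Fin n ≃ Y) : splitSign s = splitSignAux s eX eY := by
  have hX : Finite X := Finite.of_equiv _ eX
  have hY : Finite Y := Finite.of_equiv _ eY
  obtain rfl : m = Nat.card X := by rw [← Nat.card_congr eX, Nat.card_fin]
  obtain rfl : n = Nat.card Y := by rw [← Nat.card_congr eY, Nat.card_fin]
  unfold splitSign
  rw [dif_pos ⟨hX, hY⟩, ← splitSignAux_perm s _ _ (eX.trans (enum X)) (eY.trans (enum Y))]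
  simp [Equiv.trans_assoc]

theorem splitSign_natural {S X Y S' X' Y' : Type} [Finite S] (s : X ⊕ Y ≃ S) (s' : X' ⊕ Y' ≃ S')
    (f : X ≃ X') (g : Y ≃ Y') (e : S ≃ S') (he : (f.sumCongr g).trans s' = s.trans e) :
    splitSign s' * (detSign f.optionCongr * detSign g.optionCongr) =
      splitSign s * detSign e := by
  have hXY : Finite (X ⊕ Y) := Finite.of_equiv _ s.symm
  have hX : Finite X := Finite.of_injective _ (Sum.inl_injective (β := Y))
  have hY : Finite Y := Finite.of_injective _ (Sum.inr_injective (α := X))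
  rw [splitSign_eq s (enum X).symm (enum Y).symm,
    splitSign_eq s' ((enum X).symm.trans f) ((enum Y).symm.trans g)]
  unfold splitSignAux
  have h1 : (finSumFinEquiv.symm.trans
      ((((enum X).symm.trans f).sumCongr ((enum Y).symm.trans g)).trans s')) =
      (finSumFinEquiv.symm.trans (((enum X).symm.sumCongr (enum Y).symm).trans s)).trans e := by
    rw [← Equiv.sumCongr_trans, Equiv.trans_assoc, he]
    rfl
  have h2 : ∀ {Z Z' : Type} [Finite Z] (k : Z ≃ Z'),
      orient ((finSuccEquiv _).trans ((enum Z).symm.trans k).optionCongr) =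
        orient ((finSuccEquiv _).trans (enum Z).symm.optionCongr) * detSign k.optionCongr := by
    intro Z Z' _ k
    rw [← orient_trans, Equiv.trans_assoc, Equiv.optionCongr_trans]
  rw [h1, orient_trans, h2, h2]
  generalize detSign f.optionCongr = x
  generalize detSign g.optionCongr = y
  rcases Int.units_eq_one_or x with h | h <;>
    rcases Int.units_eq_one_or y with h' | h' <;> simp [h, h', mul_comm, mul_assoc]

/-- The bijection `X ⊔ Xᶜ ≃ S`. -/
noncomputable def split {S : Type} (X : Set S) : X ⊕ (Xᶜ : Set S) ≃ S :=
  haveI := Classical.decPred (· ∈ X)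
  Equiv.Set.sumCompl X

/-- The map `V((X ∪ {*})) ⊗ V((Y ∪ {*})) → 𝕋₊V((S))`, `S = X ⊔ Y`, given by the tree with one
edge, whose two vertices have the legs `X ∪ {*}` and `Y ∪ {*}`. -/
noncomputable def edge {V : CyclicModule.{u}} {S X Y : Type} (s : X ⊕ Y ≃ S) {i j k : ℤ}
    (h : i + j = k) : V.X (Option X) i ⊗[ℂ] V.X (Option Y) j →ₗ[ℂ] FreeX V S k :=
  TensorProduct.lift
    (((FreeX.comp h).compl₁₂ FreeX.gen FreeX.gen).compr₂ (FreeX.map s rfl))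

/-- The composition `A((X ∪ {*})) ⊗ A((Y ∪ {*})) → A((S))`, `S = X ⊔ Y`. -/
noncomputable def compose (A : CyclicOperad.{u}) {S X Y : Type} (s : X ⊕ Y ≃ S) {i j k : ℤ}
    (h : i + j = k) : A.X (Option X) i ⊗[ℂ] A.X (Option Y) j →ₗ[ℂ] A.X S k :=
  TensorProduct.lift ((A.comp h).compr₂ (A.map s rfl))

/-- The sign relating the adjoint of the composition to its suspension: besides the sign of the
isomorphism of determinant lines, it contains the Koszul sign for moving the line
`Σ^{|Y ∪ {*}|-3} det(Y ∪ {*})` past a functional on the component of degree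
`|X ∪ {*}| - 3 - i` of `A((X ∪ {*}))`. -/
noncomputable def cosign {S X Y : Type} (s : X ⊕ Y ≃ S) (i : ℤ) : ℂ :=
  ((splitSign s : ℤ) : ℂ) *
    ksign (((Nat.card (Option Y) : ℤ) - 3) * ((Nat.card (Option X) : ℤ) - 3 - i))

open Classical in
/-- The map `A^∨((S)) → A^∨((X ∪ {*})) ⊗ A^∨((Y ∪ {*}))` of degree `-1` which is adjoint to the
composition `A((X ∪ {*})) ⊗ A((Y ∪ {*})) → A((S))`, written out in terms of linear duals.  The
equation of degrees in the definition holds whenever `S` is finite and `i + j + 1 = n`. -/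
noncomputable def cocomposeAux (A : CyclicOperad.{u}) [A.FinDim] {S X Y : Type} (s : X ⊕ Y ≃ S)
    (i j n : ℤ) : Module.Dual ℂ (A.X S ((Nat.card S : ℤ) - 3 - n)) →ₗ[ℂ]
      Module.Dual ℂ (A.X (Option X) ((Nat.card (Option X) : ℤ) - 3 - i)) ⊗[ℂ]
        Module.Dual ℂ (A.X (Option Y) ((Nat.card (Option Y) : ℤ) - 3 - j)) :=
  if h : ((Nat.card (Option X) : ℤ) - 3 - i) + ((Nat.card (Option Y) : ℤ) - 3 - j) =
      (Nat.card S : ℤ) - 3 - n then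
    cosign s i • ((TensorProduct.dualDistribEquiv ℂ _ _).symm.toLinearMap ∘ₗ
      (compose A s h).dualMap)
  else 0

/-- The map `A^∨((S)) → A^∨((X ∪ {*})) ⊗ A^∨((Y ∪ {*}))` of degree `-1` which is adjoint to the
composition `A((X ∪ {*})) ⊗ A((Y ∪ {*})) → A((S))`. -/
noncomputable def cocompose (A : CyclicOperad.{u}) [A.FinDim] {S X Y : Type} (s : X ⊕ Y ≃ S)
    (i j n : ℤ) : (dual A.toCyclicModule).X S n →ₗ[ℂ]
      (dual A.toCyclicModule).X (Option X) i ⊗[ℂ] (dual A.toCyclicModule).X (Option Y) j :=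
  cocomposeAux A s i j n

theorem edge_tmul {V : CyclicModule.{u}} {S X Y : Type} (s : X ⊕ Y ≃ S) {i j k : ℤ}
    (h : i + j = k) (a : V.X (Option X) i) (b : V.X (Option Y) j) :
    edge s h (a ⊗ₜ b) = FreeX.map s rfl (FreeX.comp h (FreeX.gen a) (FreeX.gen b)) := rfl

theorem compose_tmul (A : CyclicOperad.{u}) {S X Y : Type} (s : X ⊕ Y ≃ S) {i j k : ℤ}
    (h : i + j = k) (a : A.X (Option X) i) (b : A.X (Option Y) j) :
    compose A s h (a ⊗ₜ b) = A.map s rfl (A.comp h a b) := rfl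

theorem edge_natural {V : CyclicModule.{u}} {S X Y S' X' Y' : Type} (s : X ⊕ Y ≃ S)
    (s' : X' ⊕ Y' ≃ S') (f : X ≃ X') (g : Y ≃ Y') (e : S ≃ S')
    (he : (f.sumCongr g).trans s' = s.trans e) {i j k i' j' k' : ℤ} (hi : i = i') (hj : j = j')
    (hk : k = k') (h : i + j = k) (h' : i' + j' = k')
    (t : V.X (Option X) i ⊗[ℂ] V.X (Option Y) j) :
    FreeX.map e hk (edge s h t) =
      edge s' h' (TensorProduct.map (V.map f.optionCongr hi) (V.map g.optionCongr hj) t) := by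
  induction t using TensorProduct.induction_on with
  | zero => simp only [map_zero]
  | add x y hx hy => simp only [map_add, hx, hy]
  | tmul a b =>
    rw [TensorProduct.map_tmul, edge_tmul, edge_tmul, ← FreeX.map_gen, ← FreeX.map_gen,
      FreeX.comp_map f g hi hj hk h h', FreeX.map_trans, FreeX.map_trans]
    congr 2
    exact he.symm

theorem compose_natural (A : CyclicOperad.{u}) {S X Y S' X' Y' : Type} (s : X ⊕ Y ≃ S)
    (s' : X' ⊕ Y' ≃ S') (f : X ≃ X') (g : Y ≃ Y') (e : S ≃ S')
    (he : (f.sumCongr g).trans s' = s.trans e) {i j k i' j' k' : ℤ} (hi : i = i') (hj : j = j')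
    (hk : k = k') (h : i + j = k) (h' : i' + j' = k')
    (a : A.X (Option X') i') (b : A.X (Option Y') j') :
    A.map e.symm hk.symm (compose A s' h' (a ⊗ₜ b)) =
      compose A s h ((A.map f.optionCongr.symm hi.symm a) ⊗ₜ
        (A.map g.optionCongr.symm hj.symm b)) := by
  rw [compose_tmul, compose_tmul, ← Equiv.optionCongr_symm, ← Equiv.optionCongr_symm,
    A.comp_map f.symm g.symm hi.symm hj.symm hk.symm h' h, A.map_trans, A.map_trans]
  congr 2
  have : s = (f.sumCongr g).trans (s'.trans e.symm) := by
    rw [← Equiv.trans_assoc, he, Equiv.trans_assoc, Equiv.self_trans_symm, Equiv.trans_refl]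
  rw [this, ← Equiv.trans_assoc, ← Equiv.sumCongr_symm, Equiv.symm_trans_self, Equiv.refl_trans]

theorem cocomposeAux_apply (A : CyclicOperad.{u}) [A.FinDim] {S X Y : Type} (s : X ⊕ Y ≃ S)
    (i j n : ℤ) (h : ((Nat.card (Option X) : ℤ) - 3 - i) + ((Nat.card (Option Y) : ℤ) - 3 - j) =
      (Nat.card S : ℤ) - 3 - n)
    (f : Module.Dual ℂ (A.X S ((Nat.card S : ℤ) - 3 - n)))
    (z : A.X (Option X) ((Nat.card (Option X) : ℤ) - 3 - i) ⊗[ℂ]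
      A.X (Option Y) ((Nat.card (Option Y) : ℤ) - 3 - j)) :
    TensorProduct.dualDistrib ℂ _ _ (cocomposeAux A s i j n f) z =
      cosign s i * f (compose A s h z) := by
  unfold cocomposeAux
  rw [dif_pos h]
  have key := LinearEquiv.apply_symm_apply (TensorProduct.dualDistribEquiv ℂ
          (A.X (Option X) ((Nat.card (Option X) : ℤ) - 3 - i))
          (A.X (Option Y) ((Nat.card (Option Y) : ℤ) - 3 - j))) ((compose A s h).dualMap f)
  have key' := congrArg (fun w => cosign s i * w z) key
  refine Eq.trans ?_ key'
  exact congrArg (fun w : Module.Dual ℂ _ => w z) (map_smul (TensorProduct.dualDistrib ℂ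
          (A.X (Option X) ((Nat.card (Option X) : ℤ) - 3 - i))
          (A.X (Option Y) ((Nat.card (Option Y) : ℤ) - 3 - j))) (cosign s i) _)

theorem cocomposeAux_zero (A : CyclicOperad.{u}) [A.FinDim] {S X Y : Type} (s : X ⊕ Y ≃ S)
    (i j n : ℤ) (h : ¬ ((Nat.card (Option X) : ℤ) - 3 - i) +
      ((Nat.card (Option Y) : ℤ) - 3 - j) = (Nat.card S : ℤ) - 3 - n) :
    cocomposeAux A s i j n = 0 := dif_neg h

theorem dualDistrib_natural (V : CyclicModule.{u}) {S T S' T' : Type} (f : S ≃ S') (g : T ≃ T')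
    {i j i' j' : ℤ} (hi : i = i') (hj : j = j')
    (t : (dual V).X S i ⊗[ℂ] (dual V).X T j)
    (a : V.X S' ((Nat.card S' : ℤ) - 3 - i')) (b : V.X T' ((Nat.card T' : ℤ) - 3 - j')) :
    TensorProduct.dualDistrib ℂ (V.X S' ((Nat.card S' : ℤ) - 3 - i'))
      (V.X T' ((Nat.card T' : ℤ) - 3 - j'))
      (TensorProduct.map ((dual V).map f hi) ((dual V).map g hj) t) (a ⊗ₜ b) =
    detC f * detC g * TensorProduct.dualDistrib ℂ (V.X S ((Nat.card S : ℤ) - 3 - i))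
      (V.X T ((Nat.card T : ℤ) - 3 - j)) t
      (V.map f.symm (by rw [Nat.card_congr f, hi]) a ⊗ₜ
        V.map g.symm (by rw [Nat.card_congr g, hj]) b) := by
  induction t using TensorProduct.induction_on with
  | zero =>
    simp only [map_zero]
    exact (mul_zero _).symm
  | add x y hx hy =>
    rw [map_add]
    refine (congrArg (fun w : Module.Dual ℂ _ => w (a ⊗ₜ b)) (map_add (TensorProduct.dualDistrib ℂ
      (V.X S' ((Nat.card S' : ℤ) - 3 - i')) (V.X T' ((Nat.card T' : ℤ) - 3 - j'))) _ _)).trans ?_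
    refine (congrArg₂ (· + ·) hx hy).trans ?_
    refine (mul_add _ _ _).symm.trans (congrArg (detC f * detC g * ·) ?_)
    exact (congrArg (fun w : Module.Dual ℂ _ => w _) (map_add (TensorProduct.dualDistrib ℂ
      (V.X S ((Nat.card S : ℤ) - 3 - i)) (V.X T ((Nat.card T : ℤ) - 3 - j))) x y)).symm
  | tmul x y =>
    rw [TensorProduct.map_tmul]
    refine (TensorProduct.dualDistrib_apply _ _ _ _).trans ?_
    refine (congrArg₂ (· * ·) (dual_map_apply V f hi x a) (dual_map_apply V g hj y b)).trans ?_
    refine Eq.trans ?_ (congrArg (detC f * detC g * ·)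
      (TensorProduct.dualDistrib_apply _ _ _ _).symm)
    ring

theorem cocompose_natural (A : CyclicOperad.{u}) [A.FinDim] {S X Y S' X' Y' : Type} [Finite S]
    (s : X ⊕ Y ≃ S) (s' : X' ⊕ Y' ≃ S') (f : X ≃ X') (g : Y ≃ Y') (e : S ≃ S')
    (he : (f.sumCongr g).trans s' = s.trans e) {i j n n' : ℤ} (hn : n = n')
    (x : (dual A.toCyclicModule).X S n) :
    TensorProduct.map ((dual A.toCyclicModule).map f.optionCongr rfl)
      ((dual A.toCyclicModule).map g.optionCongr rfl) (cocompose A s i j n x) =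
    cocompose A s' i j n' ((dual A.toCyclicModule).map e hn x) := by
  subst hn
  have cX : (Nat.card (Option X) : ℤ) = Nat.card (Option X') := by
    rw [Nat.card_congr f.optionCongr]
  have cY : (Nat.card (Option Y) : ℤ) = Nat.card (Option Y') := by
    rw [Nat.card_congr g.optionCongr]
  have cS : (Nat.card S : ℤ) = Nat.card S' := by rw [Nat.card_congr e]
  by_cases h : ((Nat.card (Option X) : ℤ) - 3 - i) + ((Nat.card (Option Y) : ℤ) - 3 - j) =
      (Nat.card S : ℤ) - 3 - n
  · have h' : ((Nat.card (Option X') : ℤ) - 3 - i) + ((Nat.card (Option Y') : ℤ) - 3 - j) =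
      (Nat.card S' : ℤ) - 3 - n := by omega
    refine (TensorProduct.dualDistribEquiv ℂ
          (A.X (Option X') ((Nat.card (Option X') : ℤ) - 3 - i))
          (A.X (Option Y') ((Nat.card (Option Y') : ℤ) - 3 - j))).injective ?_
    refine TensorProduct.ext' fun a b => ?_
    refine (dualDistrib_natural A.toCyclicModule f.optionCongr g.optionCongr rfl rfl _ a b).trans ?_
    refine (congrArg (detC f.optionCongr * detC g.optionCongr * ·)
      (cocomposeAux_apply A s i j n h x _)).trans ?_
    refine Eq.trans ?_ (cocomposeAux_apply A s' i j n h' _ _).symm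
    refine Eq.trans ?_ (congrArg (cosign s' i * ·) (dual_map_apply A.toCyclicModule e rfl x _).symm)
    have hs := splitSign_natural s s' f g e he
    have hs' : detC f.optionCongr * detC g.optionCongr * cosign s i = cosign s' i * detC e := by
      have h1 : splitSign s * (detSign f.optionCongr * detSign g.optionCongr) =
          splitSign s' * detSign e := by
        have h2 := Int.units_mul_self (detSign f.optionCongr)
        have h3 := Int.units_mul_self (detSign g.optionCongr)
        have h4 := Int.units_mul_self (detSign e)
        calc _ = splitSign s * (detSign e * detSign e) *
              (detSign f.optionCongr * detSign g.optionCongr) := by rw [h4, mul_one]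
          _ = (splitSign s * detSign e) * detSign e *
              (detSign f.optionCongr * detSign g.optionCongr) := by simp only [mul_assoc]
          _ = splitSign s' * detSign e * ((detSign f.optionCongr * detSign f.optionCongr) *
              (detSign g.optionCongr * detSign g.optionCongr)) := by
              rw [← hs]; simp only [mul_comm, mul_left_comm]
          _ = _ := by rw [h2, h3, mul_one, mul_one]
      have h5 : ((splitSign s : ℤ) : ℂ) * (detC f.optionCongr * detC g.optionCongr) =
          ((splitSign s' : ℤ) : ℂ) * detC e := by
        have := congrArg (fun z : ℤˣ => ((z : ℤ) : ℂ)) h1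
        simpa [detC] using this
      unfold cosign
      rw [cX, cY]
      linear_combination (ksign ((↑(Nat.card (Option Y')) - 3) *
        (↑(Nat.card (Option X')) - 3 - i))) * h5
    rw [← mul_assoc, ← mul_assoc, hs']
    congr 2
    exact (compose_natural A s s' f g e he (by omega) (by omega) (by omega) h h' a b).symm
  · have h' : ¬ (((Nat.card (Option X') : ℤ) - 3 - i) + ((Nat.card (Option Y') : ℤ) - 3 - j) =
      (Nat.card S' : ℤ) - 3 - n) := by omega
    have h1 : cocompose A s i j n = 0 := cocomposeAux_zero A s i j n h
    have h2 : cocompose A s' i j n = 0 := cocomposeAux_zero A s' i j n h'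
    rw [h1, h2]
    simp only [LinearMap.zero_apply, map_zero]

/-- Bijections act by isomorphisms. -/
noncomputable def CyclicModule.mapEquiv (V : CyclicModule.{u}) {S T : Type} {i j : ℤ}
    (g : S ≃ T) (h : i = j) : V.X S i ≃ₗ[ℂ] V.X T j :=
  LinearEquiv.ofLinearMap (V.map g h) (V.map g.symm h.symm)
    (LinearMap.ext fun x => by
      have : ∀ (e : T ≃ T), e = Equiv.refl T → V.map e rfl x = x := by
        rintro e rfl; exact V.map_refl x
      rw [LinearMap.comp_apply, V.map_trans]
      exact this _ (Equiv.symm_trans_self g))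
    (LinearMap.ext fun x => by
      have : ∀ (e : S ≃ S), e = Equiv.refl S → V.map e rfl x = x := by
        rintro e rfl; exact V.map_refl x
      rw [LinearMap.comp_apply, V.map_trans]
      exact this _ (Equiv.self_trans_symm g))

/-! ### The differential of the cobar construction -/

/-- The contribution to the differential of the cobar operad of the tree with one edge which
corresponds to the decomposition `S = X ⊔ Xᶜ`, in bidegree `(i, j - i)`. -/
noncomputable def cobarTerm (A : CyclicOperad.{u}) [A.FinDim] {S : Type} (n j : ℤ)
    (x : Set S × ℤ) : (dual A.toCyclicModule).X S n →ₗ[ℂ] FreeX (dual A.toCyclicModule) S j :=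
  edge (split x.1) (add_sub_cancel x.2 j) ∘ₗ cocompose A (split x.1) x.2 (j - x.2) n

/-- The differential `∂` of the cobar operad on generators: the sum of the adjoints of the
compositions over all trees with one edge.  Each such tree is counted twice in the sum over the
ordered decompositions `S = X ⊔ Xᶜ`.  The sum is finite, as the complexes `A((S))` are finite
dimensional, and vanish for infinite `S`. -/
noncomputable def cobarGen (A : CyclicOperad.{u}) [A.FinDim] {S : Type} {n j : ℤ}
    (_h : j + 1 = n) : (dual A.toCyclicModule).X S n →ₗ[ℂ] FreeX (dual A.toCyclicModule) S j :=
  (1 / 2 : ℂ) • ∑ᶠ x : Set S × ℤ, cobarTerm A n j x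

theorem split_natural {S T : Type} (g : S ≃ T) (X : Set S) (X' : Set T)
    (f : X ≃ X') (f' : (Xᶜ : Set S) ≃ (X'ᶜ : Set T)) (hf : ∀ x, (f x : T) = g x)
    (hf' : ∀ x, (f' x : T) = g x) :
    (f.sumCongr f').trans (split X') = (split X).trans g := by
  ext z
  rcases z with z | z <;> simp [split, hf, hf']

theorem cobarTerm_natural (A : CyclicOperad.{u}) [A.FinDim] {S T : Type} [Finite S]
    (g : S ≃ T) (n j : ℤ) (x : Set S × ℤ) (v : (dual A.toCyclicModule).X S n) :
    FreeX.map g rfl (cobarTerm A n j x v) =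
      cobarTerm A n j (g '' x.1, x.2) ((dual A.toCyclicModule).map g rfl v) := by
  have f' : ∃ f' : (x.1ᶜ : Set S) ≃ ((g '' x.1)ᶜ : Set T), ∀ x, (f' x : T) = g x :=
    ⟨(g.image x.1ᶜ).trans (Equiv.setCongr (Set.image_compl_eq g.bijective)), fun _ => rfl⟩
  obtain ⟨f', hf'⟩ := f'
  have hs := split_natural g x.1 (g '' x.1) (g.image x.1) f' (fun _ => rfl) hf'
  refine (edge_natural (V := dual A.toCyclicModule) (split x.1) (split (g '' x.1)) (g.image x.1)
    f' g hs rfl rfl rfl (add_sub_cancel x.2 j) (add_sub_cancel x.2 j) _).trans ?_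
  exact congrArg (edge (split (g '' x.1)) (add_sub_cancel x.2 j))
    (cocompose_natural A (split x.1) (split (g '' x.1)) (g.image x.1) f' g hs rfl v)

theorem cobarGen_natural (A : CyclicOperad.{u}) [A.FinDim] {S T : Type} {i j k l : ℤ}
    (g : S ≃ T) (h : i = k) (h' : j = l) (hi : j + 1 = i) (hk : l + 1 = k)
    (v : (dual A.toCyclicModule).X S i) :
    FreeX.map g h' (cobarGen A hi v) = cobarGen A hk ((dual A.toCyclicModule).map g h v) := by
  subst h h'
  by_cases hS : Finite S
  · let e₁ := (dual A.toCyclicModule).mapEquiv g (rfl : i = i)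
    let e₂ : FreeX (dual A.toCyclicModule) S j ≃ₗ[ℂ] FreeX (dual A.toCyclicModule) T j :=
      (free (dual A.toCyclicModule)).mapEquiv g (rfl : j = j)
    have h1 : (e₁.arrowCongr e₂) (∑ᶠ x : Set S × ℤ, cobarTerm A i j x) =
        ∑ᶠ x : Set T × ℤ, cobarTerm A i j x := by
      refine (AddEquiv.map_finsum (e₁.arrowCongr e₂).toAddEquiv _).trans ?_
      rw [← finsum_comp_equiv ((Equiv.Set.congr g).prodCongr (Equiv.refl ℤ))]
      refine finsum_congr fun x => LinearMap.ext fun w => ?_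
      refine (cobarTerm_natural A g i j x (e₁.symm w)).trans ?_
      exact congrArg (cobarTerm A i j (g '' x.1, x.2)) (e₁.apply_symm_apply w)
    have h2 : e₂ ((∑ᶠ x : Set S × ℤ, cobarTerm A i j x) v) =
        (∑ᶠ x : Set T × ℤ, cobarTerm A i j x) (e₁ v) := by
      rw [← h1, LinearEquiv.arrowCongr_apply, LinearEquiv.symm_apply_apply]
    unfold cobarGen
    rw [LinearMap.smul_apply, LinearMap.smul_apply, map_smul]
    exact congrArg ((1 / 2 : ℂ) • ·) h2
  · have h0 : Nat.card S = 0 := by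
      have : Infinite S := not_finite_iff_infinite.mp hS
      exact Nat.card_eq_zero_of_infinite
    have := (dual A.toCyclicModule).stable S i (by omega)
    rw [Subsingleton.elim v 0, map_zero, map_zero, map_zero, map_zero]

/-- The operator `∂` of degree `-1` on `B A = 𝕋₊A^∨`: the sum over all vertices of a decorated
tree of the adjoints of the compositions, i.e. the derivation extending `cobarGen`.  The
differential of the cobar operad `B A` is `δ + ∂`, where `δ` is the differential of
`𝕋₊A^∨`. -/
noncomputable def cobarD (A : CyclicOperad.{u}) [A.FinDim] {S : Type} {i j : ℤ}
    (h : j + 1 = i) :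
    (free (dual A.toCyclicModule)).X S i →ₗ[ℂ] (free (dual A.toCyclicModule)).X S j :=
  FreeX.deriv (cobarGen A) (cobarGen_natural A) h

/-! ### Quadratic operads -/

/-- The sum over all ordered decompositions `S = X ⊔ Xᶜ` of the components of degree `n` of
`V((X ∪ {*})) ⊗ V((Xᶜ ∪ {*}))`. -/
abbrev OrderedSplits (V : CyclicModule.{u}) (S : Type) (n : ℤ) : Type u :=
  ⨁ x : Set S × ℤ, V.X (Option x.1) x.2 ⊗[ℂ] V.X (Option (x.1ᶜ : Set S)) (n - x.2)

open Classical in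
/-- The exchange of the two factors, with the Koszul sign. -/
noncomputable def exchange (V : CyclicModule.{u}) (S : Type) (n : ℤ) :
    OrderedSplits V S n →ₗ[ℂ] OrderedSplits V S n :=
  DirectSum.toModule ℂ (Set S × ℤ) _ fun x =>
    ksign (x.2 * (n - x.2)) •
      (DirectSum.lof ℂ (Set S × ℤ)
          (fun x => V.X (Option x.1) x.2 ⊗[ℂ] V.X (Option (x.1ᶜ : Set S)) (n - x.2))
          (x.1ᶜ, n - x.2) ∘ₗ
        TensorProduct.map LinearMap.id
          (V.map (Equiv.setCongr (compl_compl x.1).symm).optionCongr (sub_sub_cancel n x.2).symm) ∘ₗ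
        (TensorProduct.comm ℂ _ _).toLinearMap)

/-- The component of degree `n` of `𝕋₁V((S)) = ⨁ V((T))`, the sum over the trees `T` with one
edge.  The tree with the vertices `X ∪ {*}` and `Xᶜ ∪ {*}` corresponds to the two ordered
decompositions `(X, Xᶜ)` and `(Xᶜ, X)`; an element of the unordered tensor product `V((T))` is a
pair of elements of the two ordered tensor products which correspond to each other under the
exchange of the factors. -/
noncomputable def T1 (V : CyclicModule.{u}) (S : Type) (n : ℤ) :
    Submodule ℂ (OrderedSplits V S n) :=
  LinearMap.eqLocus (exchange V S n) LinearMap.id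

open Classical in
/-- The map `𝕋₁V → 𝕋₊V`; in the sum over ordered decompositions each tree is counted twice. -/
noncomputable def T1.toFree (V : CyclicModule.{u}) (S : Type) (n : ℤ) :
    T1 V S n →ₗ[ℂ] (free V).X S n :=
  (1 / 2 : ℂ) • (DirectSum.toModule ℂ (Set S × ℤ) (FreeX V S n)
    (fun x => edge (split x.1) (add_sub_cancel x.2 n)) ∘ₗ (T1 V S n).subtype)

/-- The relations `R = ker(𝕋₁V → A)` of a cyclic operad `A` with generators `V`. -/
noncomputable def relations {V : CyclicModule.{v}} {A : CyclicOperad.{u}}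
    (φ : V.Hom A.toCyclicModule) (S : Type) (n : ℤ) : Submodule ℂ (T1 V S n) :=
  LinearMap.ker ((lift φ).f S n ∘ₗ T1.toFree V S n)

/-- `A` is a cyclic quadratic operad, with the inclusion of the generators `φ : V → A`: the
operad `A` is generated by `V`, and the ideal `ker(𝕋₊V → A)` is generated by the relations
`ker(𝕋₁V → A)`. -/
structure IsQuadratic {V : CyclicModule.{v}} {A : CyclicOperad.{u}}
    (φ : V.Hom A.toCyclicModule) : Prop where
  injective : ∀ (S : Type) (i : ℤ), Function.Injective (φ.f S i)
  generates : ∀ (S : Type) (i : ℤ), Function.Surjective ((lift φ).f S i)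
  ker_eq : ∀ (S : Type) (i : ℤ), LinearMap.ker ((lift φ).f S i) =
    idealSpan (free V) (fun S n => (relations φ S n).map (T1.toFree V S n)) S i

open Classical in
/-- The pairing between the summand `V^∨((X ∪ {*}))_i ⊗ V^∨((Xᶜ ∪ {*}))_{m-i}`, where
`x = (X, i)`, and the sum of the `V((X ∪ {*})) ⊗ V((Xᶜ ∪ {*}))`.  It is nonzero only on the
summand with the same `X`, and only in degree `n = |S| - 3 - (m + 1)`. -/
noncomputable def splitPairing (V : CyclicModule.{u}) (S : Type) (m n : ℤ) (x : Set S × ℤ) :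
    (dual V).X (Option x.1) x.2 ⊗[ℂ] (dual V).X (Option (x.1ᶜ : Set S)) (m - x.2) →ₗ[ℂ]
      Module.Dual ℂ (OrderedSplits V S n) :=
  if h : n - ((Nat.card (Option x.1) : ℤ) - 3 - x.2) =
      (Nat.card (Option (x.1ᶜ : Set S)) : ℤ) - 3 - (m - x.2) then
    cosign (split x.1) x.2 •
      ((TensorProduct.map LinearMap.id (V.map (Equiv.refl _) h) ∘ₗ
          DirectSum.component ℂ (Set S × ℤ)
            (fun x => V.X (Option x.1) x.2 ⊗[ℂ] V.X (Option (x.1ᶜ : Set S)) (n - x.2))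
            (x.1, (Nat.card (Option x.1) : ℤ) - 3 - x.2)).dualMap ∘ₗ
        TensorProduct.dualDistrib ℂ
          (V.X (Option x.1) ((Nat.card (Option x.1) : ℤ) - 3 - x.2))
          (V.X (Option (x.1ᶜ : Set S)) ((Nat.card (Option (x.1ᶜ : Set S)) : ℤ) - 3 - (m - x.2))))
  else 0

open Classical in
/-- The natural map `𝕋₁(V^∨) ≅ (𝕋₁V)^∨`, of degree `1`; recall that the component of degree
`m + 1` of `(𝕋₁V)^∨((S))` is the dual of the component of degree `|S| - 3 - (m + 1)` of
`𝕋₁V((S))`. -/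
noncomputable def T1.pairing (V : CyclicModule.{u}) (S : Type) (m : ℤ) :
    T1 (dual V) S m →ₗ[ℂ] Module.Dual ℂ (T1 V S ((Nat.card S : ℤ) - 3 - (m + 1))) :=
  (1 / 2 : ℂ) • ((T1 V S ((Nat.card S : ℤ) - 3 - (m + 1))).subtype.dualMap ∘ₗ
    DirectSum.toModule ℂ (Set S × ℤ) _ (splitPairing V S m ((Nat.card S : ℤ) - 3 - (m + 1))) ∘ₗ
      (T1 (dual V) S m).subtype)

/-- `R^⊥ = ker(𝕋₁V^∨ → R^∨)`. -/
noncomputable def orthogonal {V : CyclicModule.{u}}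
    (R : ∀ (S : Type) (n : ℤ), Submodule ℂ (T1 V S n)) (S : Type) (m : ℤ) :
    Submodule ℂ (T1 (dual V) S m) :=
  LinearMap.ker ((R S ((Nat.card S : ℤ) - 3 - (m + 1))).subtype.dualMap ∘ₗ T1.pairing V S m)

/-! ### The naive dual -/

/-- The image of `ψ : B A → B A → 𝕋₊V^∨`, the composition of `∂` with the map `𝕋₊A^∨ → 𝕋₊V^∨`
induced by the inclusion `φ : V → A`. -/
noncomputable def psiRange {V : CyclicModule.{v}} {A : CyclicOperad.{u}} [A.FinDim]
    (φ : V.Hom A.toCyclicModule) (S : Type) (j : ℤ) : Submodule ℂ ((free (dual V)).X S j) :=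
  LinearMap.range ((freeMap φ.dual).f S j ∘ₗ cobarD A (S := S) (rfl : j + 1 = j + 1))

/-- The naive dual `A^!`, the cokernel of `ψ`, as a quotient operad of `𝕋₊V^∨`. -/
noncomputable def naiveDual {V : CyclicModule.{v}} {A : CyclicOperad.{u}} [A.FinDim]
    (φ : V.Hom A.toCyclicModule) (hI : IsIdeal (free (dual V)) (psiRange φ)) :
    CyclicOperad.{max 1 v} :=
  (free (dual V)).quotient (psiRange φ) hI

/-- The map `V^∨ → 𝕋₊V^∨ → A^!`. -/
noncomputable def naiveDualGen {V : CyclicModule.{v}} {A : CyclicOperad.{u}} [A.FinDim]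
    (φ : V.Hom A.toCyclicModule) (hI : IsIdeal (free (dual V)) (psiRange φ)) :
    (dual V).Hom (naiveDual φ hI).toCyclicModule :=
  ((free (dual V)).quotientMap (psiRange φ) hI).toHom.comp (freeGen (dual V))

end CycOp

namespace CycOp

/-! ### The augmentation of the free operad -/

/-! The augmentation of 𝕋₊V kills every composition, and the kernel of 𝕋₊V → A is generated by sums
of trees with one edge. Hence the augmentation descends to a projection A → V of cyclic modules
which splits the inclusion of the generators and kills all compositions of A
(`IsQuadratic.proj_gen`, `IsQuadratic.proj_comp`). Dually, V^∨ is a direct summand of A^∨, and since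
∂ is adjoint to the compositions, ∂ vanishes on the copy of 𝕋₊V^∨ inside B A
(`IsQuadratic.cobarDiff_fmap_proj`). Therefore ψ(x) ∘ b = ψ(x ∘ b) for b in this copy, so the image
of ψ absorbs compositions. It is a subcomplex because δ and ∂ anticommute (`d_cobarDiff`), which is
a sign computation on trees with one edge, extended to all trees because both operators are
derivations.

On a generator f, the element ψ(f) is a sum of trees with one edge. On a composition, ψ(a ∘ b) is
the sum of ψ(a) ∘ b and ± a ∘ ψ(b), with the undifferentiated factors mapped to 𝕋₊V^∨. So the image
of ψ is generated as an ideal by elements coming from 𝕋₁V^∨, which makes A^! quadratic, and it has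
no component on the generators (`aug_psi`), which makes V^∨ → A^! injective.

It remains to find the elements of 𝕋₁V^∨ that lie in the image of ψ. The free operad is a quotient
of formal expressions, so its part with one edge is detected by functionals. An element r of 𝕋₁V
defines a natural symmetric family of bilinear forms (`edgeFormOf`), hence a functional on 𝕋₊V^∨
supported on the trees with one edge. Its value on ψ(f) is f evaluated on the image of r in A
(`functional_psi_gen`), and it vanishes on ψ of a composition, which has at least two edges. Thus ψ
on generators is the adjoint of 𝕋₁V → A, and over a field the image of the adjoint is the
annihilator of the kernel R. The pairing of 𝕋₁V^∨ with 𝕋₁V is nondegenerate (`pairing_injective`),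
so this annihilator is R^⊥.

Finite-dimensionality follows by induction on the number of legs (`FreeX.homogeneouslyFinite`): by
stability, both vertices of a nonzero gluing have fewer legs than the result. -/

/-- The identity of a cyclic `𝕊`-module. -/
def CyclicModule.Hom.id (V : CyclicModule.{u}) : V.Hom V where
  f _ _ := LinearMap.id
  f_map _ _ _ := rfl
  f_d _ _ := rfl

/-- A cyclic `𝕊`-module as a cyclic operad whose compositions vanish. -/
noncomputable def trivialOperad (V : CyclicModule.{u}) : CyclicOperad.{u} where
  toCyclicModule := V
  comp _ := 0
  comp_map _ _ _ _ _ _ _ _ _ := by simp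
  comp_comm _ _ _ _ := by simp
  comp_assoc _ _ _ _ _ _ _ := by simp
  d_comp _ _ _ _ _ _ _ _ := by simp

/-- The projection `𝕋₊V → V` which annihilates all compositions. -/
noncomputable def aug (V : CyclicModule.{u}) {S : Type} {i : ℤ} : FreeX V S i →ₗ[ℂ] V.X S i :=
  eval (A := trivialOperad V) (CyclicModule.Hom.id V)

section aug

variable {V : CyclicModule.{u}}

theorem aug_gen {S : Type} {i : ℤ} (v : V.X S i) : aug V (FreeX.gen v) = v := rfl

theorem aug_map {S T : Type} {i j : ℤ} (g : S ≃ T) (h : i = j) (x : FreeX V S i) :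
    aug V (FreeX.map g h x) = V.map g h (aug V x) :=
  eval_map (A := trivialOperad V) _ g h x

theorem aug_comp {S T : Type} {i j k : ℤ} (h : i + j = k) (a : FreeX V (Option S) i)
    (b : FreeX V (Option T) j) : aug V (FreeX.comp h a b) = 0 :=
  eval_comp (A := trivialOperad V) _ h a b

theorem aug_d {S : Type} {i j : ℤ} (h : j + 1 = i) (x : FreeX V S i) :
    aug V (FreeX.d h x) = V.d h (aug V x) :=
  eval_d (A := trivialOperad V) _ h x

theorem aug_edge {S X Y : Type} (s : X ⊕ Y ≃ S) {i j k : ℤ} (h : i + j = k)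
    (t : V.X (Option X) i ⊗[ℂ] V.X (Option Y) j) : aug V (edge s h t) = 0 := by
  induction t using TensorProduct.induction_on with
  | zero => simp only [map_zero]
  | add x y hx hy => simp only [map_add, hx, hy, add_zero]
  | tmul a b => rw [edge_tmul, aug_map, aug_comp, map_zero]

end aug

/-! ### Elementary properties of morphisms and ideals -/

theorem CyclicOperad.Hom.isIdeal_ker {A : CyclicOperad.{u}} {B : CyclicOperad.{v}}
    (Φ : A.Hom B) : IsIdeal A (fun S i => LinearMap.ker (Φ.f S i)) where
  map_mem g h x hx := by
    rw [LinearMap.mem_ker] at hx ⊢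
    rw [Φ.f_map, hx, map_zero]
  d_mem h x hx := by
    rw [LinearMap.mem_ker] at hx ⊢
    rw [Φ.f_d, hx, map_zero]
  comp_left h a b ha := by
    rw [LinearMap.mem_ker] at ha ⊢
    rw [Φ.f_comp, ha, map_zero, LinearMap.zero_apply]
  comp_right h a b hb := by
    rw [LinearMap.mem_ker] at hb ⊢
    rw [Φ.f_comp, hb, map_zero]

theorem idealSpan_le {A : CyclicOperad.{u}} {R I : ∀ (S : Type) (i : ℤ), Submodule ℂ (A.X S i)}
    (hI : IsIdeal A I) (h : ∀ S i, R S i ≤ I S i) (S : Type) (i : ℤ) :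
    idealSpan A R S i ≤ I S i :=
  iInf_le_of_le I (iInf_le_of_le hI (iInf_le_of_le h le_rfl))

theorem le_idealSpan {A : CyclicOperad.{u}} (R : ∀ (S : Type) (i : ℤ), Submodule ℂ (A.X S i))
    (S : Type) (i : ℤ) : R S i ≤ idealSpan A R S i :=
  le_iInf fun _ => le_iInf fun _ => le_iInf fun h => h S i

theorem mem_idealSpan {A : CyclicOperad.{u}} {R : ∀ (S : Type) (i : ℤ), Submodule ℂ (A.X S i)}
    {S : Type} {i : ℤ} {x : A.X S i} : x ∈ idealSpan A R S i ↔
      ∀ I : (∀ (S : Type) (i : ℤ), Submodule ℂ (A.X S i)), IsIdeal A I →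
        (∀ S i, R S i ≤ I S i) → x ∈ I S i := by
  simp only [idealSpan, Submodule.mem_iInf]

theorem isIdeal_idealSpan (A : CyclicOperad.{u})
    (R : ∀ (S : Type) (i : ℤ), Submodule ℂ (A.X S i)) : IsIdeal A (idealSpan A R) where
  map_mem g h x hx := mem_idealSpan.2 fun I hI hR => hI.map_mem g h x (mem_idealSpan.1 hx I hI hR)
  d_mem h x hx := mem_idealSpan.2 fun I hI hR => hI.d_mem h x (mem_idealSpan.1 hx I hI hR)
  comp_left h a b ha :=
    mem_idealSpan.2 fun I hI hR => hI.comp_left h a b (mem_idealSpan.1 ha I hI hR)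
  comp_right h a b hb :=
    mem_idealSpan.2 fun I hI hR => hI.comp_right h a b (mem_idealSpan.1 hb I hI hR)

open Classical in
/-- The sum of the maps `edge` over all ordered decompositions. -/
noncomputable def sumEdge (V : CyclicModule.{u}) (S : Type) (n : ℤ) :
    OrderedSplits V S n →ₗ[ℂ] FreeX V S n :=
  DirectSum.toModule ℂ (Set S × ℤ) (FreeX V S n)
    (fun x => edge (split x.1) (add_sub_cancel x.2 n))

theorem toFree_apply (V : CyclicModule.{u}) (S : Type) (n : ℤ) (t : T1 V S n) :
    T1.toFree V S n t = (1 / 2 : ℂ) • sumEdge V S n t.1 := rfl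

open Classical in
theorem sumEdge_lof (V : CyclicModule.{u}) (S : Type) (n : ℤ) (x : Set S × ℤ)
    (u : V.X (Option x.1) x.2 ⊗[ℂ] V.X (Option (x.1ᶜ : Set S)) (n - x.2)) :
    sumEdge V S n (DirectSum.lof ℂ (Set S × ℤ)
      (fun x => V.X (Option x.1) x.2 ⊗[ℂ] V.X (Option (x.1ᶜ : Set S)) (n - x.2)) x u) =
      edge (split x.1) (add_sub_cancel x.2 n) u :=
  DirectSum.toModule_lof (R := ℂ) (M := fun x : Set S × ℤ =>
    V.X (Option x.1) x.2 ⊗[ℂ] V.X (Option (x.1ᶜ : Set S)) (n - x.2))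
    (φ := fun x : Set S × ℤ => edge (split x.1) (add_sub_cancel x.2 n)) x u

/-- Two linear maps on `OrderedSplits` agree if they agree on each summand. -/
theorem orderedSplits_ext {V : CyclicModule.{u}} {S : Type} {n : ℤ} {M : Type*}
    [AddCommGroup M] [Module ℂ M] [DecidableEq (Set S × ℤ)]
    {f g : OrderedSplits V S n →ₗ[ℂ] M}
    (h : ∀ (Z : Set S) (k : ℤ) (a : V.X (Option Z) k) (b : V.X (Option (Zᶜ : Set S)) (n - k)),
      f (DirectSum.lof ℂ (Set S × ℤ)
        (fun x => V.X (Option x.1) x.2 ⊗[ℂ] V.X (Option (x.1ᶜ : Set S)) (n - x.2)) (Z, k)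
        (a ⊗ₜ b)) = g (DirectSum.lof ℂ (Set S × ℤ)
        (fun x => V.X (Option x.1) x.2 ⊗[ℂ] V.X (Option (x.1ᶜ : Set S)) (n - x.2)) (Z, k)
        (a ⊗ₜ b))) : f = g :=
  DirectSum.linearMap_ext ℂ fun x => TensorProduct.ext' fun a b => h x.1 x.2 a b

theorem aug_sumEdge (V : CyclicModule.{u}) (S : Type) (n : ℤ) (t : OrderedSplits V S n) :
    aug V (sumEdge V S n t) = 0 := by
  classical
  have : aug V ∘ₗ sumEdge V S n = 0 := orderedSplits_ext fun Z k a b => by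
    rw [LinearMap.comp_apply, sumEdge_lof, aug_edge, LinearMap.zero_apply]
  exact LinearMap.congr_fun this t

/-! ### The projection onto the generators -/

section retraction

variable {V : CyclicModule.{v}} {A : CyclicOperad.{u}} {φ : V.Hom A.toCyclicModule}

/-- The kernel is the ideal spanned by sums of one-edge trees. The augmentation is a morphism to an
operad with zero compositions, so its kernel is an ideal, and this ideal contains every one-edge
tree. This is where the quadraticity of A enters. -/
theorem IsQuadratic.ker_le_ker_aug (hA : IsQuadratic φ) (S : Type) (i : ℤ) :
    LinearMap.ker ((lift φ).f S i) ≤ LinearMap.ker (aug V (S := S) (i := i)) := by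
  rw [hA.ker_eq]
  refine idealSpan_le (A := free V) (CyclicOperad.Hom.isIdeal_ker
    (lift (A := trivialOperad V) (CyclicModule.Hom.id V))) (fun S n => ?_) S i
  rintro _ ⟨t, -, rfl⟩
  refine LinearMap.mem_ker.2 ?_
  refine (congrArg (aug V) (toFree_apply V S n t)).trans ?_
  rw [map_smul, aug_sumEdge, smul_zero]
  rfl

/-- The underlying linear maps of the projection `A → V` of a quadratic operad onto its
generators. -/
noncomputable def IsQuadratic.projAux (hA : IsQuadratic φ) (S : Type) (i : ℤ) :
    A.X S i →ₗ[ℂ] V.X S i :=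
  (LinearMap.ker ((lift φ).f S i)).liftQ (aug V) (hA.ker_le_ker_aug S i) ∘ₗ
    (((lift φ).f S i).quotKerEquivOfSurjective (hA.generates S i)).symm.toLinearMap

theorem IsQuadratic.projAux_eval (hA : IsQuadratic φ) {S : Type} {i : ℤ} (x : FreeX V S i) :
    hA.projAux S i (eval φ x) = aug V x := by
  have h : (((lift φ).f S i).quotKerEquivOfSurjective (hA.generates S i)).symm
      ((lift φ).f S i x) = Submodule.Quotient.mk x :=
    (LinearEquiv.symm_apply_eq _).2 rfl
  exact congrArg ((LinearMap.ker ((lift φ).f S i)).liftQ (aug V) (hA.ker_le_ker_aug S i)) h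

theorem IsQuadratic.exists_eval_eq (hA : IsQuadratic φ) {S : Type} {i : ℤ} (a : A.X S i) :
    ∃ x : FreeX V S i, eval φ x = a := hA.generates S i a

/-- The projection `A → V` of a quadratic operad onto its generators. -/
noncomputable def IsQuadratic.proj (hA : IsQuadratic φ) : A.toCyclicModule.Hom V where
  f := hA.projAux
  f_map g h a := by
    obtain ⟨x, rfl⟩ := hA.exists_eval_eq a
    rw [← eval_map, hA.projAux_eval, hA.projAux_eval, aug_map]
  f_d h a := by
    obtain ⟨x, rfl⟩ := hA.exists_eval_eq a
    rw [← eval_d, hA.projAux_eval, hA.projAux_eval, aug_d]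

theorem IsQuadratic.proj_gen (hA : IsQuadratic φ) {S : Type} {i : ℤ} (v : V.X S i) :
    hA.proj.f S i (φ.f S i v) = v := hA.projAux_eval (FreeX.gen v)

/-- Both factors lift to the free operad, where the augmentation kills their composition. -/
theorem IsQuadratic.proj_comp (hA : IsQuadratic φ) {S T : Type} {i j k : ℤ} (h : i + j = k)
    (a : A.X (Option S) i) (b : A.X (Option T) j) :
    hA.proj.f (S ⊕ T) k (A.comp h a b) = 0 := by
  obtain ⟨x, rfl⟩ := hA.exists_eval_eq a
  obtain ⟨y, rfl⟩ := hA.exists_eval_eq b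
  rw [← eval_comp]
  exact (hA.projAux_eval _).trans (aug_comp h x y)

theorem IsQuadratic.proj_compose (hA : IsQuadratic φ) {S X Y : Type} (s : X ⊕ Y ≃ S)
    {i j k : ℤ} (h : i + j = k) (t : A.X (Option X) i ⊗[ℂ] A.X (Option Y) j) :
    hA.proj.f S k (compose A s h t) = 0 := by
  induction t using TensorProduct.induction_on with
  | zero => simp only [map_zero]
  | add x y hx hy => simp only [map_add, hx, hy, add_zero]
  | tmul a b => rw [compose_tmul, hA.proj.f_map, hA.proj_comp, map_zero]

end retraction

/-! ### Induced maps of free operads -/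

/-- Induction over the elements of the free cyclic operad. -/
theorem FreeX.induction {V : CyclicModule.{u}} {p : ∀ {S : Type} {i : ℤ}, FreeX V S i → Prop}
    (gen : ∀ {S : Type} {i : ℤ} (v : V.X S i), p (FreeX.gen v))
    (add : ∀ {S : Type} {i : ℤ} (x y : FreeX V S i), p x → p y → p (x + y))
    (smul : ∀ {S : Type} {i : ℤ} (c : ℂ) (x : FreeX V S i), p x → p (c • x))
    (map : ∀ {S T : Type} {i j : ℤ} (g : S ≃ T) (h : i = j) (x : FreeX V S i), p x →
      p (FreeX.map g h x))
    (comp : ∀ {S T : Type} {i j k : ℤ} (h : i + j = k) (x : FreeX V (Option S) i)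
      (y : FreeX V (Option T) j), p x → p y → p (FreeX.comp h x y))
    {S : Type} {i : ℤ} (x : FreeX V S i) : p x := by
  induction x using FreeX.ind with
  | h x =>
    induction x with
    | gen v => exact gen v
    | zero =>
      -- The zero expression is treated as the generator 0, so that no separate case is needed in
      -- the induction principle.
      rw [mk_zero, ← map_zero FreeX.gen]
      exact gen 0
    | add x y hx hy => exact add _ _ hx hy
    | smul c x hx => exact smul c _ hx
    | map g h x hx => exact map g h _ hx
    | comp h x y hx hy => exact comp h _ _ hx hy

/-- The underlying linear maps of the morphism `𝕋₊V → 𝕋₊W` induced by `V → W`. -/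
noncomputable def fmap {V : CyclicModule.{u}} {W : CyclicModule.{v}} (ψ : V.Hom W)
    {S : Type} {i : ℤ} : FreeX V S i →ₗ[ℂ] FreeX W S i :=
  eval (A := free W) ((freeGen W).comp ψ)

section fmap

variable {V : CyclicModule.{u}} {W : CyclicModule.{v}} (ψ : V.Hom W)

theorem fmap_gen {S : Type} {i : ℤ} (v : V.X S i) :
    fmap ψ (FreeX.gen v) = FreeX.gen (ψ.f S i v) := rfl

theorem fmap_map {S T : Type} {i j : ℤ} (g : S ≃ T) (h : i = j) (x : FreeX V S i) :
    fmap ψ (FreeX.map g h x) = FreeX.map g h (fmap ψ x) :=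
  eval_map (A := free W) _ g h x

theorem fmap_comp {S T : Type} {i j k : ℤ} (h : i + j = k) (a : FreeX V (Option S) i)
    (b : FreeX V (Option T) j) :
    fmap ψ (FreeX.comp h a b) = FreeX.comp h (fmap ψ a) (fmap ψ b) :=
  eval_comp (A := free W) _ h a b

theorem fmap_d {S : Type} {i j : ℤ} (h : j + 1 = i) (x : FreeX V S i) :
    fmap ψ (FreeX.d h x) = FreeX.d h (fmap ψ x) :=
  eval_d (A := free W) _ h x

theorem fmap_edge {S X Y : Type} (s : X ⊕ Y ≃ S) {i j k : ℤ} (h : i + j = k)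
    (t : V.X (Option X) i ⊗[ℂ] V.X (Option Y) j) :
    fmap ψ (edge s h t) = edge s h (TensorProduct.map (ψ.f _ _) (ψ.f _ _) t) := by
  induction t using TensorProduct.induction_on with
  | zero => simp only [map_zero]
  | add x y hx hy => simp only [map_add, hx, hy]
  | tmul a b =>
    rw [TensorProduct.map_tmul, edge_tmul, edge_tmul, fmap_map, fmap_comp, fmap_gen, fmap_gen]

theorem fmap_leftInverse {ψ : V.Hom W} {ψ' : W.Hom V}
    (h : ∀ (S : Type) (i : ℤ) (v : V.X S i), ψ'.f S i (ψ.f S i v) = v) {S : Type} {i : ℤ}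
    (x : FreeX V S i) : fmap ψ' (fmap ψ x) = x := by
  induction x using FreeX.induction with
  | gen v => rw [fmap_gen, fmap_gen, h]
  | add x y hx hy => rw [map_add, map_add, hx, hy]
  | smul c x hx => rw [map_smul, map_smul, hx]
  | map g e x hx => rw [fmap_map, fmap_map, hx]
  | comp e x y hx hy => rw [fmap_comp, fmap_comp, hx, hy]

end fmap

/-- Dual to the splitting V → A → V: every element of 𝕋₊V^∨ has a canonical lift to B A. -/
theorem IsQuadratic.fmap_fmap_proj {V : CyclicModule.{v}} {A : CyclicOperad.{u}}
    {φ : V.Hom A.toCyclicModule} (hA : IsQuadratic φ) {S : Type} {i : ℤ}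
    (x : FreeX (dual V) S i) : fmap φ.dual (fmap hA.proj.dual x) = x := by
  refine fmap_leftInverse (fun S i f => ?_) x
  refine LinearMap.ext (M := V.X S ((Nat.card S : ℤ) - 3 - i)) fun v => ?_
  exact congrArg (DFunLike.coe (F := Module.Dual ℂ (V.X S _)) f) (hA.proj_gen v)

/-! ### The cobar differential -/

section cobar

variable (A : CyclicOperad.{u}) [A.FinDim]

/-- The operator `∂`, in terms of the underlying vector spaces of the free operad. -/
noncomputable def cobarDiff {S : Type} {i j : ℤ} (h : j + 1 = i) :
    FreeX (dual A.toCyclicModule) S i →ₗ[ℂ] FreeX (dual A.toCyclicModule) S j :=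
  FreeX.deriv (cobarGen A) (cobarGen_natural A) h

theorem cobarDiff_gen {S : Type} {i j : ℤ} (h : j + 1 = i) (v : (dual A.toCyclicModule).X S i) :
    cobarDiff A h (FreeX.gen v) = cobarGen A h v := rfl

theorem cobarDiff_map {S T : Type} {i j k l : ℤ} (g : S ≃ T) (h : i = k) (h' : j = l)
    (hi : j + 1 = i) (hk : l + 1 = k) (x : FreeX (dual A.toCyclicModule) S i) :
    FreeX.map g h' (cobarDiff A hi x) = cobarDiff A hk (FreeX.map g h x) :=
  FreeX.deriv_map _ (cobarGen_natural A) g h h' hi hk x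

theorem cobarDiff_comp {S T : Type} {i j k i' j' k' : ℤ} (h : i + j = k) (hi : i' + 1 = i)
    (hj : j' + 1 = j) (hk : k' + 1 = k) (h1 : i' + j = k') (h2 : i + j' = k')
    (a : FreeX (dual A.toCyclicModule) (Option S) i)
    (b : FreeX (dual A.toCyclicModule) (Option T) j) :
    cobarDiff A hk (FreeX.comp h a b) = FreeX.comp h1 (cobarDiff A hi a) b +
      ksign i • FreeX.comp h2 a (cobarDiff A hj b) :=
  FreeX.deriv_comp _ (cobarGen_natural A) h hi hj hk h1 h2 a b

theorem mem_psiRange {V : CyclicModule.{v}} (φ : V.Hom A.toCyclicModule) {S : Type} {j : ℤ}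
    {y : FreeX (dual V) S j} : y ∈ psiRange φ S j ↔
      ∃ x : FreeX (dual A.toCyclicModule) S (j + 1), fmap φ.dual (cobarDiff A rfl x) = y :=
  Iff.rfl

theorem psi_mem {V : CyclicModule.{v}} (φ : V.Hom A.toCyclicModule) {S : Type} {i j : ℤ}
    (h : j + 1 = i) (x : FreeX (dual A.toCyclicModule) S i) :
    fmap φ.dual (cobarDiff A h x) ∈ psiRange φ S j := by
  subst h
  exact (mem_psiRange A φ).2 ⟨x, rfl⟩

theorem CyclicModule.finite_support (W : CyclicModule.{u}) [W.FinDim] (S : Type) :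
    {i : ℤ | Nontrivial (W.X S i)}.Finite := by
  classical
  obtain ⟨s, hs⟩ := (CyclicModule.FinDim.finite (V := W) S).fg_top
  refine (s.biUnion fun w => DFinsupp.support w).finite_toSet.subset fun i hi => ?_
  by_contra hn
  -- A degree outside the supports of a finite spanning set is invisible to every element of the
  -- direct sum.
  have key : ∀ w : ⨁ i : ℤ, W.X S i, w i = 0 := by
    intro w
    have hw : w ∈ Submodule.span ℂ (s : Set (⨁ i : ℤ, W.X S i)) := hs ▸ Submodule.mem_top
    induction hw using Submodule.span_induction with
    | mem w hw =>
      by_contra h0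
      exact hn (Finset.mem_coe.2 (Finset.mem_biUnion.2 ⟨w, hw, DFinsupp.mem_support_iff.2 h0⟩))
    | zero => rfl
    | add x y _ _ hx hy => rw [DirectSum.add_apply, hx, hy, add_zero]
    | smul c x _ hx => rw [DirectSum.smul_apply, hx, smul_zero]
  obtain ⟨v, hv⟩ := @exists_ne _ hi 0
  exact hv ((DirectSum.lof_apply ℂ i v).symm.trans (key (DirectSum.lof ℂ ℤ (W.X S) i v)))

/-- There are finitely many subsets of S, and for each one finitely many degrees. Looking at the
first tensor factor alone already gives a finite index set, which serves for all sums over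
decompositions below. -/
theorem dual_finite_support {S : Type} [Finite S] :
    {x : Set S × ℤ | Nontrivial ((dual A.toCyclicModule).X (Option x.1) x.2)}.Finite := by
  refine (Set.Finite.preimage (f := fun x : Set S × ℤ =>
    (x.1, (Nat.card (Option x.1) : ℤ) - 3 - x.2)) ?_
    (Set.finite_iUnion fun Z : Set S =>
      ((Set.finite_singleton Z).prod (A.finite_support (Option Z))))).subset ?_
  · rintro ⟨Z, i⟩ - ⟨Z', i'⟩ - h
    obtain ⟨rfl, h⟩ := Prod.mk.inj h
    exact Prod.ext rfl (by simpa using h)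
  · rintro ⟨Z, i⟩ hx
    refine Set.mem_iUnion.2 ⟨Z, rfl, ?_⟩
    by_contra hn
    have h0 : Subsingleton (A.X (Option Z) ((Nat.card (Option Z) : ℤ) - 3 - i)) :=
      not_nontrivial_iff_subsingleton.1 hn
    exact not_subsingleton_iff_nontrivial.2 hx
      (inferInstanceAs (Subsingleton (Module.Dual ℂ _)))

theorem cobarTerm_finite {S : Type} [Finite S] (n j : ℤ) :
    (Function.support (cobarTerm A (S := S) n j)).Finite := by
  refine (dual_finite_support A).subset fun x hx => ?_
  by_contra hn
  have := not_nontrivial_iff_subsingleton.1 hn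
  refine hx (LinearMap.ext fun v => ?_)
  exact (congrArg (edge _ _) (Subsingleton.elim _ 0)).trans (map_zero _)

/-- Evaluation at v may be moved inside the `finsum` only because the family of linear maps has
finite support. -/
theorem cobarGen_apply {S : Type} [Finite S] {n j : ℤ} (h : j + 1 = n)
    (v : (dual A.toCyclicModule).X S n) :
    cobarGen A h v = (1 / 2 : ℂ) • ∑ᶠ x : Set S × ℤ, cobarTerm A n j x v := by
  unfold cobarGen
  rw [LinearMap.smul_apply]
  congr 1
  exact ((LinearMap.applyₗ (R := ℂ) v).toAddMonoidHom.map_finsum (cobarTerm_finite A n j))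

theorem cobarGen_infinite {S : Type} (hS : ¬ Finite S) {n j : ℤ} (h : j + 1 = n)
    (v : (dual A.toCyclicModule).X S n) : cobarGen A h v = 0 := by
  have h0 : Nat.card S = 0 := by
    have : Infinite S := not_finite_iff_infinite.mp hS
    exact Nat.card_eq_zero_of_infinite
  have := (dual A.toCyclicModule).stable S n (by omega)
  rw [Subsingleton.elim v 0, map_zero]

end cobar

/-! ### The image of `ψ` is closed under compositions -/

section psi

variable {V : CyclicModule.{v}} {A : CyclicOperad.{u}} [A.FinDim] {φ : V.Hom A.toCyclicModule}

theorem cocompose_eq_zero {S X Y : Type} (s : X ⊕ Y ≃ S) (i j n : ℤ)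
    (f : (dual A.toCyclicModule).X S n)
    (hf : ∀ (p q : ℤ) (h : p + q = (Nat.card S : ℤ) - 3 - n)
      (t : A.X (Option X) p ⊗[ℂ] A.X (Option Y) q),
      DFunLike.coe (F := Module.Dual ℂ (A.X S ((Nat.card S : ℤ) - 3 - n))) f
        (compose A s h t) = 0) :
    cocompose A s i j n f = 0 := by
  by_cases h : ((Nat.card (Option X) : ℤ) - 3 - i) + ((Nat.card (Option Y) : ℤ) - 3 - j) =
      (Nat.card S : ℤ) - 3 - n
  · refine (TensorProduct.dualDistribEquiv ℂ
          (A.X (Option X) ((Nat.card (Option X) : ℤ) - 3 - i))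
          (A.X (Option Y) ((Nat.card (Option Y) : ℤ) - 3 - j))).injective ?_
    refine LinearMap.ext fun t => ?_
    refine (cocomposeAux_apply A s i j n h f t).trans ?_
    refine (congrArg (cosign s i * ·) (hf _ _ h t)).trans ((mul_zero _).trans ?_)
    exact (LinearMap.congr_fun (map_zero (TensorProduct.dualDistribEquiv ℂ
      (A.X (Option X) ((Nat.card (Option X) : ℤ) - 3 - i))
      (A.X (Option Y) ((Nat.card (Option Y) : ℤ) - 3 - j)))) t).symm
  · exact LinearMap.congr_fun (cocomposeAux_zero A s i j n h) f

/-- A functional pulled back along A → V vanishes on all compositions of A, and ∂ on generators is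
built from the adjoints of these compositions. -/
theorem IsQuadratic.cobarGen_proj (hA : IsQuadratic φ) {S : Type} {n j : ℤ} (h : j + 1 = n)
    (v : (dual V).X S n) : cobarGen A h (hA.proj.dual.f S n v) = 0 := by
  by_cases hS : Finite S
  · rw [cobarGen_apply]
    refine (congrArg _ (finsum_congr fun x => ?_)).trans
      ((congrArg _ finsum_zero).trans (smul_zero _))
    refine (congrArg (edge (split x.1) (add_sub_cancel x.2 j)) ?_).trans (map_zero _)
    refine cocompose_eq_zero _ _ _ _ _ fun p q e t => ?_
    refine Eq.trans (congrArg (DFunLike.coe (F := Module.Dual ℂ _) v)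
      (hA.proj_compose (split x.1) e t)) ?_
    exact map_zero (M := V.X S _) (F := Module.Dual ℂ (V.X S _)) v
  · exact cobarGen_infinite A hS h _

/-- A derivation which vanishes on a set of generators vanishes on the suboperad they generate. -/
theorem IsQuadratic.cobarDiff_fmap_proj (hA : IsQuadratic φ) {S : Type} {i j : ℤ}
    (h : j + 1 = i) (x : FreeX (dual V) S i) : cobarDiff A h (fmap hA.proj.dual x) = 0 := by
  induction x using FreeX.induction generalizing j with
  | gen v => rw [fmap_gen, cobarDiff_gen, hA.cobarGen_proj]
  | add x y hx hy => rw [map_add, map_add, hx, hy, add_zero]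
  | smul c x hx => rw [map_smul, map_smul, hx, smul_zero]
  | map g e x hx =>
    subst e
    rw [fmap_map, ← cobarDiff_map A g rfl rfl h, hx, map_zero]
  | @comp S T p q r e x y hx hy =>
    rw [fmap_comp, cobarDiff_comp A (i' := p - 1) (j' := q - 1) e (by omega) (by omega) h
      (by omega) (by omega), hx, hy, map_zero, map_zero, LinearMap.zero_apply, smul_zero, add_zero]

theorem psiRange_map_mem {S T : Type} {i j : ℤ} (g : S ≃ T) (h : i = j) (y : FreeX (dual V) S i)
    (hy : y ∈ psiRange φ S i) : FreeX.map g h y ∈ psiRange φ T j := by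
  obtain ⟨x, rfl⟩ := (mem_psiRange A φ).1 hy
  subst h
  have := psi_mem A φ rfl (FreeX.map g rfl x)
  rwa [← cobarDiff_map A g rfl rfl rfl, fmap_map] at this

/-- Writing a = ψ(x), let b' be the lift of b to B A given by the projection A → V. Then ∂ kills b',
so ψ(x ∘ b') = ψ(x) ∘ b, and no second Leibniz term survives. -/
theorem IsQuadratic.psiRange_comp_left (hA : IsQuadratic φ) {S T : Type} {i j k : ℤ}
    (h : i + j = k) (a : FreeX (dual V) (Option S) i) (b : FreeX (dual V) (Option T) j)
    (ha : a ∈ psiRange φ (Option S) i) : FreeX.comp h a b ∈ psiRange φ (S ⊕ T) k := by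
  obtain ⟨x, rfl⟩ := (mem_psiRange A φ).1 ha
  have := psi_mem A φ (j := k) rfl
    (FreeX.comp (i := i + 1) (k := k + 1) (by omega) x (fmap hA.proj.dual b))
  rwa [cobarDiff_comp A (i' := i) (j' := j - 1) _ rfl (by omega) rfl h (by omega),
    hA.cobarDiff_fmap_proj, map_zero, smul_zero, add_zero, fmap_comp, hA.fmap_fmap_proj] at this

/-- Reduced to the other side by the graded symmetry of the gluing; the Koszul sign is its own
inverse. -/
theorem IsQuadratic.psiRange_comp_right (hA : IsQuadratic φ) {S T : Type} {i j k : ℤ}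
    (h : i + j = k) (a : FreeX (dual V) (Option S) i) (b : FreeX (dual V) (Option T) j)
    (hb : b ∈ psiRange φ (Option T) j) : FreeX.comp h a b ∈ psiRange φ (S ⊕ T) k := by
  have h1 := hA.psiRange_comp_left (k := k) (by omega) b a hb
  have h2 := psiRange_map_mem (φ := φ) (Equiv.sumComm T S) rfl _ h1
  rw [FreeX.comp_comm _ h] at h2
  have h3 := (psiRange φ (S ⊕ T) k).smul_mem (ksign (j * i)) h2
  have h4 : ksign (j * i) • ksign (j * i) • FreeX.comp h a b = FreeX.comp h a b := by
    rw [smul_smul, ksign_mul_self, one_smul]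
  exact h4 ▸ h3

end psi

/-! ### Evaluation of elements of the dual -/

/-- The identification of the components of the dual with linear duals. -/
noncomputable def dualEv (V : CyclicModule.{u}) {S : Type} {i : ℤ} :
    (dual V).X S i →ₗ[ℂ] Module.Dual ℂ (V.X S ((Nat.card S : ℤ) - 3 - i)) := LinearMap.id

/-- The evaluation of tensors of elements of the dual. -/
noncomputable def tensorEv (V : CyclicModule.{u}) {S T : Type} {i j : ℤ} :
    (dual V).X S i ⊗[ℂ] (dual V).X T j →ₗ[ℂ] Module.Dual ℂ
      (V.X S ((Nat.card S : ℤ) - 3 - i) ⊗[ℂ] V.X T ((Nat.card T : ℤ) - 3 - j)) :=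
  TensorProduct.dualDistrib ℂ (V.X S ((Nat.card S : ℤ) - 3 - i))
    (V.X T ((Nat.card T : ℤ) - 3 - j))

section ev

variable {V : CyclicModule.{u}}

theorem dualEv_map {S T : Type} {i j : ℤ} (g : S ≃ T) (h : i = j) (f : (dual V).X S i)
    (x : V.X T ((Nat.card T : ℤ) - 3 - j)) : dualEv V ((dual V).map g h f) x =
      detC g * dualEv V f (V.map g.symm (by rw [Nat.card_congr g, h]) x) := rfl

theorem dualEv_d {S : Type} {i j : ℤ} (h : j + 1 = i) (f : (dual V).X S i)
    (x : V.X S ((Nat.card S : ℤ) - 3 - j)) : dualEv V ((dual V).d h f) x =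
      ksign ((Nat.card S : ℤ) - 3) * dualEv V f (V.d (by omega) x) := rfl

theorem dualEv_hom {W : CyclicModule.{v}} (φ : V.Hom W) {S : Type} {i : ℤ} (f : (dual W).X S i)
    (x : V.X S ((Nat.card S : ℤ) - 3 - i)) :
    dualEv V (φ.dual.f S i f) x = dualEv W f (φ.f S _ x) := rfl

theorem dual_ext {S : Type} {i : ℤ} {f g : (dual V).X S i}
    (h : ∀ x, dualEv V f x = dualEv V g x) : f = g := LinearMap.ext h

theorem tensorEv_tmul {S T : Type} {i j : ℤ} (f : (dual V).X S i) (g : (dual V).X T j)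
    (a : V.X S ((Nat.card S : ℤ) - 3 - i)) (b : V.X T ((Nat.card T : ℤ) - 3 - j)) :
    tensorEv V (f ⊗ₜ[ℂ] g) (a ⊗ₜ[ℂ] b) = dualEv V f a * dualEv V g b := rfl

theorem tensorEv_injective {S T : Type} {i j : ℤ}
    [FiniteDimensional ℂ (V.X S ((Nat.card S : ℤ) - 3 - i))]
    [FiniteDimensional ℂ (V.X T ((Nat.card T : ℤ) - 3 - j))] :
    Function.Injective (tensorEv V (S := S) (T := T) (i := i) (j := j)) :=
  (TensorProduct.dualDistribEquiv ℂ (V.X S ((Nat.card S : ℤ) - 3 - i))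
    (V.X T ((Nat.card T : ℤ) - 3 - j))).injective

/-- Evaluation of tensors is compatible with pairs of adjoint maps. -/
theorem tensorEv_map {W : CyclicModule.{v}} {S T S' T' : Type} {i j i' j' : ℤ} (c c' : ℂ)
    (P : (dual W).X S' i' →ₗ[ℂ] (dual V).X S i) (Q : (dual W).X T' j' →ₗ[ℂ] (dual V).X T j)
    (P' : V.X S ((Nat.card S : ℤ) - 3 - i) →ₗ[ℂ] W.X S' ((Nat.card S' : ℤ) - 3 - i'))
    (Q' : V.X T ((Nat.card T : ℤ) - 3 - j) →ₗ[ℂ] W.X T' ((Nat.card T' : ℤ) - 3 - j'))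
    (hP : ∀ f x, dualEv V (P f) x = c * dualEv W f (P' x))
    (hQ : ∀ f x, dualEv V (Q f) x = c' * dualEv W f (Q' x))
    (t : (dual W).X S' i' ⊗[ℂ] (dual W).X T' j')
    (z : V.X S ((Nat.card S : ℤ) - 3 - i) ⊗[ℂ] V.X T ((Nat.card T : ℤ) - 3 - j)) :
    tensorEv V (TensorProduct.map P Q t) z =
      c * c' * tensorEv W t (TensorProduct.map P' Q' z) := by
  induction t using TensorProduct.induction_on with
  | zero => simp only [map_zero, LinearMap.zero_apply, mul_zero]
  | add x y hx hy => simp only [map_add, LinearMap.add_apply, hx, hy, mul_add]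
  | tmul f g =>
    induction z using TensorProduct.induction_on with
    | zero => simp only [map_zero, mul_zero]
    | add x y hx hy => simp only [map_add, hx, hy, mul_add]
    | tmul a b =>
      rw [TensorProduct.map_tmul, TensorProduct.map_tmul, tensorEv_tmul, tensorEv_tmul, hP, hQ]
      ring

theorem tensorEv_cocompose (A : CyclicOperad.{u}) [A.FinDim] {S X Y : Type} (s : X ⊕ Y ≃ S)
    (i j n : ℤ) (h : ((Nat.card (Option X) : ℤ) - 3 - i) + ((Nat.card (Option Y) : ℤ) - 3 - j) =
      (Nat.card S : ℤ) - 3 - n) (f : (dual A.toCyclicModule).X S n)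
    (z : A.X (Option X) ((Nat.card (Option X) : ℤ) - 3 - i) ⊗[ℂ]
      A.X (Option Y) ((Nat.card (Option Y) : ℤ) - 3 - j)) :
    tensorEv A.toCyclicModule (cocompose A s i j n f) z =
      cosign s i * dualEv A.toCyclicModule f (compose A s h z) :=
  cocomposeAux_apply A s i j n h f z

end ev

/-! ### Anticommutation of ∂ with the internal differential -/

theorem ksign_neg (n : ℤ) : ksign (-n) = ksign n := ksign_congr ⟨-n, by ring⟩

theorem ksign_one : ksign 1 = -1 := by simp [ksign]

/-- The two extra elements are the two halves of the edge. All degree bookkeeping below reduces to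
this count. -/
theorem card_option_add_card_option {S X Y : Type} [Finite S] (s : X ⊕ Y ≃ S) :
    (Nat.card (Option X) : ℤ) + Nat.card (Option Y) = Nat.card S + 2 := by
  have : Finite (X ⊕ Y) := Finite.of_equiv _ s.symm
  have : Finite X := Finite.of_injective _ (Sum.inl_injective (β := Y))
  have : Finite Y := Finite.of_injective _ (Sum.inr_injective (α := X))
  rw [← Nat.card_congr s, Nat.card_sum, Finite.card_option, Finite.card_option]
  push_cast
  ring

theorem cosign_succ {S X Y : Type} (s : X ⊕ Y ≃ S) (i : ℤ) :
    cosign s (i + 1) = ksign ((Nat.card (Option Y) : ℤ) - 3) * cosign s i := by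
  unfold cosign
  rw [mul_left_comm, ← ksign_add]
  congr 1
  refine ksign_congr ⟨-((Nat.card (Option Y) : ℤ) - 3), by ring⟩

theorem edge_d {V : CyclicModule.{u}} {S X Y : Type} (s : X ⊕ Y ≃ S) {i j k i' j' k' : ℤ}
    (h : i + j = k) (hi : i' + 1 = i) (hj : j' + 1 = j) (hk : k' + 1 = k) (h1 : i' + j = k')
    (h2 : i + j' = k') (t : V.X (Option X) i ⊗[ℂ] V.X (Option Y) j) :
    FreeX.d hk (edge s h t) = edge s h1 (TensorProduct.map (V.d hi) LinearMap.id t) +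
      ksign i • edge s h2 (TensorProduct.map LinearMap.id (V.d hj) t) := by
  induction t using TensorProduct.induction_on with
  | zero => simp only [map_zero, smul_zero, add_zero]
  | add x y hx hy => simp only [map_add, hx, hy, smul_add]; abel
  | tmul a b =>
    rw [TensorProduct.map_tmul, TensorProduct.map_tmul, edge_tmul, edge_tmul, edge_tmul,
      ← FreeX.map_d s rfl rfl hk, FreeX.d_comp h hi hj hk h1 h2, map_add, map_smul]
    rfl

theorem compose_d (A : CyclicOperad.{u}) {S X Y : Type} (s : X ⊕ Y ≃ S) {i j k i' j' k' : ℤ}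
    (h : i + j = k) (hi : i' + 1 = i) (hj : j' + 1 = j) (hk : k' + 1 = k) (h1 : i' + j = k')
    (h2 : i + j' = k') (t : A.X (Option X) i ⊗[ℂ] A.X (Option Y) j) :
    A.d hk (compose A s h t) = compose A s h1 (TensorProduct.map (A.d hi) LinearMap.id t) +
      ksign i • compose A s h2 (TensorProduct.map LinearMap.id (A.d hj) t) := by
  induction t using TensorProduct.induction_on with
  | zero => simp only [map_zero, smul_zero, add_zero]
  | add x y hx hy => simp only [map_add, hx, hy, smul_add]; abel
  | tmul a b =>
    rw [TensorProduct.map_tmul, TensorProduct.map_tmul, compose_tmul, compose_tmul, compose_tmul,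
      ← A.map_d s rfl rfl hk hk, A.d_comp h hi hj hk h1 h2, map_add, map_smul]
    rfl

section anticommute

variable (A : CyclicOperad.{u}) [A.FinDim]

/-- This is the adjoint of the Leibniz rule in A. The minus sign that turns compatibility into
anticommutation comes from the suspensions: ∂ has degree -1, so the suspension degree of S exceeds
the sum of those of the two vertices by one. -/
theorem cocompose_d {S X Y : Type} [Finite S] (s : X ⊕ Y ≃ S) {i i' j j' n n' : ℤ}
    (hi : i + 1 = i') (hj : j + 1 = j') (hn : n' + 1 = n) (h : i + j + 1 = n')
    (f : (dual A.toCyclicModule).X S n) :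
    cocompose A s i j n' ((dual A.toCyclicModule).d hn f) +
      (TensorProduct.map ((dual A.toCyclicModule).d hi) LinearMap.id (cocompose A s i' j n f) +
        ksign i • TensorProduct.map LinearMap.id ((dual A.toCyclicModule).d hj)
          (cocompose A s i j' n f)) = 0 := by
  have hc := card_option_add_card_option s
  refine tensorEv_injective ?_
  rw [map_zero]
  refine LinearMap.ext fun z => ?_
  rw [map_add, map_add, map_smul, LinearMap.add_apply, LinearMap.add_apply, LinearMap.smul_apply,
    tensorEv_cocompose A s i j n' (by omega), dualEv_d,
    tensorEv_map (ksign ((Nat.card (Option X) : ℤ) - 3)) 1 _ _ (A.d (by omega)) LinearMap.id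
      (fun f x => dualEv_d hi f x) (fun _ _ => (one_mul _).symm),
    tensorEv_map 1 (ksign ((Nat.card (Option Y) : ℤ) - 3)) _ _ LinearMap.id (A.d (by omega))
      (fun _ _ => (one_mul _).symm) (fun f x => dualEv_d hj f x),
    tensorEv_cocompose A s i' j n (by omega), tensorEv_cocompose A s i j' n (by omega),
    compose_d A s (i' := (Nat.card (Option X) : ℤ) - 3 - i')
      (j' := (Nat.card (Option Y) : ℤ) - 3 - j') _ (by omega) (by omega) (by omega) (by omega)
      (by omega)]
  subst hi
  rw [cosign_succ, map_add, map_smul]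
  -- Since |X ∪ {*}| + |Y ∪ {*}| = |S| + 2, the exponents |X ∪ {*}| - 3 and |Y ∪ {*}| - 3 add up to
  -- |S| - 4, which is one less than |S| - 3.
  have e1 : ksign ((Nat.card S : ℤ) - 3) = - (ksign ((Nat.card (Option X) : ℤ) - 3) *
      ksign ((Nat.card (Option Y) : ℤ) - 3)) := by
    rw [← ksign_add, ← mul_neg_one, ← ksign_one, ← ksign_add]
    exact ksign_congr ⟨0, by linarith⟩
  have e2 : ksign ((Nat.card (Option X) : ℤ) - 3 - i) =
      ksign ((Nat.card (Option X) : ℤ) - 3) * ksign i := by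
    rw [sub_eq_add_neg, ksign_add, ksign_neg]
  have e3 := ksign_mul_self ((Nat.card (Option X) : ℤ) - 3)
  rw [e1, e2, LinearMap.zero_apply]
  generalize dualEv A.toCyclicModule f _ = y
  generalize dualEv A.toCyclicModule f _ = z
  simp only [smul_eq_mul]
  linear_combination (-(cosign s i) * ksign ((Nat.card (Option Y) : ℤ) - 3) * ksign i * z) * e3

theorem support_edge_finite {S : Type} [Finite S] {j : ℤ} {M : Type*} [AddCommMonoid M]
    (L : ∀ x : Set S × ℤ, (dual A.toCyclicModule).X (Option x.1) x.2 ⊗[ℂ]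
      (dual A.toCyclicModule).X (Option (x.1ᶜ : Set S)) (j - x.2) → M) (hL : ∀ x, L x 0 = 0)
    (t : ∀ x : Set S × ℤ, (dual A.toCyclicModule).X (Option x.1) x.2 ⊗[ℂ]
      (dual A.toCyclicModule).X (Option (x.1ᶜ : Set S)) (j - x.2)) :
    (Function.support fun x => L x (t x)).Finite := by
  refine (dual_finite_support A (S := S)).subset fun x hx => ?_
  by_contra hn
  have := not_nontrivial_iff_subsingleton.1 hn
  refine hx ?_
  exact (congrArg (L x) (Subsingleton.elim (t x) 0)).trans (hL x)

/-- The identity for a single decomposition is summed over all decompositions. Differentiating the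
left vertex lowers its degree, so the corresponding terms `P` appear at an index shifted by one; the
shift disappears after reindexing the sum. -/
theorem d_cobarGen {S : Type} {n n' m m' : ℤ} (hm : m + 1 = n) (hn : n' + 1 = n)
    (hm' : m' + 1 = m) (hn' : m' + 1 = n') (f : (dual A.toCyclicModule).X S n) :
    cobarGen A hn' ((dual A.toCyclicModule).d hn f) + FreeX.d hm' (cobarGen A hm f) = 0 := by
  by_cases hS : Finite S
  swap
  · rw [cobarGen_infinite A hS, cobarGen_infinite A hS, map_zero, add_zero]
  obtain rfl : m = n' := by omega
  let P : ∀ x : Set S × ℤ, (dual A.toCyclicModule).X (Option x.1) x.2 ⊗[ℂ]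
      (dual A.toCyclicModule).X (Option (x.1ᶜ : Set S)) (m' - x.2) := fun x =>
    TensorProduct.map ((dual A.toCyclicModule).d rfl) LinearMap.id
      (cocompose A (split x.1) (x.2 + 1) (m' - x.2) n f)
  let Q : ∀ x : Set S × ℤ, (dual A.toCyclicModule).X (Option x.1) x.2 ⊗[ℂ]
      (dual A.toCyclicModule).X (Option (x.1ᶜ : Set S)) (m' - x.2) := fun x =>
    ksign x.2 • TensorProduct.map LinearMap.id ((dual A.toCyclicModule).d (by omega))
      (cocompose A (split x.1) x.2 (m - x.2) n f)
  let E := fun x : Set S × ℤ => edge (V := dual A.toCyclicModule) (split x.1)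
    (add_sub_cancel x.2 m')
  have h1 : ∀ x : Set S × ℤ, FreeX.d hm' (cobarTerm A n m x f) =
      E (x.1, x.2 - 1) (P (x.1, x.2 - 1)) + E x (Q x) := by
    rintro ⟨Z, i⟩
    refine (edge_d (split Z) (i' := i - 1) (j' := m' - i) _ (by omega) (by omega) hm' (by omega)
      (by omega) _).trans ?_
    refine congrArg₂ (· + ·) ?_ (map_smul (E (Z, i)) _ _).symm
    -- The degrees i and (i - 1) + 1 agree only propositionally; generalizing them to variables
    -- makes the substitution possible.
    have key : ∀ (a b c : ℤ) (ha : a = i) (hb : b = m - i) (hc : c + 1 = a) (hc' : c + b = m'),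
        edge (split Z) (show i - 1 + (m - i) = m' by omega)
          (TensorProduct.map ((dual A.toCyclicModule).d (by omega)) LinearMap.id
            (cocompose A (split Z) i (m - i) n f)) =
        edge (split Z) hc' (TensorProduct.map ((dual A.toCyclicModule).d hc) LinearMap.id
            (cocompose A (split Z) a b n f)) := by
      rintro a b c rfl rfl hc hc'
      obtain rfl : c = a - 1 := by omega
      rfl
    exact key (i - 1 + 1) (m' - (i - 1)) (i - 1) (by omega) (by omega) rfl (by omega)
  have h2 : ∀ x : Set S × ℤ, cobarTerm A m m' x ((dual A.toCyclicModule).d hn f) +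
      (E x (P x) + E x (Q x)) = 0 := by
    intro x
    refine (congrArg _ (map_add (E x) _ _).symm).trans ((map_add (E x) _ _).symm.trans ?_)
    exact (congrArg (E x) (cocompose_d A (split x.1) rfl (by omega) hn (by omega) f)).trans
      (map_zero _)
  have hP : (Function.support fun x => E x (P x)).Finite :=
    support_edge_finite A (fun x => E x) (fun x => map_zero _) P
  have hQ : (Function.support fun x => E x (Q x)).Finite :=
    support_edge_finite A (fun x => E x) (fun x => map_zero _) Q
  have hT : (Function.support fun x => cobarTerm A (S := S) n m x f).Finite :=
    (cobarTerm_finite A n m).subset fun x hx h0 => hx (LinearMap.congr_fun h0 _)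
  have hT' : (Function.support fun x => cobarTerm A (S := S) m m' x
      ((dual A.toCyclicModule).d hn f)).Finite :=
    (cobarTerm_finite A m m').subset fun x hx h0 => hx (LinearMap.congr_fun h0 _)
  -- The shift of the left degree that absorbs the index (Z, i - 1) of `P`.
  let e : Set S × ℤ ≃ Set S × ℤ := (Equiv.refl _).prodCongr (Equiv.subRight 1)
  have h3 : ∑ᶠ x, FreeX.d hm' (cobarTerm A n m x f) =
      ∑ᶠ x, E x (P x) + ∑ᶠ x, E x (Q x) := by
    rw [finsum_congr h1, finsum_add_distrib _ hQ]
    · exact congrArg (· + _) (finsum_comp_equiv e (f := fun x => E x (P x)))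
    · exact (hP.preimage e.injective.injOn : _)
  rw [cobarGen_apply, cobarGen_apply, map_smul, ← smul_add]
  have h4 : FreeX.d hm' (∑ᶠ x : Set S × ℤ, cobarTerm A n m x f) =
      ∑ᶠ x, FreeX.d hm' (cobarTerm A n m x f) :=
    (FreeX.d (V := dual A.toCyclicModule) hm').toAddMonoidHom.map_finsum hT
  rw [h4, h3, ← finsum_add_distrib hP hQ, ← finsum_add_distrib hT'
    ((hP.union hQ).subset (Function.support_add _ _)), finsum_congr h2, finsum_zero, smul_zero]

/-- The anticommutator of two odd derivations is a derivation, so it vanishes once it vanishes on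
generators. -/
theorem d_cobarDiff {S : Type} {n n' m m' : ℤ} (hm : m + 1 = n) (hn : n' + 1 = n)
    (hm' : m' + 1 = m) (hn' : m' + 1 = n') (x : FreeX (dual A.toCyclicModule) S n) :
    cobarDiff A hn' (FreeX.d hn x) + FreeX.d hm' (cobarDiff A hm x) = 0 := by
  induction x using FreeX.induction generalizing n' m m' with
  | gen v => rw [FreeX.d_gen, cobarDiff_gen, cobarDiff_gen, d_cobarGen]
  | add x y hx hy =>
    have h1 := hx hm hn hm' hn'
    have h2 := hy hm hn hm' hn'
    simp only [map_add]
    rw [add_add_add_comm, h1, h2, add_zero]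
  | smul c x hx =>
    have h1 := hx hm hn hm' hn'
    simp only [map_smul]
    rw [← smul_add, h1, smul_zero]
  | map g e x hx =>
    subst e
    rw [← FreeX.map_d g rfl rfl hn, ← cobarDiff_map A g rfl rfl hn', ← cobarDiff_map A g rfl rfl hm,
      ← FreeX.map_d g rfl rfl hm', ← map_add, hx, map_zero]
  | @comp S T p q r e x y hx hy =>
    obtain rfl : m = n' := by omega
    have h1 := hx (n' := p - 1) (m := p - 1) (m' := p - 1 - 1) (by omega) (by omega) (by omega)
      (by omega)
    have h2 := hy (n' := q - 1) (m := q - 1) (m' := q - 1 - 1) (by omega) (by omega) (by omega)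
      (by omega)
    rw [FreeX.d_comp (i' := p - 1) (j' := q - 1) (k' := m) e (by omega) (by omega) hn (by omega)
      (by omega), cobarDiff_comp A (i' := p - 1) (j' := q - 1) (k' := m) e (by omega) (by omega)
      hm (by omega) (by omega), map_add, map_add, map_smul, map_smul,
      FreeX.d_comp (i' := p - 1 - 1) (j' := q - 1) (k' := m') _ (by omega) (by omega) hm'
        (by omega) (by omega),
      FreeX.d_comp (i' := p - 1) (j' := q - 1 - 1) (k' := m') _ (by omega) (by omega) hm'
        (by omega) (by omega),
      cobarDiff_comp A (i' := p - 1 - 1) (j' := q - 1) (k' := m') _ (by omega) (by omega) hm'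
        (by omega) (by omega),
      cobarDiff_comp A (i' := p - 1) (j' := q - 1 - 1) (k' := m') _ (by omega) (by omega) hm'
        (by omega) (by omega)]
    -- With this sign, the mixed terms in which δ and ∂ act on different factors cancel in pairs.
    have hp : ksign (p - 1) = - ksign p := by
      rw [sub_eq_add_neg, ksign_add, ksign_neg, ksign_one, mul_neg_one]
    rw [hp]
    rw [add_eq_zero_iff_eq_neg] at h1 h2
    rw [h1, h2]
    simp only [map_neg, LinearMap.neg_apply, smul_add, smul_neg, neg_smul]
    abel

end anticommute

theorem IsQuadratic.isIdeal_psiRange {V : CyclicModule.{v}} {A : CyclicOperad.{u}} [A.FinDim]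
    {φ : V.Hom A.toCyclicModule} (hA : IsQuadratic φ) :
    IsIdeal (free (dual V)) (psiRange φ) where
  map_mem := psiRange_map_mem
  d_mem {S i j} h y hy := by
    obtain ⟨x, rfl⟩ := (mem_psiRange A φ).1 hy
    -- By anticommutation, δψ(x) = -ψ(δx).
    have h1 := d_cobarDiff A rfl (n' := j + 1) (by omega) h rfl x
    have h2 := psi_mem A φ (j := j) rfl (FreeX.d (by omega) x)
    rw [add_eq_zero_iff_eq_neg.1 h1, map_neg, fmap_d] at h2
    exact (Submodule.neg_mem_iff _).1 h2
  comp_left := hA.psiRange_comp_left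
  comp_right := hA.psiRange_comp_right

/-! ### Finiteness of the free operad -/

/-- A graded vector space is spanned by finitely many homogeneous elements. -/
def HomogeneouslyFinite (W : ℤ → Type u) [∀ i, AddCommGroup (W i)] [∀ i, Module ℂ (W i)] : Prop :=
  ∃ T : Set (Σ i, W i), T.Finite ∧
    ∀ (i : ℤ) (x : W i), x ∈ Submodule.span ℂ {w : W i | (⟨i, w⟩ : Σ i, W i) ∈ T}

section homogeneous

variable {W : ℤ → Type u} [∀ i, AddCommGroup (W i)] [∀ i, Module ℂ (W i)]

theorem HomogeneouslyFinite.of_finite (h : FiniteDimensional ℂ (⨁ i, W i)) :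
    HomogeneouslyFinite W := by
  classical
  obtain ⟨s, hs⟩ := h.fg_top
  let I : Finset ℤ := s.biUnion fun w => DFinsupp.support w
  refine ⟨(fun p : (⨁ i, W i) × ℤ => (⟨p.2, p.1 p.2⟩ : Σ i, W i)) '' ((s : Set _) ×ˢ (I : Set ℤ)),
    (s.finite_toSet.prod I.finite_toSet).image _, fun i x => ?_⟩
  have hx : DirectSum.lof ℂ ℤ W i x ∈ Submodule.span ℂ (s : Set (⨁ i : ℤ, W i)) :=
    hs ▸ Submodule.mem_top
  have hx' := Submodule.mem_map_of_mem (f := DirectSum.component ℂ ℤ W i) hx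
  rw [DirectSum.component.lof_self, Submodule.map_span] at hx'
  refine Submodule.span_le.2 ?_ hx'
  rintro _ ⟨w, hw, rfl⟩
  by_cases h0 : w i = 0
  · have : DirectSum.component ℂ ℤ W i w = 0 := h0
    rw [this]
    exact Submodule.zero_mem _
  · refine Submodule.subset_span ⟨(w, i), ⟨hw, ?_⟩, rfl⟩
    exact Finset.mem_coe.2 (Finset.mem_biUnion.2 ⟨w, hw, DFinsupp.mem_support_iff.2 h0⟩)

theorem HomogeneouslyFinite.finite (h : HomogeneouslyFinite W) :
    FiniteDimensional ℂ (⨁ i, W i) := by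
  classical
  obtain ⟨T, hT, h⟩ := h
  refine ⟨(Submodule.fg_def).2 ⟨(fun p : Σ i, W i => DirectSum.lof ℂ ℤ W p.1 p.2) '' T,
    hT.image _, top_unique fun x _ => ?_⟩⟩
  induction x using DirectSum.induction_on with
  | zero => exact Submodule.zero_mem _
  | add x y hx hy => exact Submodule.add_mem _ (hx trivial) (hy trivial)
  | of i x =>
    have hx := Submodule.mem_map_of_mem (f := DirectSum.lof ℂ ℤ W i) (h i x)
    rw [Submodule.map_span] at hx
    refine Submodule.span_mono ?_ hx
    rintro _ ⟨w, hw, rfl⟩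
    exact ⟨⟨i, w⟩, hw, rfl⟩

theorem HomogeneouslyFinite.of_surjective {W' : ℤ → Type v} [∀ i, AddCommGroup (W' i)]
    [∀ i, Module ℂ (W' i)] (h : HomogeneouslyFinite W) (f : ∀ i, W i →ₗ[ℂ] W' i)
    (hf : ∀ i, Function.Surjective (f i)) : HomogeneouslyFinite W' := by
  obtain ⟨T, hT, h⟩ := h
  refine ⟨(fun p : Σ i, W i => (⟨p.1, f p.1 p.2⟩ : Σ i, W' i)) '' T, hT.image _, fun i y => ?_⟩
  obtain ⟨x, rfl⟩ := hf i y
  have hx := Submodule.mem_map_of_mem (f := f i) (h i x)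
  rw [Submodule.map_span] at hx
  refine Submodule.span_mono ?_ hx
  rintro _ ⟨w, hw, rfl⟩
  exact ⟨⟨i, w⟩, hw, rfl⟩

theorem HomogeneouslyFinite.of_subsingleton (h : ∀ i, Subsingleton (W i)) :
    HomogeneouslyFinite W :=
  ⟨∅, Set.finite_empty, fun i x => by
    rw [Subsingleton.elim x 0]
    exact Submodule.zero_mem _⟩

end homogeneous

section freeFinite

variable {V : CyclicModule.{u}}

theorem FreeX.subsingleton_of_card {S : Type} (hS : Nat.card S < 3) (i : ℤ) :
    Subsingleton (FreeX V S i) := (free V).stable S i hS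

/-- The equivalence of the first summand with its image. -/
noncomputable def leftEquiv {S X Y : Type} (s : X ⊕ Y ≃ S) : X ≃ Set.range (s ∘ Sum.inl) :=
  Equiv.ofInjective _ (s.injective.comp Sum.inl_injective)

/-- The equivalence of the second summand with the complement of the image of the first. -/
noncomputable def rightEquiv {S X Y : Type} (s : X ⊕ Y ≃ S) :
    Y ≃ ((Set.range (s ∘ Sum.inl))ᶜ : Set S) :=
  (Equiv.ofInjective _ (s.injective.comp Sum.inr_injective)).trans (Equiv.setCongr (by
    rw [Set.range_comp, Set.range_comp, ← Set.image_compl_eq s.bijective, Set.compl_range_inl]))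

theorem split_left_right {S X Y : Type} (s : X ⊕ Y ≃ S) :
    ((leftEquiv s).sumCongr (rightEquiv s)).trans (split _) = s := by
  ext z
  rcases z with z | z <;> simp [split, leftEquiv, rightEquiv]

/-- The elements of `𝕋₊V` obtained by gluing two elements along a decomposition. -/
def compositions (V : CyclicModule.{u}) (S : Type) (i : ℤ) : Set (FreeX V S i) :=
  {y | ∃ (Z : Set S) (p q : ℤ) (h : p + q = i) (a : FreeX V (Option Z) p)
    (b : FreeX V (Option (Zᶜ : Set S)) q), y = FreeX.map (split Z) rfl (FreeX.comp h a b)}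

theorem map_comp_mem_compositions {S X Y : Type} (s : X ⊕ Y ≃ S) {p q i : ℤ} (h : p + q = i)
    (a : FreeX V (Option X) p) (b : FreeX V (Option Y) q) :
    FreeX.map s rfl (FreeX.comp h a b) ∈ compositions V S i := by
  refine ⟨_, p, q, h, FreeX.map (leftEquiv s).optionCongr rfl a,
    FreeX.map (rightEquiv s).optionCongr rfl b, ?_⟩
  rw [FreeX.comp_map _ _ rfl rfl rfl h, FreeX.map_trans, split_left_right]

/-- A tree either has no edge or can be cut along one. Every gluing can be transported to a
decomposition of S into a subset and its complement, which leaves only finitely many shapes when S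
is finite. -/
theorem mem_range_gen_sup_compositions {S : Type} {i : ℤ} (x : FreeX V S i) :
    x ∈ LinearMap.range (FreeX.gen (V := V)) ⊔ Submodule.span ℂ (compositions V S i) := by
  induction x using FreeX.induction with
  | gen v => exact Submodule.mem_sup_left ⟨v, rfl⟩
  | add x y hx hy => exact Submodule.add_mem _ hx hy
  | smul c x hx => exact Submodule.smul_mem _ c hx
  | @map S T i j g h x hx =>
    subst h
    have hx' := Submodule.mem_map_of_mem (f := FreeX.map (V := V) g (rfl : i = i)) hx
    rw [Submodule.map_sup, Submodule.map_span] at hx'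
    refine SetLike.le_def.1 (sup_le_sup ?_ (Submodule.span_mono ?_)) hx'
    · rintro _ ⟨_, ⟨v, rfl⟩, rfl⟩
      exact ⟨_, (FreeX.map_gen g rfl v).symm⟩
    · rintro _ ⟨_, ⟨Z, p, q, h, a, b, rfl⟩, rfl⟩
      rw [FreeX.map_trans]
      exact map_comp_mem_compositions _ h a b
  | comp h x y _ _ =>
    refine Submodule.mem_sup_right (Submodule.subset_span ?_)
    have := map_comp_mem_compositions (Equiv.refl _) h x y
    rwa [FreeX.map_refl] at this

/-- Strong induction on the number of legs. A spanning set consists of spanning generators together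
with the gluings, along subsets of S, of spanning elements for the two vertices. -/
theorem FreeX.homogeneouslyFinite [V.FinDim] (S : Type) :
    HomogeneouslyFinite (fun i => FreeX V S i) := by
  classical
  by_cases hS : Finite S
  swap
  · have : Infinite S := not_finite_iff_infinite.mp hS
    exact .of_subsingleton fun i => FreeX.subsingleton_of_card (by simp) i
  generalize hN : Nat.card S = N
  induction N using Nat.strong_induction_on generalizing S with
  | _ N ih =>
    have hZ : ∀ Z : Set S, ∃ (T : Set (Σ i, FreeX V (Option Z) i))
        (T' : Set (Σ i, FreeX V (Option (Zᶜ : Set S)) i)), T.Finite ∧ T'.Finite ∧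
        ∀ (p q i : ℤ) (h : p + q = i) (a : FreeX V (Option Z) p)
          (b : FreeX V (Option (Zᶜ : Set S)) q),
          FreeX.comp h a b ∈ Submodule.span ℂ (Set.image2 (fun a b => FreeX.comp h a b)
            {a | (⟨p, a⟩ : Σ i, FreeX V (Option Z) i) ∈ T}
            {b | (⟨q, b⟩ : Σ i, FreeX V (Option (Zᶜ : Set S)) i) ∈ T'}) := by
      intro Z
      have hc := card_option_add_card_option (split Z)
      -- If a vertex has fewer than three legs, the gluing vanishes by stability. If both have at
      -- least three, each has at most |S| - 1, because the two counts sum to |S| + 2; then the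
      -- induction hypothesis applies.
      by_cases h1 : Nat.card (Option Z) < 3
      · refine ⟨∅, ∅, Set.finite_empty, Set.finite_empty, fun p q i h a b => ?_⟩
        have := FreeX.subsingleton_of_card (V := V) h1 p
        rw [Subsingleton.elim a 0, map_zero, LinearMap.zero_apply]
        exact Submodule.zero_mem _
      by_cases h2 : Nat.card (Option (Zᶜ : Set S)) < 3
      · refine ⟨∅, ∅, Set.finite_empty, Set.finite_empty, fun p q i h a b => ?_⟩
        have := FreeX.subsingleton_of_card (V := V) h2 q
        rw [Subsingleton.elim b 0, map_zero]
        exact Submodule.zero_mem _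
      obtain ⟨T, hT, hT'⟩ := ih _ (by omega) (Option Z) inferInstance rfl
      obtain ⟨U, hU, hU'⟩ := ih _ (by omega) (Option (Zᶜ : Set S)) inferInstance rfl
      refine ⟨T, U, hT, hU, fun p q i h a b => ?_⟩
      -- By bilinearity, gluings of spanning elements span all gluings.
      rw [← Submodule.map₂_span_span]
      exact Submodule.apply_mem_map₂ _ (hT' p a) (hU' q b)
    choose T T' hT hT' hTT' using hZ
    obtain ⟨G, hG, hG'⟩ := HomogeneouslyFinite.of_finite (CyclicModule.FinDim.finite (V := V) S)
    refine ⟨(fun p : Σ i, V.X S i => (⟨p.1, FreeX.gen p.2⟩ : Σ i, FreeX V S i)) '' G ∪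
      ⋃ Z : Set S, Set.image2 (fun a b => (⟨a.1 + b.1, FreeX.map (split Z) rfl
        (FreeX.comp rfl a.2 b.2)⟩ : Σ i, FreeX V S i)) (T Z) (T' Z),
      (hG.image _).union (Set.finite_iUnion fun Z => (hT Z).image2 _ (hT' Z)), fun i x => ?_⟩
    refine SetLike.le_def.1 (sup_le ?_ (Submodule.span_le.2 ?_)) (mem_range_gen_sup_compositions x)
    · rintro _ ⟨v, rfl⟩
      have hv := Submodule.mem_map_of_mem (f := FreeX.gen (V := V)) (hG' i v)
      rw [Submodule.map_span] at hv
      refine Submodule.span_mono ?_ hv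
      rintro _ ⟨w, hw, rfl⟩
      exact Or.inl ⟨⟨i, w⟩, hw, rfl⟩
    · rintro _ ⟨Z, p, q, h, a, b, rfl⟩
      have hv := Submodule.mem_map_of_mem (f := FreeX.map (V := V) (split Z) (rfl : i = i))
        (hTT' Z p q i h a b)
      rw [Submodule.map_span] at hv
      refine Submodule.span_mono ?_ hv
      rintro _ ⟨_, ⟨a, ha, b, hb, rfl⟩, rfl⟩
      subst h
      exact Or.inr (Set.mem_iUnion.2 ⟨Z, ⟨p, a⟩, ha, ⟨q, b⟩, hb, rfl⟩)

end freeFinite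

/-! ### Finite-dimensionality of duals and of the naive dual -/

/-- Each component is finite-dimensional, and the dual lives only in the finitely many degrees |S| -
3 - k for which k is the degree of a spanning element. -/
theorem HomogeneouslyFinite.dual (V : CyclicModule.{u}) {S : Type}
    (h : HomogeneouslyFinite (V.X S)) : HomogeneouslyFinite ((dual V).X S) := by
  classical
  obtain ⟨T, hT, h⟩ := h
  have hfin : ∀ i, FiniteDimensional ℂ (V.X S i) := fun i =>
    ⟨Submodule.fg_def.2 ⟨_, hT.preimage (f := fun w : V.X S i => (⟨i, w⟩ : Σ i, V.X S i))
      (sigma_mk_injective.injOn), top_unique fun x _ => h i x⟩⟩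
  have hfin' : ∀ i, FiniteDimensional ℂ ((CycOp.dual V).X S i) := fun i =>
    inferInstanceAs (FiniteDimensional ℂ (Module.Dual ℂ _))
  have hT' : ∀ i : ℤ, ∃ B : Set ((CycOp.dual V).X S i), B.Finite ∧ Submodule.span ℂ B = ⊤ :=
    fun i => Submodule.fg_def.1 (hfin' i).fg_top
  choose B hB hB' using hT'
  refine ⟨⋃ k ∈ Sigma.fst '' T, (fun w => ⟨(Nat.card S : ℤ) - 3 - k, w⟩) ''
    B ((Nat.card S : ℤ) - 3 - k), (hT.image _).biUnion fun k _ => (hB _).image _, fun i x => ?_⟩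
  by_cases hi : (Nat.card S : ℤ) - 3 - i ∈ Sigma.fst '' T
  -- Replacing i by |S| - 3 - k makes the degree literally the one used in the witness, so no
  -- transport along the double reflection is needed.
  · obtain ⟨k, hk⟩ : ∃ k, k = (Nat.card S : ℤ) - 3 - i := ⟨_, rfl⟩
    obtain rfl : i = (Nat.card S : ℤ) - 3 - k := by omega
    rw [← hk] at hi
    have hx : x ∈ Submodule.span ℂ (B ((Nat.card S : ℤ) - 3 - k)) := hB' _ ▸ Submodule.mem_top
    refine Submodule.span_mono (fun w hw => ?_) hx
    exact Set.mem_iUnion₂.2 ⟨k, hi, w, hw, rfl⟩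
  · have : x = 0 := dual_ext fun y => by
      have hy := h _ y
      have he : {w : V.X S ((Nat.card S : ℤ) - 3 - i) |
          (⟨_, w⟩ : Σ i, V.X S i) ∈ T} = ∅ :=
        Set.eq_empty_of_forall_notMem fun w hw => hi ⟨_, hw, rfl⟩
      rw [he, Submodule.span_empty, Submodule.mem_bot] at hy
      rw [hy, map_zero, map_zero]
    rw [this]
    exact Submodule.zero_mem _

theorem CyclicModule.FinDim.dual (V : CyclicModule.{u}) [V.FinDim] : (CycOp.dual V).FinDim :=
  ⟨fun S => (HomogeneouslyFinite.dual V (.of_finite (CyclicModule.FinDim.finite S))).finite⟩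

theorem CyclicModule.FinDim.of_surjective {V : CyclicModule.{u}} {W : CyclicModule.{v}}
    [V.FinDim] (f : ∀ S i, V.X S i →ₗ[ℂ] W.X S i) (hf : ∀ S i, Function.Surjective (f S i)) :
    W.FinDim :=
  ⟨fun S => ((HomogeneouslyFinite.of_finite (CyclicModule.FinDim.finite S)).of_surjective
    (f S) (hf S)).finite⟩

theorem free_finDim (V : CyclicModule.{u}) [V.FinDim] : (free V).FinDim :=
  ⟨fun S => (FreeX.homogeneouslyFinite (V := V) S).finite⟩

/-- V inherits finiteness from A as the image of the projection A → V. -/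
theorem IsQuadratic.finDim {V : CyclicModule.{v}} {A : CyclicOperad.{u}} [A.FinDim]
    {φ : V.Hom A.toCyclicModule} (hA : IsQuadratic φ) : V.FinDim :=
  .of_surjective hA.proj.f fun S i v => ⟨φ.f S i v, hA.proj_gen v⟩

theorem IsQuadratic.naiveDual_finDim {V : CyclicModule.{v}} {A : CyclicOperad.{u}} [A.FinDim]
    {φ : V.Hom A.toCyclicModule} (hA : IsQuadratic φ) :
    (naiveDual φ hA.isIdeal_psiRange).FinDim := by
  have := hA.finDim
  have := CyclicModule.FinDim.dual V
  have := free_finDim (CycOp.dual V)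
  exact .of_surjective ((free (CycOp.dual V)).quotientMap _ hA.isIdeal_psiRange).f
    fun S i => Submodule.mkQ_surjective _

/-! ### Functionals on trees with one edge -/

/-- A natural symmetric family of bilinear forms on the pairs of vertices of the trees with one
edge and with legs `S`. -/
structure EdgeForm (V : CyclicModule.{u}) (S : Type) (n : ℤ) where
  form : ∀ {X Y : Type} (_ : X ⊕ Y ≃ S) {i j : ℤ}, i + j = n →
    (V.X (Option X) i →ₗ[ℂ] V.X (Option Y) j →ₗ[ℂ] ℂ)
  form_map : ∀ {X Y X' Y' : Type} (s : X' ⊕ Y' ≃ S) (f : X ≃ X') (g : Y ≃ Y') {i j i' j' : ℤ}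
    (hi : i = i') (hj : j = j') (h : i + j = n) (h' : i' + j' = n) (a : V.X (Option X) i)
    (b : V.X (Option Y) j), form s h' (V.map f.optionCongr hi a) (V.map g.optionCongr hj b) =
      form ((f.sumCongr g).trans s) h a b
  form_comm : ∀ {X Y : Type} (s : Y ⊕ X ≃ S) {i j : ℤ} (h : i + j = n) (h' : j + i = n)
    (a : V.X (Option X) i) (b : V.X (Option Y) j),
    form ((Equiv.sumComm X Y).trans s) h a b = ksign (i * j) * form s h' b a

namespace EdgeForm

variable {V : CyclicModule.{u}}

/-- The pullback of an edge form along a bijection. -/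
def pull {S T : Type} {i j : ℤ} (g : S ≃ T) (h : i = j) (B : EdgeForm V T j) :
    EdgeForm V S i where
  form s _ _ e := B.form (s.trans g) (e.trans h)
  form_map s f g' _ _ _ _ hi hj e e' a b :=
    B.form_map (s.trans g) f g' hi hj (e.trans h) (e'.trans h) a b
  form_comm s _ _ e e' a b := B.form_comm (s.trans g) (e.trans h) (e'.trans h) a b

/-- The value of an edge form on an expression. -/
noncomputable def exprValue : ∀ {S : Type} {i : ℤ}, Expr V S i → EdgeForm V S i → ℂ
  | _, _, Expr.gen _, _ => 0
  | _, _, Expr.zero, _ => 0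
  | _, _, Expr.add x y, B => exprValue x B + exprValue y B
  | _, _, Expr.smul c x, B => c * exprValue x B
  | _, _, Expr.map g h x, B => exprValue x (B.pull g h)
  | _, _, Expr.comp h x y, B => B.form (Equiv.refl _) h (aug V (FreeX.mk x)) (aug V (FreeX.mk y))

/-- The axioms of an edge form are exactly invariance under equivariance and symmetry of the gluing.
Associativity costs nothing: on either side one factor is itself a composition, which the
augmentation kills. -/
theorem exprValue_sound {S : Type} {i : ℤ} {x y : Expr V S i} (r : Rel V x y)
    (B : EdgeForm V S i) : exprValue x B = exprValue y B := by
  induction r with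
  | refl => rfl
  | symm _ ih => exact (ih B).symm
  | trans _ _ ih ih' => exact (ih B).trans (ih' B)
  | add_congr _ _ ih ih' => simp only [exprValue, ih, ih']
  | smul_congr c _ ih => simp only [exprValue, ih]
  | map_congr g h _ ih => simp only [exprValue, ih]
  | comp_congr h r r' => simp only [exprValue, FreeX.mk_eq r, FreeX.mk_eq r']
  | add_assoc => simp only [exprValue]; ring
  | add_comm => simp only [exprValue]; ring
  | zero_add => simp only [exprValue]; ring
  | one_smul => simp only [exprValue, one_mul]
  | zero_smul => simp only [exprValue, zero_mul]
  | mul_smul => simp only [exprValue, mul_assoc]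
  | smul_add => simp only [exprValue, mul_add]
  | add_smul => simp only [exprValue, add_mul]
  | gen_add => simp only [exprValue, add_zero]
  | gen_smul => simp only [exprValue, mul_zero]
  | map_add => simp only [exprValue]
  | map_smul => simp only [exprValue]
  | comp_add_left => simp only [exprValue, FreeX.mk_add, map_add, LinearMap.add_apply]
  | comp_add_right => simp only [exprValue, FreeX.mk_add, map_add]
  | comp_smul_left =>
    simp only [exprValue, FreeX.mk_smul, map_smul, LinearMap.smul_apply, smul_eq_mul]
  | comp_smul_right => simp only [exprValue, FreeX.mk_smul, map_smul, smul_eq_mul]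
  | map_gen => simp only [exprValue]
  | map_refl x => simp only [exprValue]; rfl
  | map_trans g g' h h' x => simp only [exprValue]; rfl
  | comp_map f g hi hj hk h h' a b =>
    simp only [exprValue, FreeX.mk_map, aug_map]
    -- After pulling back along the bijection, equivariance of gluing is naturality of the form.
    exact B.form_map _ f g hi hj (h.trans hk) h' _ _
  | comp_comm h h' a b =>
    simp only [exprValue]
    exact B.form_comm (Equiv.refl _) h h' _ _
  | comp_assoc hl hm h h' a b c =>
    simp only [exprValue, FreeX.mk_map, FreeX.mk_comp, aug_map, aug_comp, map_zero,
      LinearMap.zero_apply]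

/-- The functional on `𝕋₊V` defined by an edge form: it is the edge form on the trees with one
edge, and vanishes on all other trees. -/
noncomputable def functional {S : Type} {i : ℤ} (B : EdgeForm V S i) :
    FreeX V S i →ₗ[ℂ] ℂ where
  toFun := Quotient.lift (fun x => exprValue x B) fun _ _ r => exprValue_sound r B
  map_add' x y := by
    induction x using FreeX.ind; induction y using FreeX.ind
    rfl
  map_smul' c x := by
    induction x using FreeX.ind
    rfl

theorem functional_map {S T : Type} {i j : ℤ} (g : S ≃ T) (h : i = j) (B : EdgeForm V T j)
    (x : FreeX V S i) : B.functional (FreeX.map g h x) = (B.pull g h).functional x := by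
  induction x using FreeX.ind
  rfl

theorem functional_comp {S T : Type} {i j k : ℤ} (h : i + j = k) (B : EdgeForm V (S ⊕ T) k)
    (x : FreeX V (Option S) i) (y : FreeX V (Option T) j) :
    B.functional (FreeX.comp h x y) = B.form (Equiv.refl _) h (aug V x) (aug V y) := by
  induction x using FreeX.ind; induction y using FreeX.ind
  rfl

theorem functional_edge {S X Y : Type} (s : X ⊕ Y ≃ S) {i j k : ℤ} (h : i + j = k)
    (B : EdgeForm V S k) (t : V.X (Option X) i ⊗[ℂ] V.X (Option Y) j) :
    B.functional (edge s h t) = TensorProduct.lift (B.form s h) t := by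
  induction t using TensorProduct.induction_on with
  | zero => simp only [map_zero]
  | add x y hx hy => simp only [map_add, hx, hy]
  | tmul a b =>
    rw [edge_tmul, functional_map, functional_comp, aug_gen, aug_gen, TensorProduct.lift.tmul]
    rfl

end EdgeForm

/-! ### Components of sums over decompositions -/

section restrict

variable {V : CyclicModule.{u}}

open Classical in
/-- The component of an element of `OrderedSplits` along an arbitrary decomposition
`s : X ⊔ Y ≃ S`. -/
noncomputable def restrict (V : CyclicModule.{u}) {S X Y : Type} (s : X ⊕ Y ≃ S) {n p q : ℤ}
    (h : p + q = n) : OrderedSplits V S n →ₗ[ℂ] V.X (Option X) p ⊗[ℂ] V.X (Option Y) q :=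
  TensorProduct.map (V.map (leftEquiv s).symm.optionCongr rfl)
      (V.map (rightEquiv s).symm.optionCongr (by omega)) ∘ₗ
    DirectSum.component ℂ (Set S × ℤ)
      (fun x => V.X (Option x.1) x.2 ⊗[ℂ] V.X (Option (x.1ᶜ : Set S)) (n - x.2))
      (Set.range (s ∘ Sum.inl), p)

-- The set Z and the bijections e, e' are all forced by s, so the component may be computed with
-- whichever presentation of s is convenient.
open Classical in
theorem restrict_eq {S X Y : Type} (s : X ⊕ Y ≃ S) {n p q : ℤ} (h : p + q = n) (Z : Set S)
    (e : X ≃ Z) (e' : Y ≃ (Zᶜ : Set S)) (he : (e.sumCongr e').trans (split Z) = s)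
    (r : OrderedSplits V S n) : restrict V s h r =
      TensorProduct.map (V.map e.symm.optionCongr rfl)
        (V.map e'.symm.optionCongr (by omega)) (DirectSum.component ℂ (Set S × ℤ)
          (fun x => V.X (Option x.1) x.2 ⊗[ℂ] V.X (Option (x.1ᶜ : Set S)) (n - x.2)) (Z, p) r) := by
  have h1 : ∀ x, s (Sum.inl x) = e x := fun x => by rw [← he]; simp [split]
  have h2 : ∀ y, s (Sum.inr y) = e' y := fun y => by rw [← he]; simp [split]
  obtain rfl : Z = Set.range (s ∘ Sum.inl) := by
    ext z
    constructor
    · intro hz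
      exact ⟨e.symm ⟨z, hz⟩, by simp [h1]⟩
    · rintro ⟨x, rfl⟩
      simp [h1]
  obtain rfl : e = leftEquiv s := by
    ext x
    simp [← h1, leftEquiv]
  obtain rfl : e' = rightEquiv s := by
    ext y
    simp [← h2, rightEquiv]
  rfl

open Classical in
theorem restrict_lof {S X Y : Type} {n p q : ℤ} (h : p + q = n) (Z : Set S)
    (e : X ≃ Z) (e' : Y ≃ (Zᶜ : Set S)) (a : V.X (Option Z) p)
    (b : V.X (Option (Zᶜ : Set S)) (n - p)) :
    restrict V ((e.sumCongr e').trans (split Z)) h (DirectSum.lof ℂ (Set S × ℤ)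
        (fun x => V.X (Option x.1) x.2 ⊗[ℂ] V.X (Option (x.1ᶜ : Set S)) (n - x.2)) (Z, p)
        (a ⊗ₜ b)) =
      V.map e.symm.optionCongr rfl a ⊗ₜ V.map e'.symm.optionCongr (by omega) b := by
  rw [restrict_eq _ h Z e e' rfl]
  exact congrArg _ (DirectSum.component.lof_self ..)

open Classical in
theorem restrict_lof_of_ne {S X Y : Type} (s : X ⊕ Y ≃ S) {n p q : ℤ} (h : p + q = n)
    (x : Set S × ℤ) (hx : x ≠ (Set.range (s ∘ Sum.inl), p))
    (u : V.X (Option x.1) x.2 ⊗[ℂ] V.X (Option (x.1ᶜ : Set S)) (n - x.2)) :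
    restrict V s h (DirectSum.lof ℂ (Set S × ℤ)
        (fun x => V.X (Option x.1) x.2 ⊗[ℂ] V.X (Option (x.1ᶜ : Set S)) (n - x.2)) x u) = 0 := by
  unfold restrict
  rw [LinearMap.comp_apply, DirectSum.component.of, dif_neg hx, map_zero]

theorem restrict_natural {S X Y X' Y' : Type} (s : X' ⊕ Y' ≃ S) (f : X ≃ X') (g : Y ≃ Y')
    {n p q p' q' : ℤ} (hp : p' = p) (hq : q' = q) (h : p + q = n) (h' : p' + q' = n)
    (r : OrderedSplits V S n) :
    restrict V ((f.sumCongr g).trans s) h r =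
      TensorProduct.map (V.map f.symm.optionCongr hp) (V.map g.symm.optionCongr hq)
        (restrict V s h' r) := by
  subst hp hq
  rw [restrict_eq s h' _ _ _ (split_left_right s),
    restrict_eq _ h _ (f.trans (leftEquiv s)) (g.trans (rightEquiv s)) (by
      rw [← Equiv.sumCongr_trans, Equiv.trans_assoc, split_left_right])]
  rw [← LinearMap.comp_apply (TensorProduct.map _ _) (TensorProduct.map _ _),
    ← TensorProduct.map_comp]
  congr 2
  · ext a
    rw [LinearMap.comp_apply, V.map_trans]
    congr 2
    ext (_ | z) <;> rfl
  · ext a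
    rw [LinearMap.comp_apply, V.map_trans]
    congr 2
    ext (_ | z) <;> rfl

open Classical in
/-- An element of `OrderedSplits` is determined by its components. -/
theorem restrict_ext {S : Type} {n : ℤ} {r r' : OrderedSplits V S n}
    (h : ∀ (Z : Set S) (k : ℤ), restrict V (split Z) (add_sub_cancel k n) r =
      restrict V (split Z) (add_sub_cancel k n) r') : r = r' := by
  refine DFinsupp.ext fun x => ?_
  have := h x.1 x.2
  have h1 : ((Equiv.refl _).sumCongr (Equiv.refl _)).trans (split x.1) = split x.1 := by
    ext (z | z) <;> rfl
  rw [restrict_eq _ _ _ _ _ h1, restrict_eq _ _ _ _ _ h1] at this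
  have h2 : TensorProduct.map (V.map (Equiv.refl x.1).symm.optionCongr (rfl : x.2 = x.2))
      (V.map (Equiv.refl (x.1ᶜ : Set S)).symm.optionCongr (rfl : n - x.2 = n - x.2)) =
      LinearMap.id := by
    rw [← TensorProduct.map_id]
    congr 1
    · ext a
      have : (Equiv.refl x.1).symm.optionCongr = Equiv.refl _ := Equiv.optionCongr_refl
      rw [this, V.map_refl]
      rfl
    · ext a
      have : (Equiv.refl (x.1ᶜ : Set S)).symm.optionCongr = Equiv.refl _ := Equiv.optionCongr_refl
      rw [this, V.map_refl]
      rfl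
  exact (LinearMap.congr_fun h2 _).symm.trans (this.trans (LinearMap.congr_fun h2 _))

open Classical in
theorem exchange_lof {S : Type} {n : ℤ} (Z : Set S) (k : ℤ) (a : V.X (Option Z) k)
    (b : V.X (Option (Zᶜ : Set S)) (n - k)) :
    exchange V S n (DirectSum.lof ℂ (Set S × ℤ)
        (fun x => V.X (Option x.1) x.2 ⊗[ℂ] V.X (Option (x.1ᶜ : Set S)) (n - x.2)) (Z, k)
        (a ⊗ₜ b)) =
      ksign (k * (n - k)) • DirectSum.lof ℂ (Set S × ℤ)
        (fun x => V.X (Option x.1) x.2 ⊗[ℂ] V.X (Option (x.1ᶜ : Set S)) (n - x.2)) (Zᶜ, n - k)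
        (b ⊗ₜ V.map (Equiv.setCongr (compl_compl Z).symm).optionCongr
          (sub_sub_cancel n k).symm a) := by
  unfold exchange
  rw [DirectSum.toModule_lof]
  rfl

/-- In terms of arbitrary decompositions the exchange is just the Koszul swap; the identification of
a subset with its double complement no longer appears. On a pure tensor, either its summand is the
one seen by s or both sides vanish. -/
theorem restrict_exchange {S X Y : Type} (s : X ⊕ Y ≃ S) {n p q : ℤ} (h : p + q = n)
    (h' : q + p = n) (r : OrderedSplits V S n) :
    restrict V ((Equiv.sumComm Y X).trans s) h' (exchange V S n r) =
      ksign (p * q) • TensorProduct.comm ℂ _ _ (restrict V s h r) := by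
  classical
  refine LinearMap.congr_fun (f := restrict V ((Equiv.sumComm Y X).trans s) h' ∘ₗ exchange V S n)
    (g := ksign (p * q) • ((TensorProduct.comm ℂ _ _).toLinearMap ∘ₗ restrict V s h))
    (orderedSplits_ext fun Z k a b => ?_) r
  rw [LinearMap.comp_apply, LinearMap.smul_apply, LinearMap.comp_apply, exchange_lof, map_smul]
  by_cases hZ : Z = Set.range (s ∘ Sum.inl) ∧ k = p
  · obtain ⟨hZ, rfl⟩ := hZ
    obtain ⟨e, e', rfl⟩ : ∃ (e : X ≃ Z) (e' : Y ≃ (Zᶜ : Set S)),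
        (e.sumCongr e').trans (split Z) = s := by
      subst hZ
      exact ⟨_, _, split_left_right s⟩
    obtain rfl : q = n - k := by omega
    -- The swapped decomposition presents the complement of Z, with Z appearing as the double
    -- complement.
    have hs : (Equiv.sumComm Y X).trans ((e.sumCongr e').trans (split Z)) =
        (e'.sumCongr (e.trans (Equiv.setCongr (compl_compl Z).symm))).trans (split Zᶜ) := by
      ext (z | z) <;> simp [split]
    rw [restrict_lof, hs, restrict_lof]
    congr 1
    refine congrArg₂ _ rfl ?_
    rw [V.map_trans]
    congr 2
    ext (_ | z) <;> rfl
  · rw [restrict_lof_of_ne s h (Z, k), restrict_lof_of_ne _ h' (Zᶜ, n - k), map_zero, smul_zero,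
      smul_zero]
    · intro h0
      obtain ⟨h1, h2⟩ := Prod.mk.inj h0
      refine hZ ⟨?_, by omega⟩
      rw [← compl_inj_iff, h1, Set.range_comp s, ← Set.image_compl_eq s.bijective,
        Set.compl_range_inl, ← Set.range_comp]
      rfl
    · intro h0
      obtain ⟨h1, h2⟩ := Prod.mk.inj h0
      exact hZ ⟨h1, h2⟩

theorem exchange_exchange {S : Type} {n : ℤ} (r : OrderedSplits V S n) :
    exchange V S n (exchange V S n r) = r := by
  refine restrict_ext fun Z k => ?_
  have h1 := restrict_exchange ((Equiv.sumComm _ _).trans (split Z)) (sub_add_cancel n k)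
    (add_sub_cancel k n) (exchange V S n r)
  rw [restrict_exchange (split Z) (add_sub_cancel k n)] at h1
  refine h1.trans ?_
  rw [map_smul, smul_smul, mul_comm k, ksign_mul_self, one_smul]
  exact (TensorProduct.comm ℂ _ _).symm_apply_apply _

theorem edge_comm {S X Y : Type} (s : X ⊕ Y ≃ S) {i j k : ℤ} (h : i + j = k) (h' : j + i = k)
    (a : V.X (Option X) i) (b : V.X (Option Y) j) :
    edge ((Equiv.sumComm Y X).trans s) h' (b ⊗ₜ a) = ksign (i * j) • edge s h (a ⊗ₜ b) := by
  have h1 := FreeX.comp_comm (V := V) h' h (FreeX.gen b) (FreeX.gen a)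
  rw [edge_tmul, edge_tmul, ← FreeX.map_trans (Equiv.sumComm Y X) s rfl rfl, h1, map_smul,
    mul_comm i]

/-- The Koszul sign in the exchange cancels the one in the symmetry of the gluing, so the two
orderings of a tree have the same image. -/
theorem sumEdge_exchange {S : Type} {n : ℤ} (r : OrderedSplits V S n) :
    sumEdge V S n (exchange V S n r) = sumEdge V S n r := by
  classical
  refine LinearMap.congr_fun (f := sumEdge V S n ∘ₗ exchange V S n) (g := sumEdge V S n)
    (orderedSplits_ext fun Z k a b => ?_) r
  rw [LinearMap.comp_apply, exchange_lof, map_smul, sumEdge_lof, sumEdge_lof]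
  have hs : (Equiv.sumComm (Zᶜ : Set S) Z).trans (split Z) = ((Equiv.refl _).sumCongr
      (Equiv.setCongr (compl_compl Z).symm)).trans (split Zᶜ) := by
    ext (z | z) <;> simp [split]
  have h1 := edge_natural (V := V) ((Equiv.sumComm _ _).trans (split Z)) (split Zᶜ) (Equiv.refl _)
    (Equiv.setCongr (compl_compl Z).symm) (Equiv.refl S) hs.symm rfl
    (sub_sub_cancel n k).symm rfl (sub_add_cancel n k) (add_sub_cancel _ n) (b ⊗ₜ a)
  rw [FreeX.map_refl, edge_comm (split Z) (add_sub_cancel k n), TensorProduct.map_tmul,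
    Equiv.optionCongr_refl, V.map_refl] at h1
  rw [← h1, smul_smul, ksign_mul_self, one_smul]

/-- The symmetrization of an element of `OrderedSplits`. -/
noncomputable def symmetrize {S : Type} {n : ℤ} (r : OrderedSplits V S n) : T1 V S n :=
  ⟨r + exchange V S n r, by
    refine LinearMap.mem_eqLocus.2 ?_
    rw [map_add, exchange_exchange, add_comm]
    rfl⟩

/-- The factor 1/2 in `T1.toFree` compensates the doubling. Thus any sum of one-edge trees comes
from 𝕋₁V, without a symmetry check on its summands. -/
theorem toFree_symmetrize {S : Type} {n : ℤ} (r : OrderedSplits V S n) :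
    T1.toFree V S n (symmetrize r) = sumEdge V S n r := by
  have h : (1 / 2 : ℂ) • (sumEdge V S n r + sumEdge V S n (exchange V S n r)) =
      sumEdge V S n r := by
    rw [sumEdge_exchange, ← two_smul ℂ, smul_smul]
    norm_num
  exact (congrArg ((1 / 2 : ℂ) • ·) (map_add (sumEdge V S n) r (exchange V S n r))).trans h

end restrict

/-! ### The sign of the exchange of two blocks -/

theorem val_finRotate_pow (N k : ℕ) (i : Fin N) :
    (((finRotate N) ^ k) i : ℕ) = (i + k) % N := by
  induction k with
  | zero => simp [Nat.mod_eq_of_lt i.2]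
  | succ k ih =>
    obtain _ | N := N
    · exact i.elim0
    · rw [pow_succ', Equiv.Perm.mul_apply, finRotate_apply, Fin.val_add, ih, Fin.val_one',
        ← Nat.add_mod, Nat.add_assoc]

/-- Exchanging blocks of lengths m and n is the n-th power of the full rotation, of sign (-1)^((m +
n - 1) n). This equals (-1)^(m n) because n (n - 1) is even. -/
theorem sign_finAddFlip (m n : ℕ) :
    Equiv.Perm.sign ((finAddFlip (m := m) (n := n)).trans (finCongr (Nat.add_comm n m))) =
      (-1) ^ (m * n) := by
  have h : (finAddFlip (m := m) (n := n)).trans (finCongr (Nat.add_comm n m)) =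
      (finRotate (m + n)) ^ n := by
    refine Equiv.ext fun i => Fin.ext ?_
    rw [val_finRotate_pow]
    obtain ⟨i, hi⟩ := i
    by_cases h : i < m
    · simp only [Equiv.trans_apply, finAddFlip_apply_mk_left h]
      rw [Nat.mod_eq_of_lt (by omega), Nat.add_comm i n]
      rfl
    · simp only [Equiv.trans_apply, finAddFlip_apply_mk_right (not_lt.1 h) hi]
      rw [show i + n = (i - m) + (m + n) by omega, Nat.add_mod_right,
        Nat.mod_eq_of_lt (by omega)]
      rfl
  rw [h, map_pow, sign_finRotate, ← pow_mul]
  -- The case n = 0 is separate because m + n - 1 is a truncated subtraction.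
  obtain _ | n := n
  · simp
  · rw [show (m + (n + 1) - 1) * (n + 1) = m * (n + 1) + n * (n + 1) by
      rw [← Nat.add_mul]; rfl, pow_add, (Nat.even_mul_succ_self n).neg_one_pow, mul_one]

theorem orient_finCongr {m n : ℕ} (h : m = n) {S : Type} (e : Fin n ≃ S) :
    orient ((finCongr h).trans e) = orient e := by
  subst h
  rfl

theorem orient_sumComm {m n : ℕ} {S : Type} (E : Fin m ⊕ Fin n ≃ S) :
    orient (finSumFinEquiv.symm.trans ((Equiv.sumComm (Fin n) (Fin m)).trans E)) =
      (-1) ^ (m * n) * orient (finSumFinEquiv.symm.trans E) := by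
  have h : finSumFinEquiv.symm.trans ((Equiv.sumComm (Fin n) (Fin m)).trans E) =
      ((finAddFlip (m := n) (n := m)).trans (finCongr (Nat.add_comm m n))).trans
        ((finCongr (Nat.add_comm n m)).trans (finSumFinEquiv.symm.trans E)) := by
    ext x
    simp [finAddFlip]
  rw [h, orient_perm, sign_finAddFlip, orient_finCongr, Nat.mul_comm]

/-- Only the ordering of S feels the exchange; the orientations of the two vertices are merely
multiplied in the other order. -/
theorem splitSign_comm {S X Y : Type} [Finite X] [Finite Y] (s : X ⊕ Y ≃ S) :
    splitSign ((Equiv.sumComm Y X).trans s) =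
      (-1) ^ (Nat.card X * Nat.card Y) * splitSign s := by
  rw [splitSign_eq s (enum X).symm (enum Y).symm, splitSign_eq _ (enum Y).symm (enum X).symm]
  unfold splitSignAux
  have h := orient_sumComm (((enum X).symm.sumCongr (enum Y).symm).trans s)
  have h' : ((enum Y).symm.sumCongr (enum X).symm).trans ((Equiv.sumComm Y X).trans s) =
      (Equiv.sumComm _ _).trans (((enum X).symm.sumCongr (enum Y).symm).trans s) := by
    ext (z | z) <;> rfl
  rw [h', h, mul_assoc, mul_comm (orient ((finSuccEquiv (Nat.card Y)).trans _))]

theorem ksign_natCast (n : ℕ) : ksign n = (-1) ^ n := by simp [ksign]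

/-- This converts the Koszul sign for exchanging two elements of V into the one for exchanging two
elements of V^∨, and so makes the pairing symmetric. -/
theorem cosign_comm {S X Y : Type} [Finite S] (s : X ⊕ Y ≃ S) (i j : ℤ) :
    ksign (((Nat.card (Option X) : ℤ) - 3 - i) * ((Nat.card (Option Y) : ℤ) - 3 - j)) *
      cosign ((Equiv.sumComm Y X).trans s) j = ksign (i * j) * cosign s i := by
  have : Finite (X ⊕ Y) := Finite.of_equiv _ s.symm
  have : Finite X := Finite.of_injective _ (Sum.inl_injective (β := Y))
  have : Finite Y := Finite.of_injective _ (Sum.inr_injective (α := X))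
  unfold cosign
  rw [splitSign_comm, Finite.card_option, Finite.card_option]
  have h : (((((-1) ^ (Nat.card X * Nat.card Y) * splitSign s : ℤˣ) : ℤ)) : ℂ) =
      ksign (Nat.card X * Nat.card Y) * ((splitSign s : ℤ) : ℂ) := by
    rw [← Nat.cast_mul, ksign_natCast]
    push_cast
    ring
  rw [h, mul_comm (ksign _) ((splitSign s : ℤ) : ℂ)]
  push_cast
  rw [mul_left_comm (ksign (i * j)), mul_assoc, mul_left_comm (ksign _), ← ksign_add, ← ksign_add,
    ← ksign_add]
  congr 1
  generalize (Nat.card X : ℤ) = m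
  generalize (Nat.card Y : ℤ) = n
  -- Half the difference of the total exponents on the two sides; m - 2 stands for |X ∪ {*}| - 3,
  -- and similarly for n.
  refine ksign_congr ⟨(m - 2) * (n - 2 - j) + m + n - 2, ?_⟩
  ring

theorem cosign_natural {S X Y X' Y' : Type} [Finite S] (s : X' ⊕ Y' ≃ S) (f : X ≃ X')
    (g : Y ≃ Y') (i : ℤ) :
    cosign s i * (detC f.optionCongr * detC g.optionCongr) =
      cosign ((f.sumCongr g).trans s) i := by
  have h := splitSign_natural ((f.sumCongr g).trans s) s f g (Equiv.refl S) rfl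
  rw [detSign_refl, mul_one] at h
  have h' := congrArg (fun z : ℤˣ => ((z : ℤ) : ℂ)) h
  simp only [Units.val_mul, Int.cast_mul] at h'
  unfold cosign
  rw [← h', Nat.card_congr f.optionCongr, Nat.card_congr g.optionCongr]
  simp only [detC]
  ring

theorem cosign_mul_self {S X Y : Type} (s : X ⊕ Y ≃ S) (i : ℤ) : cosign s i * cosign s i = 1 := by
  unfold cosign
  rw [mul_mul_mul_comm, ksign_mul_self, mul_one]
  rcases Int.units_eq_one_or (splitSign s) with h | h <;> simp [h]

/-! ### The pairing along a decomposition -/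

section pairing

variable {V : CyclicModule.{u}}

/-- The pairing of tensors in `V^∨` with the component of an element of `OrderedSplits` along a
decomposition. -/
noncomputable def pairAt (V : CyclicModule.{u}) {S X Y : Type} (s : X ⊕ Y ≃ S) {i j n : ℤ}
    (h : ((Nat.card (Option X) : ℤ) - 3 - i) + ((Nat.card (Option Y) : ℤ) - 3 - j) = n) :
    OrderedSplits V S n →ₗ[ℂ] (dual V).X (Option X) i ⊗[ℂ] (dual V).X (Option Y) j →ₗ[ℂ] ℂ :=
  cosign s i • ((tensorEv V).flip ∘ₗ restrict V s h)

theorem pairAt_apply {S X Y : Type} (s : X ⊕ Y ≃ S) {i j n : ℤ}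
    (h : ((Nat.card (Option X) : ℤ) - 3 - i) + ((Nat.card (Option Y) : ℤ) - 3 - j) = n)
    (r : OrderedSplits V S n) (t : (dual V).X (Option X) i ⊗[ℂ] (dual V).X (Option Y) j) :
    pairAt V s h r t = cosign s i * tensorEv V t (restrict V s h r) := rfl

/-- The determinant signs in the action on V^∨ are absorbed by the naturality of `cosign`. This
gives the naturality axiom of `edgeFormOf`. -/
theorem pairAt_map {S X Y X' Y' : Type} [Finite S] (s : X' ⊕ Y' ≃ S) (f : X ≃ X') (g : Y ≃ Y')
    {i j i' j' n : ℤ} (hi : i = i') (hj : j = j')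
    (h : ((Nat.card (Option X) : ℤ) - 3 - i) + ((Nat.card (Option Y) : ℤ) - 3 - j) = n)
    (h' : ((Nat.card (Option X') : ℤ) - 3 - i') + ((Nat.card (Option Y') : ℤ) - 3 - j') = n)
    (r : OrderedSplits V S n) (t : (dual V).X (Option X) i ⊗[ℂ] (dual V).X (Option Y) j) :
    pairAt V s h' r (TensorProduct.map ((dual V).map f.optionCongr hi)
      ((dual V).map g.optionCongr hj) t) = pairAt V ((f.sumCongr g).trans s) h r t := by
  subst hi hj
  have hX : Nat.card (Option X) = Nat.card (Option X') := Nat.card_congr f.optionCongr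
  have hY : Nat.card (Option Y) = Nat.card (Option Y') := Nat.card_congr g.optionCongr
  rw [pairAt_apply, pairAt_apply,
    tensorEv_map _ _ _ _ _ _ (fun u x => dualEv_map f.optionCongr rfl u x)
      (fun u x => dualEv_map g.optionCongr rfl u x), ← mul_assoc, cosign_natural,
    restrict_natural s f g (by rw [hX]) (by rw [hY]) h h']
  rfl

/-- For r fixed by the exchange, this becomes the symmetry axiom of `edgeFormOf`. -/
theorem pairAt_comm {S X Y : Type} [Finite S] (s : X ⊕ Y ≃ S) {i j n : ℤ}
    (h : ((Nat.card (Option X) : ℤ) - 3 - i) + ((Nat.card (Option Y) : ℤ) - 3 - j) = n)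
    (h' : ((Nat.card (Option Y) : ℤ) - 3 - j) + ((Nat.card (Option X) : ℤ) - 3 - i) = n)
    (r : OrderedSplits V S n) (f : (dual V).X (Option X) i) (g : (dual V).X (Option Y) j) :
    pairAt V ((Equiv.sumComm Y X).trans s) h' (exchange V S n r) (g ⊗ₜ f) =
      ksign (i * j) * pairAt V s h r (f ⊗ₜ g) := by
  rw [pairAt_apply, pairAt_apply, restrict_exchange s h, map_smul, smul_eq_mul, ← mul_assoc,
    mul_comm (cosign _ _), cosign_comm, mul_assoc]
  congr 2
  generalize restrict V s h r = z
  induction z using TensorProduct.induction_on with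
  | zero => simp only [map_zero]
  | add x y hx hy => simp only [map_add, hx, hy]
  | tmul a b =>
    rw [TensorProduct.comm_tmul, tensorEv_tmul, tensorEv_tmul, mul_comm]

/-! ### The total pairing and its nondegeneracy -/

open Classical in
/-- The total pairing of the sums over ordered decompositions. -/
noncomputable def splitsPairing (V : CyclicModule.{u}) (S : Type) (m n : ℤ) :
    OrderedSplits (dual V) S m →ₗ[ℂ] Module.Dual ℂ (OrderedSplits V S n) :=
  DirectSum.toModule ℂ (Set S × ℤ) _ (splitPairing V S m n)

theorem pairing_apply (S : Type) (m : ℤ) (t : T1 (dual V) S m)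
    (r : T1 V S ((Nat.card S : ℤ) - 3 - (m + 1))) :
    T1.pairing V S m t r = (1 / 2 : ℂ) * splitsPairing V S m _ t.1 r.1 := rfl

open Classical in
theorem splitsPairing_lof {S : Type} (m n : ℤ) (Z : Set S) (k : ℤ)
    (h : ((Nat.card (Option Z) : ℤ) - 3 - k) +
      ((Nat.card (Option (Zᶜ : Set S)) : ℤ) - 3 - (m - k)) = n)
    (t : (dual V).X (Option Z) k ⊗[ℂ] (dual V).X (Option (Zᶜ : Set S)) (m - k))
    (r : OrderedSplits V S n) :
    splitsPairing V S m n (DirectSum.lof ℂ (Set S × ℤ)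
        (fun x => (dual V).X (Option x.1) x.2 ⊗[ℂ]
          (dual V).X (Option (x.1ᶜ : Set S)) (m - x.2)) (Z, k) t) r =
      pairAt V (split Z) h r t := by
  have h1 : splitsPairing V S m n (DirectSum.lof ℂ (Set S × ℤ)
        (fun x => (dual V).X (Option x.1) x.2 ⊗[ℂ]
          (dual V).X (Option (x.1ᶜ : Set S)) (m - x.2)) (Z, k) t) =
      splitPairing V S m n (Z, k) t :=
    DirectSum.toModule_lof (R := ℂ) (M := fun x : Set S × ℤ => (dual V).X (Option x.1) x.2 ⊗[ℂ]
          (dual V).X (Option (x.1ᶜ : Set S)) (m - x.2)) (φ := splitPairing V S m n) (Z, k) t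
  have h2 : ((Equiv.refl _).sumCongr (Equiv.refl _)).trans (split Z) = split Z := by
    ext (z | z) <;> rfl
  refine (LinearMap.congr_fun h1 r).trans ?_
  rw [pairAt_apply, restrict_eq (split Z) h Z (Equiv.refl _) (Equiv.refl _) h2]
  have h3 : n - ((Nat.card (Option Z) : ℤ) - 3 - k) =
      (Nat.card (Option (Zᶜ : Set S)) : ℤ) - 3 - (m - k) := by omega
  refine (LinearMap.congr_fun (LinearMap.congr_fun
    (dif_pos h3 : splitPairing V S m n (Z, k) = _) t) r).trans ?_
  refine congrArg (cosign (split Z) k * ·) (congrArg (tensorEv V t) ?_)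
  refine LinearMap.congr_fun (f := TensorProduct.map LinearMap.id (V.map (Equiv.refl _) _)) ?_ _
  congr 1
  · ext a
    exact (V.map_refl a).symm.trans
      (congrArg (fun e => V.map e rfl a) Equiv.optionCongr_refl.symm)
  · exact congrArg (fun e => V.map e h3) Equiv.optionCongr_refl.symm

theorem card_option_add {S : Type} [Finite S] (Z : Set S) (m k : ℤ) :
    ((Nat.card (Option Z) : ℤ) - 3 - k) +
      ((Nat.card (Option (Zᶜ : Set S)) : ℤ) - 3 - (m - k)) = (Nat.card S : ℤ) - 3 - (m + 1) := by
  have := card_option_add_card_option (split Z)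
  omega

/-- Summand by summand this is `pairAt_comm`, after transport from Z to its double complement. -/
theorem splitsPairing_exchange {S : Type} [Finite S] (m : ℤ) (t : OrderedSplits (dual V) S m)
    (r : OrderedSplits V S ((Nat.card S : ℤ) - 3 - (m + 1))) :
    splitsPairing V S m _ (exchange (dual V) S m t) (exchange V S _ r) =
      splitsPairing V S m _ t r := by
  classical
  refine LinearMap.congr_fun (f := (splitsPairing V S m _).flip (exchange V S _ r) ∘ₗ
    exchange (dual V) S m) (g := (splitsPairing V S m _).flip r)
    (orderedSplits_ext fun Z k f g => ?_) t
  rw [LinearMap.comp_apply, exchange_lof, map_smul, LinearMap.flip_apply, LinearMap.flip_apply,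
    splitsPairing_lof m _ _ _ (card_option_add _ _ _),
    splitsPairing_lof m _ _ _ (card_option_add _ _ _)]
  have hs : (Equiv.sumComm (Zᶜ : Set S) Z).trans (split Z) = ((Equiv.refl _).sumCongr
      (Equiv.setCongr (compl_compl Z).symm)).trans (split Zᶜ) := by
    ext (z | z) <;> simp [split]
  have hc := card_option_add Z m k
  have h1 := pairAt_map (V := V) (split Zᶜ) (Equiv.refl _) (Equiv.setCongr (compl_compl Z).symm)
    rfl (sub_sub_cancel m k).symm (by omega) (card_option_add _ _ _) (exchange V S _ r) (g ⊗ₜ f)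
  rw [TensorProduct.map_tmul, Equiv.optionCongr_refl, (dual V).map_refl, ← hs,
    pairAt_comm (split Z) hc] at h1
  rw [h1, smul_eq_mul, ← mul_assoc, ksign_mul_self, one_mul]

/-- The edge form on `V^∨` defined by an element of `𝕋₁V`. -/
noncomputable def edgeFormOf {S : Type} [Finite S] {m : ℤ}
    (r : T1 V S ((Nat.card S : ℤ) - 3 - (m + 1))) : EdgeForm (dual V) S m where
  form s _ _ h := TensorProduct.curry (pairAt V s
    (by have := card_option_add_card_option s; omega) r.1)
  form_map s f g _ _ _ _ hi hj h h' a b := by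
    rw [TensorProduct.curry_apply, TensorProduct.curry_apply, ← TensorProduct.map_tmul, pairAt_map]
  form_comm s i j h h' a b := by
    have hr : exchange V S _ r.1 = r.1 := r.2
    have hc := card_option_add_card_option s
    have := pairAt_comm s (i := j) (j := i) (by omega) (by omega) r.1 b a
    rw [hr, mul_comm j] at this
    exact this

/-- The pairing on 𝕋₁V^∨ extends to a functional on all of 𝕋₊V^∨, so it can be compared with the
image of ψ there. -/
theorem functional_toFree {S : Type} [Finite S] {m : ℤ}
    (r : T1 V S ((Nat.card S : ℤ) - 3 - (m + 1))) (t : T1 (dual V) S m) :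
    (edgeFormOf r).functional (T1.toFree (dual V) S m t) = T1.pairing V S m t r := by
  classical
  rw [pairing_apply, toFree_apply]
  refine (map_smul (edgeFormOf r).functional _ _).trans (congrArg ((1 / 2 : ℂ) * ·) ?_)
  refine LinearMap.congr_fun (f := (edgeFormOf r).functional ∘ₗ sumEdge (dual V) S m)
    (g := (splitsPairing V S m _).flip r.1) (orderedSplits_ext fun Z k f g => ?_) t.1
  rw [LinearMap.comp_apply, sumEdge_lof, EdgeForm.functional_edge, LinearMap.flip_apply,
    splitsPairing_lof m _ _ _ (card_option_add _ _ _)]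
  rfl

open Classical in
theorem restrict_split_lof {S : Type} {n p q : ℤ} (h : p + q = n) (Z : Set S)
    (a : V.X (Option Z) p) (b : V.X (Option (Zᶜ : Set S)) (n - p)) :
    restrict V (split Z) h (DirectSum.lof ℂ (Set S × ℤ)
        (fun x => V.X (Option x.1) x.2 ⊗[ℂ] V.X (Option (x.1ᶜ : Set S)) (n - x.2)) (Z, p)
        (a ⊗ₜ b)) = a ⊗ₜ V.map (Equiv.refl _) (by omega) b := by
  have h2 : ((Equiv.refl _).sumCongr (Equiv.refl _)).trans (split Z) = split Z := by
    ext (z | z) <;> rfl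
  have := restrict_lof h Z (Equiv.refl _) (Equiv.refl _) a b
  rwa [h2, Equiv.refl_symm, Equiv.refl_symm, Equiv.optionCongr_refl, Equiv.optionCongr_refl,
    V.map_refl] at this

theorem range_split_inl {S : Type} (Z : Set S) : Set.range (split Z ∘ Sum.inl) = Z := by
  ext z
  simp [split]

-- Pairing with a tensor concentrated in one summand reads off a single component of t, up to the
-- sign `cosign`.
open Classical in
theorem splitsPairing_lof_right {S : Type} [Finite S] (m : ℤ) (Z : Set S) (k : ℤ)
    (h : (Nat.card (Option (Zᶜ : Set S)) : ℤ) - 3 - (m - k) =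
      (Nat.card S : ℤ) - 3 - (m + 1) - ((Nat.card (Option Z) : ℤ) - 3 - k))
    (t : OrderedSplits (dual V) S m) (a : V.X (Option Z) ((Nat.card (Option Z) : ℤ) - 3 - k))
    (b : V.X (Option (Zᶜ : Set S)) ((Nat.card (Option (Zᶜ : Set S)) : ℤ) - 3 - (m - k))) :
    splitsPairing V S m _ t (DirectSum.lof ℂ (Set S × ℤ)
        (fun x => V.X (Option x.1) x.2 ⊗[ℂ] V.X (Option (x.1ᶜ : Set S))
          ((Nat.card S : ℤ) - 3 - (m + 1) - x.2)) (Z, (Nat.card (Option Z) : ℤ) - 3 - k)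
        (a ⊗ₜ V.map (Equiv.refl _) h b)) =
      cosign (split Z) k * tensorEv V (DirectSum.component ℂ (Set S × ℤ)
        (fun x => (dual V).X (Option x.1) x.2 ⊗[ℂ]
          (dual V).X (Option (x.1ᶜ : Set S)) (m - x.2)) (Z, k) t) (a ⊗ₜ b) := by
  set u : OrderedSplits V S ((Nat.card S : ℤ) - 3 - (m + 1)) := DirectSum.lof ℂ (Set S × ℤ)
        (fun x => V.X (Option x.1) x.2 ⊗[ℂ] V.X (Option (x.1ᶜ : Set S))
          ((Nat.card S : ℤ) - 3 - (m + 1) - x.2)) (Z, (Nat.card (Option Z) : ℤ) - 3 - k)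
        (a ⊗ₜ V.map (Equiv.refl _) h b) with hu
  refine LinearMap.congr_fun (f := (splitsPairing V S m _).flip u)
    (g := cosign (split Z) k • ((tensorEv V).flip (a ⊗ₜ b) ∘ₗ DirectSum.component ℂ (Set S × ℤ)
        (fun x => (dual V).X (Option x.1) x.2 ⊗[ℂ]
          (dual V).X (Option (x.1ᶜ : Set S)) (m - x.2)) (Z, k)))
    (orderedSplits_ext fun Z' k' f g => ?_) t
  rw [LinearMap.flip_apply, splitsPairing_lof m _ _ _ (card_option_add _ _ _), pairAt_apply,
    LinearMap.smul_apply, LinearMap.comp_apply, LinearMap.flip_apply, smul_eq_mul]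
  by_cases hZ : (Z', k') = (Z, k)
  · obtain ⟨rfl, rfl⟩ := Prod.mk.inj hZ
    rw [hu, restrict_split_lof, V.map_trans, DirectSum.component.lof_self]
    congr 3
    exact V.map_refl b
  · rw [hu, restrict_lof_of_ne, map_zero, mul_zero, DirectSum.component.of, dif_neg hZ, map_zero,
      LinearMap.zero_apply, mul_zero]
    rw [range_split_inl]
    intro h0
    obtain ⟨rfl, h0⟩ := Prod.mk.inj h0
    exact hZ (Prod.ext rfl (by dsimp only; omega))

/-- Only symmetric test elements are available, so a tensor u in one summand is replaced by its
symmetrization. Since t is symmetric and the pairing is invariant, this doubles the value at u,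
which determines the component of t. -/
theorem eq_zero_of_pairing_eq_zero [∀ S i, FiniteDimensional ℂ (V.X S i)] {S : Type} [Finite S]
    {m : ℤ} {t : T1 (dual V) S m} (ht : T1.pairing V S m t = 0) : t = 0 := by
  classical
  refine Subtype.ext (DFinsupp.ext fun x => ?_)
  obtain ⟨Z, k⟩ := x
  have hc := card_option_add Z m k
  refine tensorEv_injective (V := V) ?_
  refine TensorProduct.ext' fun a b => ?_
  have hd : (Nat.card (Option (Zᶜ : Set S)) : ℤ) - 3 - (m - k) =
      (Nat.card S : ℤ) - 3 - (m + 1) - ((Nat.card (Option Z) : ℤ) - 3 - k) := by omega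
  have h1 := splitsPairing_lof_right m Z k hd t.1 a b
  set u : OrderedSplits V S ((Nat.card S : ℤ) - 3 - (m + 1)) := DirectSum.lof ℂ (Set S × ℤ)
        (fun x => V.X (Option x.1) x.2 ⊗[ℂ] V.X (Option (x.1ᶜ : Set S))
          ((Nat.card S : ℤ) - 3 - (m + 1) - x.2)) (Z, (Nat.card (Option Z) : ℤ) - 3 - k)
        (a ⊗ₜ V.map (Equiv.refl _) hd b) with hu
  have h2 := LinearMap.congr_fun ht (symmetrize u)
  rw [pairing_apply] at h2
  have h3 : splitsPairing V S m _ t.1 (exchange V S _ u) = splitsPairing V S m _ t.1 u := by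
    have ht' : exchange (dual V) S m t.1 = t.1 := t.2
    have := splitsPairing_exchange m t.1 u
    rwa [ht'] at this
  have h4 : splitsPairing V S m _ t.1 (u + exchange V S _ u) = 0 := by
    have : (1 / 2 : ℂ) * splitsPairing V S m _ t.1 (u + exchange V S _ u) = 0 := h2
    simpa using this
  rw [map_add, h3, ← two_mul] at h4
  have h5 : splitsPairing V S m _ t.1 u = 0 := by simpa using h4
  rw [h1] at h5
  have h6 := congrArg (cosign (split Z) k * ·) h5
  simp only [← mul_assoc, cosign_mul_self, one_mul, mul_zero] at h6
  refine Eq.trans h6 ?_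
  exact (LinearMap.congr_fun (map_zero (tensorEv V)) _).symm

theorem pairing_injective [∀ S i, FiniteDimensional ℂ (V.X S i)] {S : Type} [Finite S] (m : ℤ) :
    Function.Injective (T1.pairing V S m) := by
  intro t t' h
  have h1 : T1.pairing V S m (t + (-1 : ℂ) • t') = 0 := by
    refine ((T1.pairing V S m).map_add _ _).trans ?_
    refine (congrArg₂ (· + ·) h ((T1.pairing V S m).map_smul (-1) t')).trans ?_
    rw [neg_one_smul, add_neg_cancel]
  have h2 := eq_zero_of_pairing_eq_zero h1
  calc t = t + ((-1 : ℂ) + 1) • t' := by rw [neg_add_cancel, zero_smul, add_zero]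
    _ = (t + (-1 : ℂ) • t') + t' := by rw [add_smul, one_smul, add_assoc]
    _ = t' := by rw [h2, zero_add]

end pairing

theorem eval_edge {V : CyclicModule.{v}} {A : CyclicOperad.{u}} (φ : V.Hom A.toCyclicModule)
    {S X Y : Type} (s : X ⊕ Y ≃ S) {i j k : ℤ} (h : i + j = k)
    (t : V.X (Option X) i ⊗[ℂ] V.X (Option Y) j) :
    eval φ (edge s h t) = compose A s h (TensorProduct.map (φ.f _ _) (φ.f _ _) t) := by
  induction t using TensorProduct.induction_on with
  | zero => simp only [map_zero]
  | add x y hx hy => simp only [map_add, hx, hy]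
  | tmul a b =>
    rw [TensorProduct.map_tmul, edge_tmul, compose_tmul, eval_map, eval_comp, eval_gen, eval_gen]

/-- A functional which vanishes on the kernel of a linear map factors through it. -/
theorem exists_dual_comp_eq {E : Type u} {F : Type v} [AddCommMonoid E] [Module ℂ E]
    [AddCommGroup F] [Module ℂ F] (L : E →ₗ[ℂ] F) (g : E →ₗ[ℂ] ℂ)
    (h : ∀ x, L x = 0 → g x = 0) : ∃ f : F →ₗ[ℂ] ℂ, ∀ x, f (L x) = g x := by
  let _ : AddCommGroup E := Module.addCommMonoidToAddCommGroup ℂ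
  have h1 : g ∈ (LinearMap.ker L).dualAnnihilator := (Submodule.mem_dualAnnihilator _).2 h
  rw [← LinearMap.range_dualMap_eq_dualAnnihilator_ker] at h1
  obtain ⟨f, hf⟩ := h1
  exact ⟨f, LinearMap.congr_fun hf⟩

section quadraticDual

variable {V : CyclicModule.{v}} {A : CyclicOperad.{u}} [A.FinDim] (φ : V.Hom A.toCyclicModule)

/-! ### The values of `ψ` on generators -/

theorem cobarGen_eq_sum {S : Type} [Finite S] {n j : ℤ} (h : j + 1 = n)
    (f : (dual A.toCyclicModule).X S n) : cobarGen A h f =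
      (1 / 2 : ℂ) • ∑ x ∈ (dual_finite_support A (S := S)).toFinset, cobarTerm A n j x f := by
  rw [cobarGen_apply]
  congr 1
  refine finsum_eq_sum_of_support_subset _ fun x hx => ?_
  rw [Set.Finite.coe_toFinset]
  by_contra hn
  have := not_nontrivial_iff_subsingleton.1 hn
  refine hx ?_
  exact (congrArg (edge _ _) (Subsingleton.elim _ 0)).trans (map_zero _)

/-- Every term of ψ has at least one edge. This yields the injectivity of V^∨ → A^! and the
vanishing of one-edge functionals on ψ of compositions. -/
theorem aug_psi {S : Type} {i j : ℤ} (h : j + 1 = i) (x : FreeX (dual A.toCyclicModule) S i) :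
    aug (dual V) (fmap φ.dual (cobarDiff A h x)) = 0 := by
  induction x using FreeX.induction generalizing j with
  | @gen S i f =>
    rw [cobarDiff_gen]
    by_cases hS : Finite S
    · rw [cobarGen_eq_sum, map_smul, map_smul, map_sum, map_sum]
      refine (congrArg _ (Finset.sum_eq_zero fun x _ => ?_)).trans (smul_zero _)
      exact (congrArg (aug (dual V)) (fmap_edge φ.dual _ _ _)).trans (aug_edge _ _ _)
    · rw [cobarGen_infinite A hS, map_zero, map_zero]
  | add x y hx hy => rw [map_add, map_add, map_add, hx, hy, add_zero]
  | smul c x hx => rw [map_smul, map_smul, map_smul, hx, smul_zero]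
  | map g e x hx =>
    subst e
    rw [← cobarDiff_map A g rfl rfl h, fmap_map, aug_map, hx, map_zero]
  | @comp S T p q r e x y hx hy =>
    rw [cobarDiff_comp A (i' := p - 1) (j' := q - 1) e (by omega) (by omega) h (by omega)
      (by omega), map_add, map_smul, fmap_comp, fmap_comp, map_add, map_smul, aug_comp, aug_comp,
      smul_zero, add_zero]

theorem exists_toFree_eq_psi {S : Type} {n m : ℤ} (h : m + 1 = n)
    (f : (dual A.toCyclicModule).X S n) :
    ∃ t : T1 (dual V) S m, T1.toFree (dual V) S m t = fmap φ.dual (cobarGen A h f) := by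
  classical
  by_cases hS : Finite S
  swap
  · exact ⟨0, by rw [cobarGen_infinite A hS, map_zero, map_zero]; rfl⟩
  let c : OrderedSplits (dual V) S m := ∑ x ∈ (dual_finite_support A (S := S)).toFinset,
    DirectSum.lof ℂ (Set S × ℤ) (fun x => (dual V).X (Option x.1) x.2 ⊗[ℂ]
      (dual V).X (Option (x.1ᶜ : Set S)) (m - x.2)) x (TensorProduct.map (φ.dual.f _ _)
        (φ.dual.f _ _) (cocompose A (split x.1) x.2 (m - x.2) n f))
  -- The factor 1/2 is the one in `cobarGen`; symmetrizing makes it unnecessary to show that `c` is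
  -- already symmetric.
  refine ⟨symmetrize ((1 / 2 : ℂ) • c), (toFree_symmetrize _).trans ?_⟩
  rw [cobarGen_eq_sum, map_smul, map_smul, map_sum, map_sum]
  refine congrArg _ (Finset.sum_congr rfl fun x _ => ?_)
  exact (sumEdge_lof _ _ _ _ _).trans (fmap_edge φ.dual _ _ _).symm

/-! ### Adjointness of ψ on generators with the map 𝕋₁V → A -/

/-- The same sign `cosign` enters the pairing and the adjoint of the composition, so it cancels. -/
theorem functional_psi_term {S : Type} [Finite S] {m : ℤ}
    (r : T1 V S ((Nat.card S : ℤ) - 3 - (m + 1))) (f : (dual A.toCyclicModule).X S (m + 1))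
    (x : Set S × ℤ) :
    (edgeFormOf r).functional (fmap φ.dual (cobarTerm A (m + 1) m x f)) =
      dualEv A.toCyclicModule f (compose A (split x.1) (card_option_add x.1 m x.2)
        (TensorProduct.map (φ.f _ _) (φ.f _ _)
          (restrict V (split x.1) (card_option_add x.1 m x.2) r.1))) := by
  have h1 : fmap φ.dual (cobarTerm A (m + 1) m x f) = edge (split x.1) (add_sub_cancel x.2 m)
      (TensorProduct.map (φ.dual.f _ _) (φ.dual.f _ _)
        (cocompose A (split x.1) x.2 (m - x.2) (m + 1) f)) := fmap_edge _ _ _ _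
  rw [h1, EdgeForm.functional_edge]
  have h2 : TensorProduct.lift ((edgeFormOf r).form (split x.1) (add_sub_cancel x.2 m)) =
      pairAt V (split x.1) (card_option_add x.1 m x.2) r.1 := TensorProduct.ext' fun _ _ => rfl
  rw [h2, pairAt_apply, tensorEv_map 1 1 _ _ (φ.f _ _) (φ.f _ _)
    (fun u y => (dualEv_hom φ u y).trans (one_mul _).symm)
    (fun u y => (dualEv_hom φ u y).trans (one_mul _).symm),
    tensorEv_cocompose A _ _ _ _ (card_option_add x.1 m x.2), one_mul, one_mul, ← mul_assoc,
    cosign_mul_self, one_mul]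

theorem sum_compose_restrict {S : Type} [Finite S] {m : ℤ}
    (r : OrderedSplits V S ((Nat.card S : ℤ) - 3 - (m + 1))) :
    ∑ x ∈ (dual_finite_support A (S := S)).toFinset,
      compose A (split x.1) (card_option_add x.1 m x.2) (TensorProduct.map (φ.f _ _) (φ.f _ _)
        (restrict V (split x.1) (card_option_add x.1 m x.2) r)) = eval φ (sumEdge V S _ r) := by
  classical
  have key : (∑ x ∈ (dual_finite_support A (S := S)).toFinset,
      (compose A (split x.1) (card_option_add x.1 m x.2) ∘ₗ
        TensorProduct.map (φ.f _ _) (φ.f _ _)) ∘ₗ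
        restrict V (split x.1) (card_option_add x.1 m x.2)) =
      eval φ ∘ₗ sumEdge V S ((Nat.card S : ℤ) - 3 - (m + 1)) := by
    refine orderedSplits_ext fun Z p a b => ?_
    -- The sum is indexed by degrees k of the dual; this is the index that sees degree p of V.
    obtain ⟨k, rfl⟩ : ∃ k, p = (Nat.card (Option Z) : ℤ) - 3 - k :=
      ⟨(Nat.card (Option Z) : ℤ) - 3 - p, by ring⟩
    rw [LinearMap.sum_apply, LinearMap.comp_apply, sumEdge_lof, eval_edge,
      Finset.sum_eq_single (Z, k)]
    · rw [LinearMap.comp_apply, restrict_split_lof, LinearMap.comp_apply]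
      have : ∀ (q q' : ℤ) (hq : q = q') (b : V.X (Option (Zᶜ : Set S)) q) (h h'),
          compose A (split Z) h (TensorProduct.map (φ.f (Option Z)
            ((Nat.card (Option Z) : ℤ) - 3 - k)) (φ.f _ q')
            (a ⊗ₜ V.map (Equiv.refl _) hq b)) = compose A (split Z)
            (k := (Nat.card S : ℤ) - 3 - (m + 1)) h'
            (TensorProduct.map (φ.f (Option Z) _) (φ.f _ q) (a ⊗ₜ b)) := by
        rintro q _ rfl b h h'
        rw [V.map_refl]
      exact this _ _ _ b _ _
    · rintro ⟨Z', k'⟩ - hne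
      rw [LinearMap.comp_apply, restrict_lof_of_ne, map_zero]
      rw [range_split_inl]
      intro h0
      obtain ⟨rfl, h0⟩ := Prod.mk.inj h0
      exact hne (Prod.ext rfl (by dsimp only at h0 ⊢; omega))
    -- Outside the finite index set, A^∨ vanishes on the left vertex. Functionals separate points,
    -- so A vanishes there too and the term is zero.
    · intro hn
      rw [Set.Finite.mem_toFinset] at hn
      have h1 : Subsingleton ((dual A.toCyclicModule).X (Option Z) k) :=
        not_nontrivial_iff_subsingleton.1 hn
      have h2 : ∀ y : A.X (Option Z) ((Nat.card (Option Z) : ℤ) - 3 - k), y = 0 := fun y =>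
        (Module.forall_dual_apply_eq_zero_iff ℂ y).1 fun g =>
          LinearMap.congr_fun (h1.elim g 0 : g = 0) y
      rw [LinearMap.comp_apply, restrict_split_lof, LinearMap.comp_apply, TensorProduct.map_tmul,
        h2 (φ.f _ _ a), TensorProduct.zero_tmul, map_zero]
  have := LinearMap.congr_fun key r
  rw [LinearMap.sum_apply] at this
  exact this

/-- Here ψ on A^∨ is seen to be the adjoint of 𝕋₁V → A; the factors 1/2 in `cobarGen` and in
`T1.toFree` match. -/
theorem functional_psi_gen {S : Type} [Finite S] {m : ℤ}
    (r : T1 V S ((Nat.card S : ℤ) - 3 - (m + 1))) (f : (dual A.toCyclicModule).X S (m + 1)) :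
    (edgeFormOf r).functional (fmap φ.dual (cobarGen A rfl f)) =
      dualEv A.toCyclicModule f (eval φ (T1.toFree V S _ r)) := by
  rw [cobarGen_eq_sum, map_smul, map_smul, map_sum, map_sum,
    Finset.sum_congr rfl fun x _ => functional_psi_term φ r f x, ← map_sum,
    sum_compose_restrict, toFree_apply]
  exact (map_smul (dualEv A.toCyclicModule f) _ _).symm.trans
    (congrArg (dualEv A.toCyclicModule f) (map_smul (eval φ) _ _).symm)

/-- On a composition ψ produces at least two edges, where an edge form vanishes, so generators
suffice. The form is quantified inside the statement because bijections replace it by its pullback.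
-/
theorem functional_psi {S : Type} {i : ℤ} (x : FreeX (dual A.toCyclicModule) S i) :
    ∀ (m : ℤ) (h : m + 1 = i) (B : EdgeForm (dual V) S m),
      (∀ f, B.functional (fmap φ.dual (cobarGen A h f)) = 0) →
      B.functional (fmap φ.dual (cobarDiff A h x)) = 0 := by
  induction x using FreeX.induction with
  | gen f => exact fun m h B hB => hB f
  | add x y hx hy =>
    intro m h B hB
    rw [map_add, map_add, map_add, hx m h B hB, hy m h B hB, add_zero]
  | smul c x hx =>
    intro m h B hB
    rw [map_smul, map_smul, map_smul, hx m h B hB, smul_zero]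
  | map g e x hx =>
    subst e
    intro m h B hB
    rw [← cobarDiff_map A g rfl rfl h, fmap_map, EdgeForm.functional_map]
    refine hx m h _ fun f => ?_
    rw [← EdgeForm.functional_map, ← fmap_map, cobarGen_natural A g rfl rfl h h]
    exact hB _
  | @comp S T p q r e x y _ _ =>
    intro m h B _
    rw [cobarDiff_comp A (i' := p - 1) (j' := q - 1) e (by omega) (by omega) h (by omega)
      (by omega), map_add, map_smul, fmap_comp, fmap_comp, map_add, map_smul,
      EdgeForm.functional_comp, EdgeForm.functional_comp, aug_psi, aug_psi, map_zero, map_zero,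
      LinearMap.zero_apply, smul_zero, add_zero]

/-! ### The naive dual -/

variable {φ}

/-- By the universal property, the quotient map is the extension of its restriction to generators;
hence ker(𝕋₊V^∨ → A^!) is the image of ψ. -/
theorem lift_naiveDualGen (hI : IsIdeal (free (dual V)) (psiRange φ)) {S : Type} {i : ℤ}
    (x : (free (dual V)).X S i) :
    (lift (naiveDualGen φ hI)).f S i x = (psiRange φ S i).mkQ x :=
  (lift_unique (naiveDualGen φ hI) ((free (dual V)).quotientMap (psiRange φ) hI)
    (fun _ _ _ => rfl) S i x).symm

theorem lift_naiveDualGen_eq_zero (hI : IsIdeal (free (dual V)) (psiRange φ)) {S : Type} {i : ℤ}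
    (x : (free (dual V)).X S i) :
    (lift (naiveDualGen φ hI)).f S i x = 0 ↔ x ∈ psiRange φ S i := by
  rw [lift_naiveDualGen]
  exact Submodule.Quotient.mk_eq_zero _

theorem mem_relations_naiveDualGen (hI : IsIdeal (free (dual V)) (psiRange φ)) {S : Type} {m : ℤ}
    (t : T1 (dual V) S m) : t ∈ relations (naiveDualGen φ hI) S m ↔
      T1.toFree (dual V) S m t ∈ psiRange φ S m :=
  lift_naiveDualGen_eq_zero hI _

/-- The Leibniz rule puts the image of ψ into the ideal generated by its values on generators. These
come from 𝕋₁V^∨ and lie in the kernel, so they are relations. -/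
theorem isQuadratic_naiveDualGen (hI : IsIdeal (free (dual V)) (psiRange φ)) :
    IsQuadratic (naiveDualGen φ hI) where
  injective S i := by
    refine (injective_iff_map_eq_zero _).2 fun f hf => ?_
    have h1 : FreeX.gen f ∈ psiRange φ S i := (lift_naiveDualGen_eq_zero hI _).1 hf
    obtain ⟨x, hx⟩ := (mem_psiRange A φ).1 h1
    rw [← aug_gen f, ← hx, aug_psi]
  generates S i y := by
    obtain ⟨x, rfl⟩ := Submodule.mkQ_surjective (psiRange φ S i) y
    exact ⟨x, lift_naiveDualGen hI x⟩
  ker_eq S i := by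
    have h1 : LinearMap.ker ((lift (naiveDualGen φ hI)).f S i) = psiRange φ S i :=
      Submodule.ext fun x => lift_naiveDualGen_eq_zero hI x
    rw [h1]
    refine le_antisymm ?_ (idealSpan_le hI ?_ S i)
    · have hJ := isIdeal_idealSpan (free (dual V)) (fun S n =>
        (relations (naiveDualGen φ hI) S n).map (T1.toFree (dual V) S n))
      have key : ∀ {S : Type} {i : ℤ} (x : FreeX (dual A.toCyclicModule) S i) (j : ℤ)
          (h : j + 1 = i), fmap φ.dual (cobarDiff A h x) ∈ idealSpan (free (dual V))
            (fun S n => (relations (naiveDualGen φ hI) S n).map (T1.toFree (dual V) S n)) S j := by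
        intro S i x
        induction x using FreeX.induction with
        | gen f =>
          intro j h
          obtain ⟨t, ht⟩ := exists_toFree_eq_psi φ h f
          refine le_idealSpan _ _ _ ⟨t, (mem_relations_naiveDualGen hI t).2 ?_, ht⟩
          rw [ht]
          exact psi_mem A φ h (FreeX.gen f)
        | add x y hx hy =>
          intro j h
          rw [map_add, map_add]
          exact Submodule.add_mem _ (hx j h) (hy j h)
        | smul c x hx =>
          intro j h
          rw [map_smul, map_smul]
          exact Submodule.smul_mem _ c (hx j h)
        | map g e x hx =>
          subst e
          intro j h
          rw [← cobarDiff_map A g rfl rfl h, fmap_map]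
          exact hJ.map_mem g rfl _ (hx j h)
        | @comp S T p q r e x y hx hy =>
          intro j h
          rw [cobarDiff_comp A (i' := p - 1) (j' := q - 1) e (by omega) (by omega) h (by omega)
            (by omega), map_add, map_smul, fmap_comp, fmap_comp]
          exact Submodule.add_mem _ (hJ.comp_left _ _ _ (hx (p - 1) (by omega)))
            (Submodule.smul_mem _ _ (hJ.comp_right _ _ _ (hy (q - 1) (by omega))))
      intro y hy
      obtain ⟨x, rfl⟩ := (mem_psiRange A φ).1 hy
      exact key x i rfl
    · rintro S n _ ⟨t, ht, rfl⟩
      exact (mem_relations_naiveDualGen hI t).1 ht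

/-! ### Identification of the relations with R^⊥ -/

theorem orderedSplits_subsingleton (W : CyclicModule.{w}) {S : Type} (hS : ¬ Finite S) (n : ℤ) :
    Subsingleton (OrderedSplits W S n) := by
  have h : ∀ x : Set S × ℤ, Subsingleton
      (W.X (Option x.1) x.2 ⊗[ℂ] W.X (Option (x.1ᶜ : Set S)) (n - x.2)) := by
    intro x
    by_cases h1 : Finite x.1
    · have h2 : Infinite (x.1ᶜ : Set S) := by
        rw [← not_finite_iff_infinite]
        intro h2
        exact hS (Finite.of_equiv _ (split x.1))
      have := W.stable (Option (x.1ᶜ : Set S)) (n - x.2) (by simp)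
      infer_instance
    · have h2 : Infinite x.1 := not_finite_iff_infinite.1 h1
      have := W.stable (Option x.1) x.2 (by simp)
      infer_instance
  exact ⟨fun a b => DFinsupp.ext fun x => (h x).elim _ _⟩

theorem mem_orthogonal {R : ∀ (S : Type) (n : ℤ), Submodule ℂ (T1 V S n)} {S : Type} {m : ℤ}
    {t : T1 (dual V) S m} : t ∈ orthogonal R S m ↔ ∀ r ∈ R S ((Nat.card S : ℤ) - 3 - (m + 1)),
      T1.pairing V S m t r = 0 :=
  ⟨fun h r hr => LinearMap.congr_fun (LinearMap.mem_ker.1 h) ⟨r, hr⟩,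
    fun h => LinearMap.mem_ker.2 (LinearMap.ext fun r => h r.1 r.2)⟩

/-- For r in R, the functional of r vanishes on ψ of generators by adjointness, hence on the whole
image of ψ. Conversely, an element orthogonal to R is ψ of a single generator f. -/
theorem IsQuadratic.relations_naiveDualGen (hA : IsQuadratic φ)
    (hI : IsIdeal (free (dual V)) (psiRange φ)) (S : Type) (m : ℤ) :
    relations (naiveDualGen φ hI) S m = orthogonal (relations φ) S m := by
  by_cases hS : Finite S
  swap
  · have := orderedSplits_subsingleton (dual V) hS m
    exact Subsingleton.elim _ _
  have := hA.finDim
  refine Submodule.ext fun t => ?_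
  rw [mem_relations_naiveDualGen, mem_orthogonal]
  constructor
  · intro ht r hr
    obtain ⟨x, hx⟩ := (mem_psiRange A φ).1 ht
    rw [← functional_toFree, ← hx]
    refine functional_psi φ x m rfl _ fun f => ?_
    rw [functional_psi_gen]
    exact (congrArg (dualEv A.toCyclicModule f) (LinearMap.mem_ker.1 hr)).trans (map_zero _)
  · intro ht
    -- The functional of t vanishes on R = ker(𝕋₁V → A), so it factors through A; the factorization
    -- is an element of A^∨ of degree m + 1.
    obtain ⟨f, hf⟩ : ∃ f : (dual A.toCyclicModule).X S (m + 1), ∀ r,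
        dualEv A.toCyclicModule f (eval φ (T1.toFree V S _ r)) = T1.pairing V S m t r :=
      exists_dual_comp_eq ((lift φ).f S _ ∘ₗ T1.toFree V S _) (T1.pairing V S m t) ht
    obtain ⟨t', ht'⟩ := exists_toFree_eq_psi φ rfl f
    -- Both have the same pairing with every r, by adjointness and the choice of f.
    have h2 : t' = t := by
      refine pairing_injective m (LinearMap.ext fun r => ?_)
      rw [← functional_toFree, ht', functional_psi_gen, hf]
    rw [← h2, ht']
    exact psi_mem A φ rfl (FreeX.gen f)

end quadraticDual

end CycOp


theorem mainTheorem10 (A : CycOp.CyclicOperad.{u}) [A.FinDim] (V : CycOp.CyclicModule.{v})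
    (φ : V.Hom A.toCyclicModule) (hA : CycOp.IsQuadratic φ) :
    ∃ hI : CycOp.IsIdeal (CycOp.free (CycOp.dual V)) (CycOp.psiRange φ),
      (CycOp.naiveDual φ hI).FinDim ∧
      CycOp.IsQuadratic (CycOp.naiveDualGen φ hI) ∧
      ∀ (S : Type) (m : ℤ),
        CycOp.relations (CycOp.naiveDualGen φ hI) S m =
          CycOp.orthogonal (CycOp.relations φ) S m :=
  ⟨hA.isIdeal_psiRange, hA.naiveDual_finDim, CycOp.isQuadratic_naiveDualGen _,
    hA.relations_naiveDualGen _⟩
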